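/- **Model.** Let $k_1,k_2,n\ge 1$, let $R^*\in\mathbb R^{p_1\times k_1}$, $C^*\in\mathbb R^{p_2\times k_2}$ be deterministic and let $X_i=R^*F_iC^{*\top}+U_i\in\mathbb R^{p_1\times p_2}$, where the pairs $(F_i,U_i)$ of random matrices $F_i\in\mathbb R^{k_1\times k_2}$, $U_i\in\mathbb R^{p_1\times p_2}$ are i.i.d. ($F_i$ and $U_i$ need not be independent of each other). Fix constants $c_0,c_R,C_R,c_C,C_C,c_U\in\mathbb R$ and $K\ge 0$ with $c_R,c_C>0$, and assume: (i) all eigenvalues of $p_1^{-1}R^{*\top}R^*$ lie in $[c_R,C_R]$ and all eigenvalues of $p_2^{-1}C^{*\top}C^*$ lie in $[c_C,C_C]$; (ii) $\mathbb E[p_1^{-1}F_i^\top R^{*\top}R^*F_i]=I_{k_2}$ and $\mathbb E[p_2^{-1}F_iC^{*\top}C^*F_i^\top]=I_{k_1}$; (iii) $F_i=\Sigma_{k_1}Z_i\Sigma_{k_2}$ almost surely, with deterministic square matrices satisfying $0<\|\Sigma_{k_j}\|_2<c_0$, where for each $i$ the entries $z$ of $Z_i$ are independent, have mean zero and satisfy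 $\mathbb E e^{\lambda z}\le e^{K\lambda^2/2}$ for all $\lambda\in\mathbb R$; likewise $U_i=\Sigma_{p_1}\tilde Z_i\Sigma_{p_2}$ with the same constants $c_0,K$; (iv) writing $U_i=(u_{ab})$, $\mathbb E\big[\sum_{j}u_{aj}u_{bj}\big]\le c_U\sqrt{p_2/p_1}$ for all $a\ne b$ in $[p_1]$, and $\mathbb E\big[\sum_{j}u_{ja}u_{jb}\big]\le c_U\sqrt{p_1/p_2}$ for all $a\neq b$ in $[p_2]$. **$\alpha$-PCA.** Let $\alpha\ge-1$ be fixed. For data $X_1,\dots,X_n$ with mean $\bar X$ put $$\hat S_1=\frac1{p_1p_2}\Big[(1+\alpha)\bar X\bar X^\top+\frac1n\sum_{i=1}^n(X_i-\bar X)(X_i-\bar X)^\top\Big],$$ and let $\hat S_2$ be the same expression for $X_1^\top,\dots,X_n^\top$. The $\alpha$-PCA projection matrices are $W_j=\sqrt{p_j}\,\hat Z_j\in\mathbb R^{p_j\times k_j}$, where the columns of $\hat Z_j$ are orthonormal eigenvectors of $\hat S_j$ for its $k_j$ largest eigenvalues ($\alpha=0$ gives $\hat S_1=\frac1{p_1p_2n}\sum_iX_iX_i^\top$).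 Put $H_1=p_1^{-1}W_1^\top R^*$, $H_2=p_2^{-1}W_2^\top C^*$, and let $\nu_{\min},\nu_{\max}$ denote the smallest and the largest singular value. For $t>0$ put $$\delta_j=\sqrt{t(k_1\vee k_2)}\sqrt{\frac{\log k_j+t}{n}}+\frac1{\sqrt{p_j}},\qquad j=1,2.$$ **Claim.** (1) There are constants $c_1,c_2,c_3>0$ depending only on $\alpha,c_0,K,c_R,C_R,c_C,C_C,c_U$ (not on $p_1,p_2,k_1,k_2,n,t$ or the distributions) such that for every $t>0$ there is an event of probability at least $1-11e^{-t}$ on which, for all $\alpha$-PCA projection matrices $W_1,W_2$ computed from $X_1,\dots,X_n$, $$c_1-c_2\,\delta_j\le\nu_{\min}(H_j)\le\nu_{\max}(H_j)\le c_3\qquad\text{for both }j=1,2.$$ (2) Consequently, if the i.i.d. sample is split into a pre-training part $X_1',\dots,X_n'$ and a main part $X_1,\dots,X_N$ and $W_1,W_2$ are $\alpha$-PCA projection matrices obtained as measurable functions of the pre-training part, then these satisfy the signal and independence requirements on diversified projection matrices: $(W_1,W_2)$ is independent of $(X_1,\dots,X_N)$; and $\nu_{\min}(H_j)\gg p_j^{-1/2}$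 as $\delta_1,\delta_2\to0$, that is, for every $M>0$ there is $\varepsilon>0$, depending only on $M$ and the constants listed in (1), such that for every $t>0$ with $\delta_1,\delta_2\le\varepsilon$, with probability at least $1-11e^{-t}$, $\nu_{\min}(H_j)\ge M p_j^{-1/2}$ for both $j=1,2$. -/

import Mathlib

open MeasureTheory ProbabilityTheory
open scoped NNReal Matrix

/-- The entrywise (product) measurable structure on matrices. -/
instance matrixMeasurableSpace {m n α : Type*} [MeasurableSpace α] :
    MeasurableSpace (Matrix m n α) :=
  inferInstanceAs (MeasurableSpace (m → n → α))

noncomputable section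

/-- The largest singular value of a `k × k` matrix (singular values are listed in non-increasing
order, starting at index `0`). -/
def nuMax {k : ℕ} (A : Matrix (Fin k) (Fin k) ℝ) : ℝ :=
  (Matrix.toEuclideanLin A).singularValues 0

/-- The smallest singular value of a `k × k` matrix, `k ≥ 1`. -/
def nuMin {k : ℕ} (A : Matrix (Fin k) (Fin k) ℝ) : ℝ :=
  (Matrix.toEuclideanLin A).singularValues (k - 1)

/-- The spectral norm of a square matrix. -/
def specNorm {k : ℕ} (A : Matrix (Fin k) (Fin k) ℝ) : ℝ :=
  ‖Matrix.toEuclideanCLM (n := Fin k) (𝕜 := ℝ) A‖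

/-- The normalized Gram matrix `p⁻¹ Lᵀ L` of a `p × k` loading matrix `L`. -/
def gram {p k : ℕ} (L : Matrix (Fin p) (Fin k) ℝ) : Matrix (Fin k) (Fin k) ℝ :=
  (p : ℝ)⁻¹ • (Lᵀ * L)

theorem gram_isHermitian {p k : ℕ} (L : Matrix (Fin p) (Fin k) ℝ) : (gram L).IsHermitian := by
  unfold gram Matrix.IsHermitian
  simp [Matrix.conjTranspose_eq_transpose_of_trivial, Matrix.transpose_smul, Matrix.transpose_mul]

/-- The entrywise expectation of a random matrix. -/
def matrixExpectation {Ω : Type*} [MeasurableSpace Ω] (μ : Measure Ω) {a b : ℕ}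
    (A : Ω → Matrix (Fin a) (Fin b) ℝ) : Matrix (Fin a) (Fin b) ℝ :=
  Matrix.of fun r s => ∫ ω, A ω r s ∂μ

/-- The random `a × b` matrices `A i` are mean zero, sub-Gaussian and weakly correlated:
`A i = S₁ * Z i * S₂` with deterministic `S₁`, `S₂` of spectral norm in `(0, c₀)` and `Z i` having
independent mean-zero sub-Gaussian entries with variance proxy `K`. -/
def WeaklyCorrelatedSubGaussian {ι Ω : Type*} [MeasurableSpace Ω] (μ : Measure Ω) {a b : ℕ}
    (A : ι → Ω → Matrix (Fin a) (Fin b) ℝ) (c₀ : ℝ) (K : ℝ≥0) : Prop :=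
  ∃ (S₁ : Matrix (Fin a) (Fin a) ℝ) (S₂ : Matrix (Fin b) (Fin b) ℝ)
    (Z : ι → Ω → Matrix (Fin a) (Fin b) ℝ),
    (0 < specNorm S₁ ∧ specNorm S₁ < c₀) ∧ (0 < specNorm S₂ ∧ specNorm S₂ < c₀) ∧
    (∀ i, iIndepFun (fun (q : Fin a × Fin b) ω => Z i ω q.1 q.2) μ) ∧
    (∀ i r s, ∫ ω, Z i ω r s ∂μ = 0 ∧ HasSubgaussianMGF (fun ω => Z i ω r s) K μ) ∧
    ∀ i, ∀ᵐ ω ∂μ, A i ω = S₁ * Z i ω * S₂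

/-- The observations `X i = R * F i * Cᵀ + U i` of the matrix factor model. -/
def mfmObs {ι Ω : Type*} {p₁ p₂ k₁ k₂ : ℕ}
    (R : Matrix (Fin p₁) (Fin k₁) ℝ) (C : Matrix (Fin p₂) (Fin k₂) ℝ)
    (F : ι → Ω → Matrix (Fin k₁) (Fin k₂) ℝ) (U : ι → Ω → Matrix (Fin p₁) (Fin p₂) ℝ)
    (i : ι) (ω : Ω) : Matrix (Fin p₁) (Fin p₂) ℝ :=
  R * F i ω * Cᵀ + U i ω

/-- The assumptions of the sub-Gaussian matrix factor model on the loadings `R`, `C` and on the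
factors `F i` and idiosyncratic matrices `U i` of a sample indexed by `ι`. -/
structure IsSubGaussianMFM {ι Ω : Type*} [MeasurableSpace Ω] (μ : Measure Ω) {p₁ p₂ k₁ k₂ : ℕ}
    (R : Matrix (Fin p₁) (Fin k₁) ℝ) (C : Matrix (Fin p₂) (Fin k₂) ℝ)
    (F : ι → Ω → Matrix (Fin k₁) (Fin k₂) ℝ) (U : ι → Ω → Matrix (Fin p₁) (Fin p₂) ℝ)
    (c₀ : ℝ) (K : ℝ≥0) (cR CR cC CC cU : ℝ) : Prop where
  measurable_factor : ∀ i, Measurable (F i)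
  measurable_idio : ∀ i, Measurable (U i)
  /-- The pairs `(F i, U i)` are independent ... -/
  indep : iIndepFun (fun i ω => (F i ω, U i ω)) μ
  /-- ... and identically distributed. -/
  identDistrib : ∀ i j, IdentDistrib (fun ω => (F i ω, U i ω)) (fun ω => (F j ω, U j ω)) μ μ
  gram_row : ∀ a, cR ≤ (gram_isHermitian R).eigenvalues a ∧ (gram_isHermitian R).eigenvalues a ≤ CR
  gram_col : ∀ a, cC ≤ (gram_isHermitian C).eigenvalues a ∧ (gram_isHermitian C).eigenvalues a ≤ CC
  normalize_row : ∀ i,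
    matrixExpectation μ (fun ω => (p₁ : ℝ)⁻¹ • ((F i ω)ᵀ * (Rᵀ * R) * F i ω)) = 1
  normalize_col : ∀ i,
    matrixExpectation μ (fun ω => (p₂ : ℝ)⁻¹ • (F i ω * (Cᵀ * C) * (F i ω)ᵀ)) = 1
  factor_subGaussian : WeaklyCorrelatedSubGaussian μ F c₀ K
  idio_subGaussian : WeaklyCorrelatedSubGaussian μ U c₀ K
  idio_rows : ∀ i, ∀ r s : Fin p₁, r ≠ s →
    ∫ ω, ∑ j, U i ω r j * U i ω s j ∂μ ≤ cU * √((p₂ : ℝ) / p₁)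
  idio_cols : ∀ i, ∀ r s : Fin p₂, r ≠ s →
    ∫ ω, ∑ j, U i ω j r * U i ω j s ∂μ ≤ cU * √((p₁ : ℝ) / p₂)

/-- The sample mean of `n` matrices. -/
def sampleMean {p₁ p₂ n : ℕ} (X : Fin n → Matrix (Fin p₁) (Fin p₂) ℝ) :
    Matrix (Fin p₁) (Fin p₂) ℝ :=
  (n : ℝ)⁻¹ • ∑ i, X i

/-- The row aggregation matrix of `α`-PCA,
`(p₁ p₂)⁻¹ ((1 + α) X̄ X̄ᵀ + n⁻¹ ∑ i, (X i - X̄) (X i - X̄)ᵀ)`. -/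
def alphaPCAMatrix {p₁ p₂ n : ℕ} (α : ℝ) (X : Fin n → Matrix (Fin p₁) (Fin p₂) ℝ) :
    Matrix (Fin p₁) (Fin p₁) ℝ :=
  ((p₁ : ℝ) * p₂)⁻¹ • ((1 + α) • (sampleMean X * (sampleMean X)ᵀ) +
    (n : ℝ)⁻¹ • ∑ i, (X i - sampleMean X) * (X i - sampleMean X)ᵀ)

/-- The columns of `Q` are top `k` orthonormal eigenvectors of the symmetric matrix `S`: they are
the first `k` columns of an orthogonal matrix `V` that diagonalizes `S` with eigenvalues in
non-increasing order. -/
def IsTopEigenvectors {p k : ℕ} (S : Matrix (Fin p) (Fin p) ℝ) (Q : Matrix (Fin p) (Fin k) ℝ) :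
    Prop :=
  ∃ (hk : k ≤ p) (V : Matrix (Fin p) (Fin p) ℝ) (ev : Fin p → ℝ),
    Vᵀ * V = 1 ∧ Antitone ev ∧ S = V * Matrix.diagonal ev * Vᵀ ∧
      Q = V.submatrix id (Fin.castLE hk)

/-- `W` is an `α`-PCA estimate of the `p₁ × k` row loading matrix from the data `X`: `√p₁` times
a matrix of top `k` eigenvectors of the row aggregation matrix. -/
def IsAlphaPCARow {p₁ p₂ n k : ℕ} (α : ℝ) (X : Fin n → Matrix (Fin p₁) (Fin p₂) ℝ)
    (W : Matrix (Fin p₁) (Fin k) ℝ) : Prop :=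
  ∃ Q : Matrix (Fin p₁) (Fin k) ℝ, IsTopEigenvectors (alphaPCAMatrix α X) Q ∧ W = √(p₁ : ℝ) • Q

/-- `W` is an `α`-PCA estimate of the `p₂ × k` column loading matrix from the data `X`: a row
estimate for the transposed data. -/
def IsAlphaPCACol {p₁ p₂ n k : ℕ} (α : ℝ) (X : Fin n → Matrix (Fin p₁) (Fin p₂) ℝ)
    (W : Matrix (Fin p₂) (Fin k) ℝ) : Prop :=
  IsAlphaPCARow α (fun i => (X i)ᵀ) W

/-- The transformation matrix `H = p⁻¹ Wᵀ L` of a projection matrix `W` and a loading matrix `L`. -/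
def transformationMatrix {p k : ℕ} (W L : Matrix (Fin p) (Fin k) ℝ) : Matrix (Fin k) (Fin k) ℝ :=
  (p : ℝ)⁻¹ • (Wᵀ * L)

/-- The error `√(t (k₁ ∨ k₂)) √((log k + t) / n) + 1 / √p`. -/
def pretrainError (t : ℝ) (k₁ k₂ n k p : ℕ) : ℝ :=
  √(t * (max k₁ k₂ : ℕ)) * √((Real.log k + t) / n) + 1 / √(p : ℝ)

end

/-! The heart is a deterministic perturbation argument. Let `Q` hold the top `k` eigenvectors of the
aggregation matrix `S`, so that `H = p^{-1/2} Qᵀ R`. On the kernel of `Rᵀ` the form of `S` sees only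
noise, of size `η`; since this kernel has codimension at most `k`, Courant-Fischer gives the same
bound on the orthogonal complement of the range of `Q`. Conversely, at any `z` that form is at least
a signal part `κ |Rᵀ z|² / (2 p₁)` minus noise. If `z` is the residual of `R u` after projection
onto the range of `Q`, the two bounds make `|Rᵀ z|` small, and `|z|² = z ⬝ R u = Rᵀ z ⬝ u` then
makes `z` itself small. By Pythagoras `|Qᵀ R u|` keeps a fixed fraction of `|R u|`. No eigengap and
no convergence of eigenvectors enters (`IsAlphaPCARow.le_transformationMatrix`).

The probabilistic inputs are `η ≲ t/n + 1/p₁` and `κ ≳ 1/(log k₁ + 7)`. The noise bound, and a bound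
for the mean of the factors, come from a union bound over nets (`BilinearSubGaussian.exists_event`).
The signal needs a lower tail for a sum of independent positive semidefinite matrices
(`exists_event_le_sum`). For this the factors are truncated and multiplied up as contractions `1 -
L⁻¹ A Aᵀ` along disjoint blocks of the sample: each product has small expected Frobenius norm, a
small product forces a large sum over its block, and most of the independent blocks are good. The
Frobenius norm costs a factor `k₁`, hence the logarithm in `κ`. It is harmless because `η` beats it:
`(log k₁ + 7)/p₁ ≤ 9/√p₁`.

All this is needed only for `δ` below a threshold `ε`. Beyond it the choice `c₂ = c₁/ε` makes the
lower bound negative, and for `t < 1` the probability bound is vacuous. The upper bound holds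
because projections contract. Columns follow by transposing the model. -/

/-! ### Dot products and half nets of the Euclidean ball. -/

theorem le_of_sq_le_sq_of_nonneg {a b : ℝ} (h : a ^ 2 ≤ b ^ 2) (hb : 0 ≤ b) : a ≤ b :=
  (le_abs_self a).trans (abs_le_of_sq_le_sq h hb)

theorem dotProduct_self_nonneg' {ι : Type*} [Fintype ι] (u : ι → ℝ) : 0 ≤ u ⬝ᵥ u :=
  Finset.sum_nonneg fun i _ => mul_self_nonneg (u i)

theorem dotProduct_sq_le {ι : Type*} [Fintype ι] (u v : ι → ℝ) :
    (u ⬝ᵥ v) ^ 2 ≤ (u ⬝ᵥ u) * (v ⬝ᵥ v) := by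
  have := Finset.sum_mul_sq_le_sq_mul_sq Finset.univ u v
  simpa [dotProduct, sq] using this

theorem dotProduct_mulVec_transpose {ι κ : Type*} [Fintype ι] [Fintype κ] (A : Matrix ι κ ℝ)
    (u : ι → ℝ) (w : κ → ℝ) : u ⬝ᵥ A *ᵥ w = (Aᵀ *ᵥ u) ⬝ᵥ w := by
  rw [Matrix.dotProduct_mulVec, Matrix.mulVec_transpose]

theorem norm_sq_toLp {ι : Type*} [Fintype ι] (v : ι → ℝ) : ‖WithLp.toLp 2 v‖ ^ 2 = v ⬝ᵥ v := by
  rw [EuclideanSpace.norm_sq_eq]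
  simp [dotProduct, sq]

/-- The Euclidean unit ball has a `1/2`-net with at most `5 ^ d` points. -/
theorem exists_halfNet (ι : Type*) [Fintype ι] : ∃ N : Finset (ι → ℝ),
    N.card ≤ 5 ^ Fintype.card ι ∧ (∀ c ∈ N, c ⬝ᵥ c ≤ 1) ∧
      ∀ x : ι → ℝ, x ⬝ᵥ x ≤ 1 → ∃ c ∈ N, (x - c) ⬝ᵥ (x - c) ≤ 1 / 4 := by
  classical
  -- Radius 2 and separation 1 are the normalization of the Besicovitch bound `5 ^ d`; a separated
  -- set of maximal cardinality, scaled by `1/2`, is the net.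
  let Sep : Finset (EuclideanSpace ℝ ι) → Prop := fun s =>
    (∀ c ∈ s, ‖c‖ ≤ 2) ∧ ∀ c ∈ s, ∀ d ∈ s, c ≠ d → 1 ≤ ‖c - d‖
  have hcard : ∀ s, Sep s → s.card ≤ 5 ^ Fintype.card ι := fun s hs => by
    have := Besicovitch.card_le_of_separated s hs.1 hs.2
    rwa [finrank_euclideanSpace] at this
  obtain ⟨m, ⟨s, hs, hsm⟩, hmax⟩ : ∃ m, (∃ s, Sep s ∧ s.card = m) ∧
      ∀ s, Sep s → s.card ≤ m := by
    let T : Set ℕ := {m | ∃ s, Sep s ∧ s.card = m}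
    have hT : BddAbove T := ⟨_, by rintro _ ⟨s, hs, rfl⟩; exact hcard s hs⟩
    have hne : T.Nonempty := ⟨0, ∅, ⟨by simp, by simp⟩, rfl⟩
    exact ⟨sSup T, Nat.sSup_mem hne hT, fun s hs => le_csSup hT ⟨s, hs, rfl⟩⟩
  refine ⟨s.image fun c => (2 : ℝ)⁻¹ • WithLp.ofLp c, Finset.card_image_le.trans (hcard s hs),
    ?_, ?_⟩
  · simp only [Finset.mem_image, forall_exists_index, and_imp, forall_apply_eq_imp_iff₂]
    intro c hc
    have h1 : ‖c‖ ^ 2 = c.ofLp ⬝ᵥ c.ofLp := norm_sq_toLp c.ofLp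
    have h2 := hs.1 c hc
    have h3 := norm_nonneg c
    rw [smul_dotProduct, dotProduct_smul, ← h1, smul_eq_mul, smul_eq_mul]
    nlinarith
  · intro x hx
    -- Otherwise `2x` could be added to the separated set, against maximality.
    obtain ⟨c, hc, hxc⟩ : ∃ c ∈ s, ‖WithLp.toLp 2 ((2 : ℝ) • x) - c‖ < 1 := by
      by_contra! h
      have hx2 : ‖WithLp.toLp 2 ((2 : ℝ) • x)‖ ≤ 2 := by
        have := norm_sq_toLp ((2 : ℝ) • x)
        rw [smul_dotProduct, dotProduct_smul, smul_eq_mul, smul_eq_mul] at this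
        nlinarith [norm_nonneg (WithLp.toLp 2 ((2 : ℝ) • x))]
      have hnot : WithLp.toLp 2 ((2 : ℝ) • x) ∉ s := fun hmem => by
        have := h _ hmem
        simp at this
        linarith
      have hins : Sep (insert (WithLp.toLp 2 ((2 : ℝ) • x)) s) := by
        refine ⟨?_, ?_⟩
        · simp only [Finset.mem_insert, forall_eq_or_imp]
          exact ⟨hx2, hs.1⟩
        · intro a ha b hb hab
          rw [Finset.mem_insert] at ha hb
          rcases ha with rfl | ha <;> rcases hb with rfl | hb
          · exact absurd rfl hab
          · exact h b hb
          · rw [norm_sub_rev]; exact h a ha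
          · exact hs.2 a ha b hb hab
      have := hmax _ hins
      rw [Finset.card_insert_of_notMem hnot] at this
      omega
    refine ⟨_, Finset.mem_image_of_mem _ hc, ?_⟩
    have h1 : ‖WithLp.toLp 2 ((2 : ℝ) • x) - c‖ ^ 2 =
        ((2 : ℝ) • x - c.ofLp) ⬝ᵥ ((2 : ℝ) • x - c.ofLp) := norm_sq_toLp ((2 : ℝ) • x - c.ofLp)
    have h2 : x - (2 : ℝ)⁻¹ • c.ofLp = (2 : ℝ)⁻¹ • ((2 : ℝ) • x - c.ofLp) := by
      rw [smul_sub, smul_smul]; norm_num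
    rw [h2, smul_dotProduct, dotProduct_smul, ← h1, smul_eq_mul, smul_eq_mul]
    nlinarith [norm_nonneg (WithLp.toLp 2 ((2 : ℝ) • x) - c)]

/-- A finite `1/2`-net of the Euclidean unit ball. -/
noncomputable def halfNet (ι : Type*) [Fintype ι] : Finset (ι → ℝ) := (exists_halfNet ι).choose

theorem card_halfNet_le (ι : Type*) [Fintype ι] : (halfNet ι).card ≤ 5 ^ Fintype.card ι :=
  (exists_halfNet ι).choose_spec.1

theorem dotProduct_self_le_one_of_mem_halfNet {ι : Type*} [Fintype ι] {c : ι → ℝ}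
    (hc : c ∈ halfNet ι) : c ⬝ᵥ c ≤ 1 :=
  (exists_halfNet ι).choose_spec.2.1 c hc

/-- If `c` is a net point within `1/2` of `b/|b|`, then `|b| - c ⬝ b = (b/|b| - c) ⬝ b ≤ |b|/2`, so
a net loses only a factor 2 in the norm. -/
theorem dotProduct_self_le_of_halfNet {ι : Type*} [Fintype ι] (b : ι → ℝ) {r : ℝ} (hr : 0 ≤ r)
    (h : ∀ c ∈ halfNet ι, c ⬝ᵥ b ≤ r) : b ⬝ᵥ b ≤ 4 * r ^ 2 := by
  set s := √(b ⬝ᵥ b) with hs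
  have hss : s ^ 2 = b ⬝ᵥ b := Real.sq_sqrt (dotProduct_self_nonneg' b)
  have hs0 : 0 ≤ s := Real.sqrt_nonneg _
  rcases hs0.eq_or_lt with h0 | h0
  · rw [← hss, ← h0, zero_pow two_ne_zero]; positivity
  have hx : (s⁻¹ • b) ⬝ᵥ (s⁻¹ • b) = 1 := by
    rw [smul_dotProduct, dotProduct_smul, ← hss, smul_eq_mul, smul_eq_mul]
    field_simp
  obtain ⟨c, hc, hcx⟩ := (exists_halfNet ι).choose_spec.2.2 _ hx.le
  have h1 := h c hc
  have h2 := dotProduct_sq_le (s⁻¹ • b - c) b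
  have h3 : (s⁻¹ • b - c) ⬝ᵥ b = s - c ⬝ᵥ b := by
    rw [sub_dotProduct, smul_dotProduct, ← hss, smul_eq_mul]
    field_simp
  rw [h3, ← hss] at h2
  have h4 : s - c ⬝ᵥ b ≤ s / 2 := by
    refine le_of_sq_le_sq_of_nonneg ?_ (by positivity)
    nlinarith
  nlinarith

/-- A factor 2 is lost for each of the two nets, and `(2 · 2)² = 16`. -/
theorem mulVec_transpose_le_of_halfNet {ι κ : Type*} [Fintype ι] [Fintype κ] (G : Matrix ι κ ℝ)
    {r : ℝ} (hr : 0 ≤ r) (h : ∀ u ∈ halfNet ι, ∀ w ∈ halfNet κ, u ⬝ᵥ G *ᵥ w ≤ r) (y : ι → ℝ) :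
    (Gᵀ *ᵥ y) ⬝ᵥ (Gᵀ *ᵥ y) ≤ 16 * r ^ 2 * (y ⬝ᵥ y) := by
  have hy := dotProduct_self_nonneg' y
  have h1 : ∀ w ∈ halfNet κ, w ⬝ᵥ (Gᵀ *ᵥ y) ≤ √(y ⬝ᵥ y) * (2 * r) := fun w hw => by
    have h2 := dotProduct_self_le_of_halfNet (G *ᵥ w) hr fun u hu => h u hu w hw
    rw [dotProduct_comm, ← dotProduct_mulVec_transpose]
    refine le_of_sq_le_sq_of_nonneg ?_ (by positivity)
    calc _ ≤ _ := dotProduct_sq_le _ _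
      _ ≤ (y ⬝ᵥ y) * (4 * r ^ 2) := by gcongr
      _ = _ := by rw [mul_pow, Real.sq_sqrt hy]; ring
  have := dotProduct_self_le_of_halfNet _ (by positivity) h1
  rw [mul_pow, Real.sq_sqrt hy] at this
  linarith

/-! ### Singular values and Gram eigenvalues as bounds on quadratic forms. -/

section SingularValues

variable {k : ℕ}

/-- The vector is an eigenvector of `Hᵀ H` for the squared singular value. It turns every bound on
`|H u|` valid for all `u` into a bound on singular values. -/
theorem exists_singularVector (H : Matrix (Fin k) (Fin k) ℝ) {i : ℕ} (hi : i < k) :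
    ∃ v : Fin k → ℝ, 0 < v ⬝ᵥ v ∧
      (H *ᵥ v) ⬝ᵥ (H *ᵥ v) = (Matrix.toEuclideanLin H).singularValues i ^ 2 * (v ⬝ᵥ v) := by
  have hn : i < Module.finrank ℝ (EuclideanSpace ℝ (Fin k)) := by simpa using hi
  obtain ⟨v, hv⟩ :=
    ((Matrix.toEuclideanLin H).hasEigenvalue_adjoint_comp_self_sq_singularValues
      hn).exists_hasEigenvector
  have hv1 := hv.apply_eq_smul
  refine ⟨v.ofLp, ?_, ?_⟩
  · rw [← norm_sq_toLp]
    have := norm_pos_iff.2 hv.2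
    positivity
  · have h1 : inner ℝ (LinearMap.adjoint (Matrix.toEuclideanLin H) (Matrix.toEuclideanLin H v)) v
        = inner ℝ (Matrix.toEuclideanLin H v) (Matrix.toEuclideanLin H v) :=
      LinearMap.adjoint_inner_left _ _ _
    have h2 : LinearMap.adjoint (Matrix.toEuclideanLin H) (Matrix.toEuclideanLin H v) = _ := hv1
    rw [h2, inner_smul_left, real_inner_self_eq_norm_sq, real_inner_self_eq_norm_sq] at h1
    have h3 : ‖Matrix.toEuclideanLin H v‖ ^ 2 = (H *ᵥ v.ofLp) ⬝ᵥ (H *ᵥ v.ofLp) :=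
      norm_sq_toLp (H *ᵥ v.ofLp)
    have h4 : ‖v‖ ^ 2 = v.ofLp ⬝ᵥ v.ofLp := norm_sq_toLp v.ofLp
    rw [h3, h4] at h1
    simpa using h1.symm

theorem le_nuMin (hk : 0 < k) (H : Matrix (Fin k) (Fin k) ℝ) {s : ℝ}
    (h : ∀ u, s ^ 2 * (u ⬝ᵥ u) ≤ (H *ᵥ u) ⬝ᵥ (H *ᵥ u)) : s ≤ nuMin H := by
  obtain ⟨v, hv, hv2⟩ := exists_singularVector H (i := k - 1) (by omega)
  have := h v
  rw [hv2] at this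
  exact le_of_sq_le_sq_of_nonneg (le_of_mul_le_mul_right this hv) (LinearMap.singularValues_nonneg _ _)

theorem nuMax_le (hk : 0 < k) (H : Matrix (Fin k) (Fin k) ℝ) {s : ℝ} (hs : 0 ≤ s)
    (h : ∀ u, (H *ᵥ u) ⬝ᵥ (H *ᵥ u) ≤ s ^ 2 * (u ⬝ᵥ u)) : nuMax H ≤ s := by
  obtain ⟨v, hv, hv2⟩ := exists_singularVector H hk
  have := h v
  rw [hv2] at this
  exact le_of_sq_le_sq_of_nonneg (le_of_mul_le_mul_right this hv) hs

theorem nuMin_nonneg (H : Matrix (Fin k) (Fin k) ℝ) : 0 ≤ nuMin H :=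
  LinearMap.singularValues_nonneg _ _

theorem nuMin_le_nuMax (H : Matrix (Fin k) (Fin k) ℝ) : nuMin H ≤ nuMax H :=
  LinearMap.singularValues_antitone _ (Nat.zero_le _)

end SingularValues

theorem IsHermitian.exists_eq_sum_eigenvalues {k : ℕ} {A : Matrix (Fin k) (Fin k) ℝ}
    (hA : A.IsHermitian) (u : Fin k → ℝ) : ∃ w : Fin k → ℝ, w ⬝ᵥ w = u ⬝ᵥ u ∧
      u ⬝ᵥ A *ᵥ u = ∑ a, hA.eigenvalues a * (w a * w a) := by
  have hU : (hA.eigenvectorUnitary : Matrix (Fin k) (Fin k) ℝ) *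
      (hA.eigenvectorUnitary : Matrix (Fin k) (Fin k) ℝ)ᵀ = 1 :=
    Matrix.mem_unitaryGroup_iff.1 hA.eigenvectorUnitary.2
  have hs : A = (hA.eigenvectorUnitary : Matrix (Fin k) (Fin k) ℝ) *
      Matrix.diagonal hA.eigenvalues *
      (hA.eigenvectorUnitary : Matrix (Fin k) (Fin k) ℝ)ᵀ := by
    have := hA.spectral_theorem
    rw [Unitary.conjStarAlgAut_apply] at this
    exact this
  set Q := (hA.eigenvectorUnitary : Matrix (Fin k) (Fin k) ℝ)
  refine ⟨Qᵀ *ᵥ u, ?_, ?_⟩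
  · rw [← dotProduct_mulVec_transpose, Matrix.mulVec_mulVec, hU, Matrix.one_mulVec]
  · conv_lhs => rw [hs]
    rw [← Matrix.mulVec_mulVec, ← Matrix.mulVec_mulVec, dotProduct_mulVec_transpose,
      dotProduct]
    refine Finset.sum_congr rfl fun a _ => ?_
    rw [Matrix.mulVec_diagonal]
    ring

theorem dotProduct_gram_mulVec {p k : ℕ} (L : Matrix (Fin p) (Fin k) ℝ) (u : Fin k → ℝ) :
    u ⬝ᵥ gram L *ᵥ u = (p : ℝ)⁻¹ * ((L *ᵥ u) ⬝ᵥ (L *ᵥ u)) := by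
  rw [gram, Matrix.smul_mulVec, dotProduct_smul, ← Matrix.mulVec_mulVec,
    dotProduct_mulVec_transpose, Matrix.transpose_transpose, smul_eq_mul]

theorem le_dotProduct_of_le_eigenvalues_gram {p k : ℕ} (hp : 0 < p) (L : Matrix (Fin p) (Fin k) ℝ)
    {c : ℝ} (h : ∀ a, c ≤ (gram_isHermitian L).eigenvalues a) (u : Fin k → ℝ) :
    c * p * (u ⬝ᵥ u) ≤ (L *ᵥ u) ⬝ᵥ (L *ᵥ u) := by
  obtain ⟨w, hw, hA⟩ := IsHermitian.exists_eq_sum_eigenvalues (gram_isHermitian L) u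
  rw [dotProduct_gram_mulVec] at hA
  have h1 : c * (w ⬝ᵥ w) ≤ (p : ℝ)⁻¹ * ((L *ᵥ u) ⬝ᵥ (L *ᵥ u)) := by
    rw [hA, dotProduct, Finset.mul_sum]
    exact Finset.sum_le_sum fun a _ => mul_le_mul_of_nonneg_right (h a) (mul_self_nonneg _)
  have hp' : (0 : ℝ) < p := by exact_mod_cast hp
  rw [inv_mul_eq_div, le_div_iff₀ hp', hw] at h1
  linarith

theorem dotProduct_le_of_eigenvalues_gram_le {p k : ℕ} (hp : 0 < p) (L : Matrix (Fin p) (Fin k) ℝ)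
    {c : ℝ} (h : ∀ a, (gram_isHermitian L).eigenvalues a ≤ c) (u : Fin k → ℝ) :
    (L *ᵥ u) ⬝ᵥ (L *ᵥ u) ≤ c * p * (u ⬝ᵥ u) := by
  obtain ⟨w, hw, hA⟩ := IsHermitian.exists_eq_sum_eigenvalues (gram_isHermitian L) u
  rw [dotProduct_gram_mulVec] at hA
  have h1 : (p : ℝ)⁻¹ * ((L *ᵥ u) ⬝ᵥ (L *ᵥ u)) ≤ c * (w ⬝ᵥ w) := by
    rw [hA, dotProduct, Finset.mul_sum]
    exact Finset.sum_le_sum fun a _ => mul_le_mul_of_nonneg_right (h a) (mul_self_nonneg _)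
  have hp' : (0 : ℝ) < p := by exact_mod_cast hp
  rw [inv_mul_eq_div, div_le_iff₀ hp', hw] at h1
  linarith

/-- The model does not assume `p > 0`: it follows because for `p = 0` the Gram matrix vanishes,
while `k > 0` provides a vector to test it on. -/
theorem pos_of_pos_le_eigenvalues_gram {p k : ℕ} (hk : 0 < k) (L : Matrix (Fin p) (Fin k) ℝ)
    {c : ℝ} (hc : 0 < c) (h : ∀ a, c ≤ (gram_isHermitian L).eigenvalues a) : 0 < p := by
  by_contra hp
  obtain rfl : p = 0 := by omega
  obtain ⟨w, hw, hA⟩ := IsHermitian.exists_eq_sum_eigenvalues (gram_isHermitian L)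
    (Pi.single ⟨0, hk⟩ 1)
  rw [dotProduct_gram_mulVec] at hA
  have h1 : c * (w ⬝ᵥ w) ≤ ∑ a, (gram_isHermitian L).eigenvalues a * (w a * w a) := by
    rw [dotProduct, Finset.mul_sum]
    exact Finset.sum_le_sum fun a _ => mul_le_mul_of_nonneg_right (h a) (mul_self_nonneg _)
  rw [← hA, hw] at h1
  simp at h1
  linarith

/-! ### Courant-Fischer and projection onto the top eigenvectors. -/

section TopEigenvectors

variable {p k : ℕ}

theorem dotProduct_diagonalization {V : Matrix (Fin p) (Fin p) ℝ} {ev : Fin p → ℝ} (z : Fin p → ℝ) :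
    z ⬝ᵥ (V * Matrix.diagonal ev * Vᵀ) *ᵥ z = ∑ b, ev b * ((Vᵀ *ᵥ z) b * (Vᵀ *ᵥ z) b) := by
  rw [← Matrix.mulVec_mulVec, ← Matrix.mulVec_mulVec, dotProduct_mulVec_transpose, dotProduct]
  refine Finset.sum_congr rfl fun a _ => ?_
  rw [Matrix.mulVec_diagonal]
  ring

theorem dotProduct_transpose_mulVec_self {V : Matrix (Fin p) (Fin p) ℝ} (hV : Vᵀ * V = 1)
    (z : Fin p → ℝ) : (Vᵀ *ᵥ z) ⬝ᵥ (Vᵀ *ᵥ z) = z ⬝ᵥ z := by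
  rw [← dotProduct_mulVec_transpose, Matrix.mulVec_mulVec, mul_eq_one_comm.1 hV, Matrix.one_mulVec]

/-- A Courant-Fischer bound: if the quadratic form of `S` is at most `τ` on the kernel of a map to
`ℝᵏ`, then it is at most `τ` on the orthogonal complement of the top `k` eigenvectors. -/
theorem IsTopEigenvectors.quadForm_le {S : Matrix (Fin p) (Fin p) ℝ} {Q : Matrix (Fin p) (Fin k) ℝ}
    (hQ : IsTopEigenvectors S Q) (R : Matrix (Fin p) (Fin k) ℝ) {τ : ℝ}
    (h : ∀ z, Rᵀ *ᵥ z = 0 → z ⬝ᵥ S *ᵥ z ≤ τ * (z ⬝ᵥ z)) (z : Fin p → ℝ) (hz : Qᵀ *ᵥ z = 0) :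
    z ⬝ᵥ S *ᵥ z ≤ τ * (z ⬝ᵥ z) := by
  obtain ⟨hk, V, ev, hV, hev, rfl, rfl⟩ := hQ
  -- The span of the first `k + 1` columns of `V` meets the kernel of `Rᵀ` by dimension. On a common
  -- nonzero vector the Rayleigh quotient is at most `τ` and at least the eigenvalue of index `k`
  -- (counting from 0), which dominates `ev b`.
  have hlow : ∀ b : Fin p, k ≤ b → ev b ≤ τ := by
    intro b hb
    have hk1 : k + 1 ≤ p := by omega
    let V' : Matrix (Fin p) (Fin (k + 1)) ℝ := V.submatrix id (Fin.castLE hk1)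
    have hker : LinearMap.ker (Rᵀ * V').mulVecLin ≠ ⊥ :=
      LinearMap.ker_ne_bot_of_finrank_lt (by simp)
    obtain ⟨x, hx, hx0⟩ := (Submodule.ne_bot_iff _).1 hker
    have hVV : Vᵀ * V' = (1 : Matrix (Fin p) (Fin p) ℝ).submatrix id (Fin.castLE hk1) := by
      rw [← hV]; rfl
    have hw : Vᵀ *ᵥ (V' *ᵥ x) =
        (1 : Matrix (Fin p) (Fin p) ℝ).submatrix id (Fin.castLE hk1) *ᵥ x := by
      rw [Matrix.mulVec_mulVec, hVV]
    have hw0 : ∀ c : Fin p, k < c → (Vᵀ *ᵥ (V' *ᵥ x)) c = 0 := by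
      intro c hc
      rw [hw, Matrix.mulVec, dotProduct]
      refine Finset.sum_eq_zero fun d _ => ?_
      rw [Matrix.submatrix_apply, Matrix.one_apply_ne, zero_mul]
      intro hcd
      have := congrArg Fin.val hcd
      simp at this
      omega
    have hw1 : ∀ d, (Vᵀ *ᵥ (V' *ᵥ x)) (Fin.castLE hk1 d) = x d := by
      intro d
      rw [hw, Matrix.mulVec, dotProduct, Finset.sum_eq_single d]
      · rw [Matrix.submatrix_apply, id, Matrix.one_apply_eq, one_mul]
      · intro e _ hed
        rw [Matrix.submatrix_apply, Matrix.one_apply_ne, zero_mul]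
        intro hcd
        exact hed ((Fin.castLE_injective hk1 hcd).symm)
      · simp
    have h1 := h (V' *ᵥ x) (by rw [Matrix.mulVec_mulVec]; exact hx)
    rw [dotProduct_diagonalization, ← dotProduct_transpose_mulVec_self hV] at h1
    set w := Vᵀ *ᵥ (V' *ᵥ x)
    have hpos : 0 < w ⬝ᵥ w := by
      refine lt_of_le_of_ne (dotProduct_self_nonneg' w) fun h0 => hx0 ?_
      have := dotProduct_self_eq_zero.1 h0.symm
      funext d
      rw [← hw1 d, this]
      rfl
    have h2 : ev b * (w ⬝ᵥ w) ≤ ∑ c, ev c * (w c * w c) := by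
      rw [dotProduct, Finset.mul_sum]
      refine Finset.sum_le_sum fun c _ => ?_
      rcases lt_or_ge k c with hc | hc
      · rw [hw0 c hc]; simp
      · exact mul_le_mul_of_nonneg_right (hev (Fin.le_def.2 (hc.trans hb))) (mul_self_nonneg _)
    exact le_of_mul_le_mul_right (h2.trans h1) hpos
  rw [dotProduct_diagonalization, ← dotProduct_transpose_mulVec_self hV z, dotProduct,
    Finset.mul_sum]
  refine Finset.sum_le_sum fun b _ => ?_
  rcases lt_or_ge (b : ℕ) k with hb | hb
  · have : (Vᵀ *ᵥ z) b = 0 := congrFun hz ⟨b, hb⟩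
    rw [this]; simp
  · exact mul_le_mul_of_nonneg_right (hlow b hb) (mul_self_nonneg _)

theorem IsTopEigenvectors.transpose_mul_self {S : Matrix (Fin p) (Fin p) ℝ}
    {Q : Matrix (Fin p) (Fin k) ℝ} (hQ : IsTopEigenvectors S Q) : Qᵀ * Q = 1 := by
  obtain ⟨hk, V, ev, hV, hev, rfl, rfl⟩ := hQ
  have : (V.submatrix id (Fin.castLE hk))ᵀ * V.submatrix id (Fin.castLE hk) =
      (Vᵀ * V).submatrix (Fin.castLE hk) (Fin.castLE hk) := rfl
  rw [this, hV, Matrix.submatrix_one _ (Fin.castLE_injective hk)]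

/-- Pythagoras for the projection onto the range of a matrix with orthonormal columns. -/
theorem dotProduct_self_eq_add_of_transpose_mul_self {Q : Matrix (Fin p) (Fin k) ℝ}
    (hQ : Qᵀ * Q = 1) (x : Fin p → ℝ) :
    Qᵀ *ᵥ (x - Q *ᵥ Qᵀ *ᵥ x) = 0 ∧
    (x - Q *ᵥ Qᵀ *ᵥ x) ⬝ᵥ (x - Q *ᵥ Qᵀ *ᵥ x) = (x - Q *ᵥ Qᵀ *ᵥ x) ⬝ᵥ x ∧
    x ⬝ᵥ x = (Qᵀ *ᵥ x) ⬝ᵥ (Qᵀ *ᵥ x) +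
      (x - Q *ᵥ Qᵀ *ᵥ x) ⬝ᵥ (x - Q *ᵥ Qᵀ *ᵥ x) := by
  have h0 : Qᵀ *ᵥ (x - Q *ᵥ Qᵀ *ᵥ x) = 0 := by
    rw [Matrix.mulVec_sub, Matrix.mulVec_mulVec, hQ, Matrix.one_mulVec, sub_self]
  have h1 : (x - Q *ᵥ Qᵀ *ᵥ x) ⬝ᵥ (Q *ᵥ Qᵀ *ᵥ x) = 0 := by
    rw [dotProduct_mulVec_transpose, h0, zero_dotProduct]
  have h2 : x ⬝ᵥ (Q *ᵥ Qᵀ *ᵥ x) = (Qᵀ *ᵥ x) ⬝ᵥ (Qᵀ *ᵥ x) := by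
    rw [dotProduct_mulVec_transpose]
  refine ⟨h0, ?_, ?_⟩
  · rw [dotProduct_sub _ x, h1, sub_zero]
  · rw [dotProduct_sub _ x, h1, sub_zero, sub_dotProduct, dotProduct_comm (Q *ᵥ _) x, h2]
    ring

end TopEigenvectors

/-! ### Sample means and the quadratic form of the aggregation matrix. -/

section SampleMean

theorem sum_dotProduct_self_sub_mean {n : ℕ} {ι : Type*} [Fintype ι] (hn : 0 < n)
    (a : Fin n → ι → ℝ) :
    ∑ i, (a i - (n : ℝ)⁻¹ • ∑ j, a j) ⬝ᵥ (a i - (n : ℝ)⁻¹ • ∑ j, a j) =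
      ∑ i, a i ⬝ᵥ a i - n * (((n : ℝ)⁻¹ • ∑ j, a j) ⬝ᵥ ((n : ℝ)⁻¹ • ∑ j, a j)) := by
  set m := (n : ℝ)⁻¹ • ∑ j, a j with hm
  have hn' : (n : ℝ) ≠ 0 := by positivity
  have hsum : ∑ j, a j = (n : ℝ) • m := by rw [hm, smul_smul, mul_inv_cancel₀ hn', one_smul]
  have h1 : ∀ i, (a i - m) ⬝ᵥ (a i - m) = a i ⬝ᵥ a i - 2 * (a i ⬝ᵥ m) + m ⬝ᵥ m := fun i => by
    rw [sub_dotProduct, dotProduct_sub, dotProduct_sub, dotProduct_comm m (a i)]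
    ring
  simp_rw [h1]
  rw [Finset.sum_add_distrib, Finset.sum_sub_distrib, ← Finset.mul_sum, ← sum_dotProduct, hsum,
    smul_dotProduct]
  simp
  ring

theorem sampleMean_transpose_mulVec {p₁ p₂ n : ℕ} (X : Fin n → Matrix (Fin p₁) (Fin p₂) ℝ)
    (z : Fin p₁ → ℝ) : (sampleMean X)ᵀ *ᵥ z = (n : ℝ)⁻¹ • ∑ i, (X i)ᵀ *ᵥ z := by
  rw [sampleMean, Matrix.transpose_smul, Matrix.smul_mulVec, Matrix.transpose_sum,
    Matrix.sum_mulVec]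

theorem dotProduct_mul_transpose_mulVec {ι κ : Type*} [Fintype ι] [Fintype κ] (A : Matrix ι κ ℝ)
    (z : ι → ℝ) : z ⬝ᵥ (A * Aᵀ) *ᵥ z = (Aᵀ *ᵥ z) ⬝ᵥ (Aᵀ *ᵥ z) := by
  rw [← Matrix.mulVec_mulVec, dotProduct_mulVec_transpose]

theorem dotProduct_alphaPCAMatrix_mulVec {p₁ p₂ n : ℕ} (α : ℝ)
    (X : Fin n → Matrix (Fin p₁) (Fin p₂) ℝ) (z : Fin p₁ → ℝ) :
    z ⬝ᵥ alphaPCAMatrix α X *ᵥ z = ((p₁ : ℝ) * p₂)⁻¹ *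
      ((1 + α) * (((sampleMean X)ᵀ *ᵥ z) ⬝ᵥ ((sampleMean X)ᵀ *ᵥ z)) +
      (n : ℝ)⁻¹ * ∑ i, ((X i - sampleMean X)ᵀ *ᵥ z) ⬝ᵥ ((X i - sampleMean X)ᵀ *ᵥ z)) := by
  rw [alphaPCAMatrix, Matrix.smul_mulVec, dotProduct_smul, Matrix.add_mulVec, dotProduct_add,
    Matrix.smul_mulVec, dotProduct_smul, dotProduct_mul_transpose_mulVec, Matrix.smul_mulVec,
    dotProduct_smul, Matrix.sum_mulVec, dotProduct_sum]
  simp_rw [dotProduct_mul_transpose_mulVec, smul_eq_mul]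

theorem sampleMean_add {p₁ p₂ n : ℕ} (X Y : Fin n → Matrix (Fin p₁) (Fin p₂) ℝ) :
    sampleMean (fun i => X i + Y i) = sampleMean X + sampleMean Y := by
  rw [sampleMean, Finset.sum_add_distrib, smul_add]; rfl

theorem sampleMean_mul_mul {p₁ p₂ k₁ k₂ n : ℕ} (R : Matrix (Fin p₁) (Fin k₁) ℝ)
    (C : Matrix (Fin k₂) (Fin p₂) ℝ) (F : Fin n → Matrix (Fin k₁) (Fin k₂) ℝ) :
    sampleMean (fun i => R * F i * C) = R * sampleMean F * C := by
  rw [sampleMean, sampleMean, ← Matrix.sum_mul, ← Matrix.mul_sum, Matrix.mul_smul,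
    Matrix.smul_mul]

theorem sum_sub_sampleMean {p₁ p₂ n : ℕ} (hn : 0 < n) (X : Fin n → Matrix (Fin p₁) (Fin p₂) ℝ)
    (z : Fin p₁ → ℝ) :
    ∑ i, ((X i - sampleMean X)ᵀ *ᵥ z) ⬝ᵥ ((X i - sampleMean X)ᵀ *ᵥ z) =
      ∑ i, ((X i)ᵀ *ᵥ z) ⬝ᵥ ((X i)ᵀ *ᵥ z) -
        n * (((sampleMean X)ᵀ *ᵥ z) ⬝ᵥ ((sampleMean X)ᵀ *ᵥ z)) := by
  have := sum_dotProduct_self_sub_mean hn fun i => (X i)ᵀ *ᵥ z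
  rw [← sampleMean_transpose_mulVec] at this
  simpa only [Matrix.transpose_sub, Matrix.sub_mulVec] using this

end SampleMean

/-- This is half of `0 ≤ |a + 2b|²`; it separates signal from noise without any independence between
them. -/
theorem half_dotProduct_self_sub_le {ι : Type*} [Fintype ι] (a b : ι → ℝ) :
    (a ⬝ᵥ a) / 2 - b ⬝ᵥ b ≤ (a + b) ⬝ᵥ (a + b) := by
  have h := dotProduct_self_nonneg' (a + (2 : ℝ) • b)
  simp only [dotProduct_add, add_dotProduct, smul_dotProduct, dotProduct_smul, smul_eq_mul,
    dotProduct_comm b a] at h ⊢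
  linarith

/-! ### Deterministic perturbation bound for the transformation matrix. -/

section Perturbation

variable {p₁ p₂ k₁ k₂ n : ℕ}

theorem transformationMatrix_sq (hp : 0 < p₁) (Q R : Matrix (Fin p₁) (Fin k₁) ℝ)
    (u : Fin k₁ → ℝ) :
    (transformationMatrix (√(p₁ : ℝ) • Q) R *ᵥ u) ⬝ᵥ
      (transformationMatrix (√(p₁ : ℝ) • Q) R *ᵥ u) =
      (p₁ : ℝ)⁻¹ * ((Qᵀ *ᵥ R *ᵥ u) ⬝ᵥ (Qᵀ *ᵥ R *ᵥ u)) := by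
  have hp' : (0 : ℝ) < p₁ := by exact_mod_cast hp
  rw [transformationMatrix, Matrix.transpose_smul, Matrix.smul_mul, smul_smul, Matrix.smul_mulVec,
    ← Matrix.mulVec_mulVec, smul_dotProduct, dotProduct_smul, smul_eq_mul, smul_eq_mul, ← mul_assoc]
  congr 1
  have := Real.mul_self_sqrt hp'.le
  field_simp
  nlinarith

theorem IsAlphaPCARow.transformationMatrix_le {α : ℝ} {X : Fin n → Matrix (Fin p₁) (Fin p₂) ℝ}
    {W : Matrix (Fin p₁) (Fin k₁) ℝ} (hW : IsAlphaPCARow α X W) (hp : 0 < p₁)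
    (R : Matrix (Fin p₁) (Fin k₁) ℝ) {c : ℝ}
    (hR : ∀ u, (R *ᵥ u) ⬝ᵥ (R *ᵥ u) ≤ c * p₁ * (u ⬝ᵥ u)) (u : Fin k₁ → ℝ) :
    (transformationMatrix W R *ᵥ u) ⬝ᵥ (transformationMatrix W R *ᵥ u) ≤ c * (u ⬝ᵥ u) := by
  obtain ⟨Q, hQ, rfl⟩ := hW
  have hp' : (0 : ℝ) < p₁ := by exact_mod_cast hp
  rw [transformationMatrix_sq hp, inv_mul_le_iff₀ hp']
  have h := (dotProduct_self_eq_add_of_transpose_mul_self hQ.transpose_mul_self (R *ᵥ u)).2.2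
  have h1 := hR u
  have h2 := dotProduct_self_nonneg' (R *ᵥ u - Q *ᵥ Qᵀ *ᵥ R *ᵥ u)
  linarith

/-- Here `η` is the noise level and `κ` the strength of the centred signal. Comparing the upper and
lower bounds for the form of the aggregation matrix at the residual `z` of `R u` gives `κ |Rᵀ z|² ≤
2 (2 + |α|) η p₁ |z|²`, and `hηκ` is what makes `|z|²` at most `cR p₁ |u|² / 2`. -/
theorem IsAlphaPCARow.le_transformationMatrix {α cR η κ : ℝ} (hα : -1 ≤ α) (hn : 0 < n)
    (hp₁ : 0 < p₁) (hp₂ : 0 < p₂) (hη : 0 ≤ η) (hκ : 0 < κ)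
    {R : Matrix (Fin p₁) (Fin k₁) ℝ} {C : Matrix (Fin p₂) (Fin k₂) ℝ}
    {F : Fin n → Matrix (Fin k₁) (Fin k₂) ℝ} {U : Fin n → Matrix (Fin p₁) (Fin p₂) ℝ}
    {W : Matrix (Fin p₁) (Fin k₁) ℝ}
    (hR : ∀ u, cR * p₁ * (u ⬝ᵥ u) ≤ (R *ᵥ u) ⬝ᵥ (R *ᵥ u))
    (hU : ∀ z, ∑ i, ((U i)ᵀ *ᵥ z) ⬝ᵥ ((U i)ᵀ *ᵥ z) ≤ n * (η * (p₁ * p₂)) * (z ⬝ᵥ z))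
    (hF : ∀ y, n * (κ * p₂) * (y ⬝ᵥ y) ≤
      ∑ i, (C *ᵥ (F i - sampleMean F)ᵀ *ᵥ y) ⬝ᵥ (C *ᵥ (F i - sampleMean F)ᵀ *ᵥ y))
    (hηκ : 4 * (2 + |α|) * η ≤ cR * κ)
    (hW : IsAlphaPCARow α (fun i => R * F i * Cᵀ + U i) W) (u : Fin k₁ → ℝ) :
    cR / 2 * (u ⬝ᵥ u) ≤
      (transformationMatrix W R *ᵥ u) ⬝ᵥ (transformationMatrix W R *ᵥ u) := by
  obtain ⟨Q, hQ, rfl⟩ := hW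
  have hn' : (0 : ℝ) < n := by exact_mod_cast hn
  have hp₁' : (0 : ℝ) < p₁ := by exact_mod_cast hp₁
  have hp₂' : (0 : ℝ) < p₂ := by exact_mod_cast hp₂
  set X : Fin n → Matrix (Fin p₁) (Fin p₂) ℝ := fun i => R * F i * Cᵀ + U i with hX
  have hUc : ∀ z, ∑ i, ((U i - sampleMean U)ᵀ *ᵥ z) ⬝ᵥ ((U i - sampleMean U)ᵀ *ᵥ z) ≤
      n * (η * (p₁ * p₂)) * (z ⬝ᵥ z) := fun z => by
    rw [sum_sub_sampleMean hn]
    have := mul_nonneg hn'.le (dotProduct_self_nonneg' ((sampleMean U)ᵀ *ᵥ z))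
    linarith [hU z]
  have hUm : ∀ z, n * (((sampleMean U)ᵀ *ᵥ z) ⬝ᵥ ((sampleMean U)ᵀ *ᵥ z)) ≤
      n * (η * (p₁ * p₂)) * (z ⬝ᵥ z) := fun z => by
    have h1 := sum_sub_sampleMean hn U z
    have h2 : 0 ≤ ∑ i, ((U i - sampleMean U)ᵀ *ᵥ z) ⬝ᵥ ((U i - sampleMean U)ᵀ *ᵥ z) :=
      Finset.sum_nonneg fun i _ => dotProduct_self_nonneg' _
    linarith [hU z]
  have hker : ∀ z, Rᵀ *ᵥ z = 0 → z ⬝ᵥ alphaPCAMatrix α X *ᵥ z ≤ (1 + |α|) * η * (z ⬝ᵥ z) := by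
    intro z hz
    have hXU : ∀ i, (X i)ᵀ *ᵥ z = (U i)ᵀ *ᵥ z := fun i => by
      rw [hX]
      simp only [Matrix.transpose_add, Matrix.transpose_mul, Matrix.add_mulVec,
        ← Matrix.mulVec_mulVec, hz, Matrix.mulVec_zero, zero_add]
    have hXm : (sampleMean X)ᵀ *ᵥ z = (sampleMean U)ᵀ *ᵥ z := by
      rw [sampleMean_transpose_mulVec, sampleMean_transpose_mulVec]
      simp_rw [hXU]
    rw [dotProduct_alphaPCAMatrix_mulVec, sum_sub_sampleMean hn, hXm]
    simp_rw [hXU]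
    rw [inv_mul_le_iff₀ (by positivity)]
    have h1 := hU z
    have h2 := hUm z
    set s := ∑ i, ((U i)ᵀ *ᵥ z) ⬝ᵥ ((U i)ᵀ *ᵥ z)
    have hm0 := dotProduct_self_nonneg' ((sampleMean U)ᵀ *ᵥ z)
    set m := ((sampleMean U)ᵀ *ᵥ z) ⬝ᵥ ((sampleMean U)ᵀ *ᵥ z)
    -- After expanding the centred sum, the form is `s/n + α m` up to scaling; as `α` may have
    -- either sign, its absolute value appears.
    have h3 : (n : ℝ)⁻¹ * (s - n * m) = (n : ℝ)⁻¹ * s - m := by field_simp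
    have h4 : (n : ℝ)⁻¹ * s ≤ η * (p₁ * p₂) * (z ⬝ᵥ z) := by
      rw [inv_mul_le_iff₀ hn']; linarith
    have h5 : m ≤ η * (p₁ * p₂) * (z ⬝ᵥ z) := by
      rw [mul_assoc] at h2
      exact le_of_mul_le_mul_left h2 hn'
    have h6 : α * m ≤ |α| * (η * (p₁ * p₂) * (z ⬝ᵥ z)) :=
      (mul_le_mul_of_nonneg_right (le_abs_self α) hm0).trans
        (mul_le_mul_of_nonneg_left h5 (abs_nonneg α))
    rw [h3]
    nlinarith
  have hlow : ∀ z, (κ / 2) * ((Rᵀ *ᵥ z) ⬝ᵥ (Rᵀ *ᵥ z)) - η * p₁ * (z ⬝ᵥ z) ≤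
      p₁ * (z ⬝ᵥ alphaPCAMatrix α X *ᵥ z) := by
    intro z
    have hdec : ∀ i, (X i - sampleMean X)ᵀ *ᵥ z =
        C *ᵥ (F i - sampleMean F)ᵀ *ᵥ Rᵀ *ᵥ z + (U i - sampleMean U)ᵀ *ᵥ z := fun i => by
      have : X i - sampleMean X = R * (F i - sampleMean F) * Cᵀ + (U i - sampleMean U) := by
        rw [hX, sampleMean_add, sampleMean_mul_mul, Matrix.mul_sub, Matrix.sub_mul]
        exact add_sub_add_comm _ _ _ _
      rw [this]
      simp only [Matrix.transpose_add, Matrix.transpose_mul, Matrix.add_mulVec,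
        ← Matrix.mulVec_mulVec, Matrix.transpose_transpose]
    have h1 : (∑ i, (C *ᵥ (F i - sampleMean F)ᵀ *ᵥ Rᵀ *ᵥ z) ⬝ᵥ
        (C *ᵥ (F i - sampleMean F)ᵀ *ᵥ Rᵀ *ᵥ z)) / 2 -
        ∑ i, ((U i - sampleMean U)ᵀ *ᵥ z) ⬝ᵥ ((U i - sampleMean U)ᵀ *ᵥ z) ≤
        ∑ i, ((X i - sampleMean X)ᵀ *ᵥ z) ⬝ᵥ ((X i - sampleMean X)ᵀ *ᵥ z) := by
      rw [Finset.sum_div, ← Finset.sum_sub_distrib]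
      refine Finset.sum_le_sum fun i _ => ?_
      rw [hdec]
      exact half_dotProduct_self_sub_le _ _
    have h2 := hF (Rᵀ *ᵥ z)
    have h3 := hUc z
    rw [dotProduct_alphaPCAMatrix_mulVec]
    set s := ∑ i, ((X i - sampleMean X)ᵀ *ᵥ z) ⬝ᵥ ((X i - sampleMean X)ᵀ *ᵥ z)
    -- This is where `α ≥ -1` is used: the mean term may be dropped from the lower bound.
    have h4 : 0 ≤ (1 + α) * (((sampleMean X)ᵀ *ᵥ z) ⬝ᵥ ((sampleMean X)ᵀ *ᵥ z)) :=
      mul_nonneg (by linarith) (dotProduct_self_nonneg' _)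
    set m := (1 + α) * (((sampleMean X)ᵀ *ᵥ z) ⬝ᵥ ((sampleMean X)ᵀ *ᵥ z))
    have h5 : (p₁ : ℝ) * (((p₁ : ℝ) * p₂)⁻¹ * (m + (n : ℝ)⁻¹ * s)) =
        (m * n + s) / (p₂ * n) := by
      field_simp
    rw [h5, le_div_iff₀ (by positivity)]
    have h6 : 0 ≤ m * n := by positivity
    linarith
  have hcap := hQ.quadForm_le R hker
  obtain ⟨hz0, hz1, hz2⟩ :=
    dotProduct_self_eq_add_of_transpose_mul_self hQ.transpose_mul_self (R *ᵥ u)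
  rw [transformationMatrix_sq hp₁, inv_mul_eq_div, le_div_iff₀ hp₁']
  set z := R *ᵥ u - Q *ᵥ Qᵀ *ᵥ R *ᵥ u
  have h1 := hcap z hz0
  have h2 := hlow z
  have hu := dotProduct_self_nonneg' u
  have hzz := dotProduct_self_nonneg' z
  have h3 : κ * ((Rᵀ *ᵥ z) ⬝ᵥ (Rᵀ *ᵥ z)) ≤ 2 * (2 + |α|) * η * p₁ * (z ⬝ᵥ z) := by
    have := mul_le_mul_of_nonneg_left h1 hp₁'.le
    linarith
  -- The residual is orthogonal to the range of `Q`, so `|z|² = z ⬝ R u = Rᵀ z ⬝ u`, followed by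
  -- Cauchy-Schwarz.
  have h4 : (z ⬝ᵥ z) ^ 2 ≤ ((Rᵀ *ᵥ z) ⬝ᵥ (Rᵀ *ᵥ z)) * (u ⬝ᵥ u) := by
    rw [hz1, dotProduct_mulVec_transpose]
    exact dotProduct_sq_le _ _
  have h5 : κ * (z ⬝ᵥ z) ≤ κ * (cR / 2 * p₁ * (u ⬝ᵥ u)) := by
    rcases hzz.eq_or_lt with h0 | h0
    · rw [← h0, mul_zero]
      have hcR : 0 ≤ cR * κ := le_trans (by positivity) hηκ
      have hcR' : 0 ≤ cR := nonneg_of_mul_nonneg_left hcR hκ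
      positivity
    · refine le_of_mul_le_mul_right ?_ h0
      calc κ * (z ⬝ᵥ z) * (z ⬝ᵥ z) ≤ κ * (((Rᵀ *ᵥ z) ⬝ᵥ (Rᵀ *ᵥ z)) * (u ⬝ᵥ u)) := by
            rw [mul_assoc, ← sq]; exact mul_le_mul_of_nonneg_left h4 hκ.le
        _ ≤ (2 * (2 + |α|) * η * p₁ * (z ⬝ᵥ z)) * (u ⬝ᵥ u) := by
            rw [← mul_assoc]; exact mul_le_mul_of_nonneg_right h3 hu
        _ = 4 * (2 + |α|) * η * (p₁ / 2 * (z ⬝ᵥ z) * (u ⬝ᵥ u)) := by ring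
        _ ≤ cR * κ * (p₁ / 2 * (z ⬝ᵥ z) * (u ⬝ᵥ u)) := by gcongr
        _ = _ := by ring
  have h6 := le_of_mul_le_mul_left h5 hκ
  have h7 := hR u
  linarith

end Perturbation

/-- A matrix and its transpose have the same operator norm: Cauchy-Schwarz on `|Aᵀ u|² = u ⬝ A (Aᵀ
u)`, then cancellation. -/
theorem mulVec_transpose_dotProduct_self_le {ι κ : Type*} [Fintype ι] [Fintype κ]
    {A : Matrix ι κ ℝ} {L : ℝ}
    (h : ∀ w, (A *ᵥ w) ⬝ᵥ (A *ᵥ w) ≤ L * (w ⬝ᵥ w)) (hL : 0 ≤ L) (u : ι → ℝ) :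
    (Aᵀ *ᵥ u) ⬝ᵥ (Aᵀ *ᵥ u) ≤ L * (u ⬝ᵥ u) := by
  have hx := dotProduct_self_nonneg' (Aᵀ *ᵥ u)
  have hu := dotProduct_self_nonneg' u
  rcases hx.eq_or_lt with h0 | h0
  · rw [← h0]; positivity
  · refine le_of_mul_le_mul_right ?_ h0
    calc _ = (u ⬝ᵥ A *ᵥ (Aᵀ *ᵥ u)) ^ 2 := by rw [dotProduct_mulVec_transpose A, sq]
      _ ≤ _ := dotProduct_sq_le _ _
      _ ≤ (u ⬝ᵥ u) * (L * ((Aᵀ *ᵥ u) ⬝ᵥ (Aᵀ *ᵥ u))) := by gcongr; exact h _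
      _ = _ := by ring

theorem mulVec_dotProduct_self_le_of_specNorm {k : ℕ} {S : Matrix (Fin k) (Fin k) ℝ} {c : ℝ}
    (hS : specNorm S ≤ c) (w : Fin k → ℝ) :
    (S *ᵥ w) ⬝ᵥ (S *ᵥ w) ≤ c ^ 2 * (w ⬝ᵥ w) := by
  have h := (Matrix.toEuclideanCLM (n := Fin k) (𝕜 := ℝ) S).le_opNorm (WithLp.toLp 2 w)
  have h1 : ‖Matrix.toEuclideanCLM (n := Fin k) (𝕜 := ℝ) S (WithLp.toLp 2 w)‖ ^ 2 =
      (S *ᵥ w) ⬝ᵥ (S *ᵥ w) := norm_sq_toLp (S *ᵥ w)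
  rw [← h1, ← norm_sq_toLp w, ← mul_pow]
  refine pow_le_pow_left₀ (norm_nonneg _) (h.trans ?_) 2
  exact mul_le_mul_of_nonneg_right hS (norm_nonneg _)

/-! ### Sub-Gaussian bilinear forms and operator norm bounds. -/

section SubGaussian

variable {Ω : Type*} [MeasurableSpace Ω] {μ : Measure Ω} {ι κ : Type*} [Fintype ι] [Fintype κ]

theorem HasSubgaussianMGF.mono {X : Ω → ℝ} {c d : ℝ≥0} (h : HasSubgaussianMGF X c μ)
    (hcd : c ≤ d) : HasSubgaussianMGF X d μ where
  integrable_exp_mul := h.integrable_exp_mul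
  mgf_le t := (h.mgf_le t).trans (Real.exp_le_exp.2 (by gcongr))

/-- From `x⁴ ≤ 4! e^{|x|} ≤ 24 (e^x + e^{-x})` and the moment generating function at `±1`. -/
theorem HasSubgaussianMGF.integral_pow_four_le {X : Ω → ℝ} {c : ℝ≥0}
    (h : HasSubgaussianMGF X c μ) : Integrable (fun ω => X ω ^ 4) μ ∧
      ∫ ω, X ω ^ 4 ∂μ ≤ 48 * Real.exp (c / 2) := by
  have hb : ∀ x : ℝ, x ^ 4 ≤ 24 * (Real.exp (1 * x) + Real.exp (-1 * x)) := fun x => by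
    have h1 := Real.pow_div_factorial_le_exp |x| (abs_nonneg x) 4
    have h2 : |x| ^ 4 = x ^ 4 := by rw [← abs_pow, abs_of_nonneg (by positivity)]
    rw [h2, div_le_iff₀ (by positivity)] at h1
    have h3 : ((Nat.factorial 4 : ℕ) : ℝ) = 24 := by norm_num [Nat.factorial]
    rw [h3] at h1
    have h4 : Real.exp |x| ≤ Real.exp (1 * x) + Real.exp (-1 * x) := by
      rcases abs_cases x with ⟨hx, _⟩ | ⟨hx, _⟩ <;> rw [hx] <;> simp <;> positivity
    linarith
  have hint : Integrable (fun ω => 24 * (Real.exp (1 * X ω) + Real.exp (-1 * X ω))) μ :=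
    ((h.integrable_exp_mul 1).add (h.integrable_exp_mul (-1))).const_mul 24
  have hint4 : Integrable (fun ω => X ω ^ 4) μ := by
    refine hint.mono' (h.aestronglyMeasurable.pow 4) (ae_of_all _ fun ω => ?_)
    rw [Real.norm_of_nonneg (by positivity)]
    exact hb _
  refine ⟨hint4, (integral_mono hint4 hint fun ω => hb _).trans ?_⟩
  rw [integral_const_mul, integral_add (h.integrable_exp_mul 1) (h.integrable_exp_mul (-1))]
  have h1 := h.mgf_le 1
  have h2 := h.mgf_le (-1)
  simp only [mgf] at h1 h2
  norm_num at h1 h2 ⊢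
  linarith

/-- All the bilinear forms `uᵀ G w` of the random matrix `G` are sub-Gaussian with variance proxy
`V ‖u‖² ‖w‖²`. -/
def BilinearSubGaussian (μ : Measure Ω) (G : Ω → Matrix ι κ ℝ) (V : ℝ≥0) : Prop :=
  ∀ (u : ι → ℝ) (w : κ → ℝ) (c : ℝ≥0), V * ((u ⬝ᵥ u) * (w ⬝ᵥ w)) ≤ c →
    HasSubgaussianMGF (fun ω => u ⬝ᵥ G ω *ᵥ w) c μ

theorem BilinearSubGaussian.mono {G : Ω → Matrix ι κ ℝ} {V V' : ℝ≥0}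
    (h : BilinearSubGaussian μ G V) (hV : V ≤ V') : BilinearSubGaussian μ G V' := by
  intro u w c hc
  refine h u w c (le_trans ?_ hc)
  have := mul_nonneg (dotProduct_self_nonneg' u) (dotProduct_self_nonneg' w)
  gcongr

theorem BilinearSubGaussian.transpose {G : Ω → Matrix ι κ ℝ} {V : ℝ≥0}
    (h : BilinearSubGaussian μ G V) : BilinearSubGaussian μ (fun ω => (G ω)ᵀ) V := by
  intro u w c hc
  have := h w u c (by rwa [mul_comm (w ⬝ᵥ w)])
  refine this.congr (ae_of_all _ fun ω => ?_)
  change w ⬝ᵥ G ω *ᵥ u = u ⬝ᵥ (G ω)ᵀ *ᵥ w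
  rw [dotProduct_mulVec_transpose, dotProduct_comm]

/-- The form `uᵀ S₁ Z S₂ w` is a linear combination of the independent entries of `Z`. Its squared
coefficients sum to `|S₁ᵀ u|² |S₂ w|²`, at most `c₀⁴ |u|² |w|²`. -/
theorem WeaklyCorrelatedSubGaussian.bilinearSubGaussian {I : Type*} {a b : ℕ}
    {A : I → Ω → Matrix (Fin a) (Fin b) ℝ} {c₀ : ℝ} {K : ℝ≥0}
    (h : WeaklyCorrelatedSubGaussian μ A c₀ K) (i : I) :
    BilinearSubGaussian μ (A i) (K * c₀.toNNReal ^ 4) := by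
  obtain ⟨S₁, S₂, Z, ⟨h10, h1⟩, ⟨h20, h2⟩, hind, hZ, hA⟩ := h
  intro u w c hc
  have hc0 : 0 < c₀ := h10.trans h1
  let d : Fin a × Fin b → ℝ := fun q => (S₁ᵀ *ᵥ u) q.1 * (S₂ *ᵥ w) q.2
  have hsub : HasSubgaussianMGF (fun ω => ∑ q, d q * Z i ω q.1 q.2)
      (∑ q, (d q ^ 2).toNNReal * K) μ :=
    HasSubgaussianMGF.sum_of_iIndepFun
      ((hind i).comp (fun q x => d q * x) fun q => measurable_const_mul _)
      fun q _ => HasSubgaussianMGF.mono (((hZ i q.1 q.2).2).const_mul (d q))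
        (le_of_eq (by rw [Real.toNNReal_of_nonneg (sq_nonneg _)]; rfl))
  have hd : ∑ q, d q ^ 2 = ((S₁ᵀ *ᵥ u) ⬝ᵥ (S₁ᵀ *ᵥ u)) * ((S₂ *ᵥ w) ⬝ᵥ (S₂ *ᵥ w)) := by
    rw [dotProduct, dotProduct, Finset.sum_mul_sum, ← Finset.univ_product_univ,
      Finset.sum_product]
    refine Finset.sum_congr rfl fun x _ => Finset.sum_congr rfl fun y _ => ?_
    simp only [d]
    ring
  have hle : (∑ q, (d q ^ 2).toNNReal * K : ℝ≥0) ≤ c := by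
    rw [← NNReal.coe_le_coe]
    push_cast
    simp_rw [Real.coe_toNNReal _ (sq_nonneg _)]
    rw [← Finset.sum_mul]
    refine le_trans ?_ hc
    have e1 := mulVec_transpose_dotProduct_self_le (A := S₁)
      (mulVec_dotProduct_self_le_of_specNorm h1.le) (sq_nonneg c₀) u
    have e2 := mulVec_dotProduct_self_le_of_specNorm h2.le w
    rw [hd]
    push_cast
    rw [Real.coe_toNNReal _ hc0.le]
    calc _ ≤ (c₀ ^ 2 * (u ⬝ᵥ u)) * (c₀ ^ 2 * (w ⬝ᵥ w)) * (K : ℝ) := by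
          have := dotProduct_self_nonneg' u
          have := dotProduct_self_nonneg' (S₂ *ᵥ w)
          gcongr
      _ = _ := by ring
  refine (HasSubgaussianMGF.mono hsub hle).congr ?_
  filter_upwards [hA i] with ω hω
  rw [hω, ← Matrix.mulVec_mulVec, ← Matrix.mulVec_mulVec, dotProduct_mulVec_transpose S₁,
    ← Finset.univ_product_univ, Finset.sum_product, dotProduct]
  refine Finset.sum_congr rfl fun x _ => ?_
  have hx : (Z i ω *ᵥ S₂ *ᵥ w) x = ∑ y, Z i ω x y * (S₂ *ᵥ w) y := rfl
  rw [hx, Finset.mul_sum]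
  refine Finset.sum_congr rfl fun y _ => ?_
  simp only [d]
  ring

theorem measurable_dotProduct_mulVec (u : ι → ℝ) (w : κ → ℝ) :
    Measurable fun G : Matrix ι κ ℝ => u ⬝ᵥ G *ᵥ w := by
  have h : ∀ i j, Measurable fun G : Matrix ι κ ℝ => G i j := fun i j =>
    (measurable_pi_apply j).comp (measurable_pi_apply i)
  simp only [dotProduct, Matrix.mulVec]
  refine Finset.measurable_sum _ fun i _ => ?_
  refine Measurable.const_mul ?_ _
  exact Finset.measurable_sum _ fun j _ => (h i j).mul_const _

/-- Letting `w` vary with `i` covers two cases at once: constant `w` gives the sum of the matrices,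
and the blocks of a long vector give their concatenation. -/
theorem hasSubgaussianMGF_sum_bilinear {n : ℕ} {G : Fin n → Ω → Matrix ι κ ℝ} {V : ℝ≥0}
    (hind : iIndepFun G μ) (h : ∀ i, BilinearSubGaussian μ (G i) V) (u : ι → ℝ)
    (w : Fin n → κ → ℝ) {c : ℝ≥0} (hc : V * ((u ⬝ᵥ u) * ∑ i, w i ⬝ᵥ w i) ≤ c) :
    HasSubgaussianMGF (fun ω => ∑ i, u ⬝ᵥ G i ω *ᵥ w i) c μ := by
  have hnn : ∀ i, 0 ≤ V * ((u ⬝ᵥ u) * (w i ⬝ᵥ w i)) := fun i =>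
    mul_nonneg V.2 (mul_nonneg (dotProduct_self_nonneg' u) (dotProduct_self_nonneg' (w i)))
  have := HasSubgaussianMGF.sum_of_iIndepFun
      (hind.comp (fun i g => u ⬝ᵥ g *ᵥ w i) fun i => measurable_dotProduct_mulVec _ _)
      (s := Finset.univ) (c := fun i => (V * ((u ⬝ᵥ u) * (w i ⬝ᵥ w i))).toNNReal)
      fun i _ => h i u (w i) _ (Real.coe_toNNReal _ (hnn i)).ge
  refine HasSubgaussianMGF.mono this ?_
  rw [← NNReal.coe_le_coe]
  push_cast
  simp_rw [fun i => Real.coe_toNNReal _ (hnn i)]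
  rwa [← Finset.mul_sum, ← Finset.mul_sum]

theorem BilinearSubGaussian.sum {n : ℕ} {G : Fin n → Ω → Matrix ι κ ℝ} {V : ℝ≥0}
    (hind : iIndepFun G μ) (h : ∀ i, BilinearSubGaussian μ (G i) V) :
    BilinearSubGaussian μ (fun ω => ∑ i, G i ω) (n * V) := by
  intro u w c hc
  refine (hasSubgaussianMGF_sum_bilinear hind h u (fun _ => w) (c := c) ?_).congr
    (ae_of_all _ fun ω => ?_)
  · refine le_of_eq_of_le ?_ hc
    simp
    ring
  · simp only [Matrix.sum_mulVec, dotProduct_sum]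

/-- The horizontal concatenation of the matrices `G i`. -/
def concatMatrix {n : ℕ} (G : Fin n → Matrix ι κ ℝ) : Matrix ι (Fin n × κ) ℝ :=
  Matrix.of fun r q => G q.1 r q.2

omit [Fintype ι] in
theorem concatMatrix_mulVec {n : ℕ} (G : Fin n → Matrix ι κ ℝ) (w : Fin n × κ → ℝ) :
    concatMatrix G *ᵥ w = ∑ i, G i *ᵥ fun j => w (i, j) := by
  funext r
  rw [Finset.sum_apply, Matrix.mulVec, dotProduct, ← Finset.univ_product_univ, Finset.sum_product]
  rfl

theorem concatMatrix_transpose_mulVec_sq {n : ℕ} (G : Fin n → Matrix ι κ ℝ) (z : ι → ℝ) :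
    ((concatMatrix G)ᵀ *ᵥ z) ⬝ᵥ ((concatMatrix G)ᵀ *ᵥ z) =
      ∑ i, ((G i)ᵀ *ᵥ z) ⬝ᵥ ((G i)ᵀ *ᵥ z) := by
  rw [dotProduct, ← Finset.univ_product_univ, Finset.sum_product]
  rfl

theorem BilinearSubGaussian.concat {n : ℕ} {G : Fin n → Ω → Matrix ι κ ℝ} {V : ℝ≥0}
    (hind : iIndepFun G μ) (h : ∀ i, BilinearSubGaussian μ (G i) V) :
    BilinearSubGaussian μ (fun ω => concatMatrix fun i => G i ω) V := by
  intro u w c hc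
  refine (hasSubgaussianMGF_sum_bilinear hind h u (fun i j => w (i, j)) (c := c) ?_).congr
    (ae_of_all _ fun ω => ?_)
  · refine le_of_eq_of_le ?_ hc
    congr 2
    rw [dotProduct, ← Finset.univ_product_univ, Finset.sum_product]
    rfl
  · simp only [concatMatrix_mulVec, dotProduct_sum]

variable (ι κ) in
/-- The matrices whose bilinear form is at most `r` on the half nets. -/
def netBounded (r : ℝ) : Set (Matrix ι κ ℝ) :=
  {G | ∀ u ∈ halfNet ι, ∀ w ∈ halfNet κ, u ⬝ᵥ G *ᵥ w ≤ r}

theorem measurableSet_netBounded (r : ℝ) : MeasurableSet (netBounded ι κ r) := by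
  have : netBounded ι κ r = ⋂ u ∈ halfNet ι, ⋂ w ∈ halfNet κ,
      {G : Matrix ι κ ℝ | u ⬝ᵥ G *ᵥ w ≤ r} := by
    ext G; simp [netBounded]
  rw [this]
  refine Finset.measurableSet_biInter _ fun u _ => Finset.measurableSet_biInter _ fun w _ => ?_
  exact measurableSet_le (measurable_dotProduct_mulVec u w) measurable_const

theorem five_pow_le_exp (m : ℕ) : (5 : ℝ) ^ m ≤ Real.exp (2 * m) := by
  have h : (5 : ℝ) ≤ Real.exp 2 := by
    have h1 := Real.exp_one_gt_d9
    have h2 : Real.exp 2 = Real.exp 1 * Real.exp 1 := by rw [← Real.exp_add]; norm_num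
    rw [h2]
    nlinarith
  calc (5 : ℝ) ^ m ≤ Real.exp 2 ^ m := by gcongr
    _ = Real.exp (2 * m) := by rw [← Real.exp_nat_mul, mul_comm]

/-- Union bound over pairs of net points; the number of pairs is at most `5 ^ (d₁ + d₂) ≤ exp (2 (d₁
+ d₂))`. -/
theorem BilinearSubGaussian.measure_not_netBounded_le [IsProbabilityMeasure μ]
    {G : Ω → Matrix ι κ ℝ} {V : ℝ≥0}
    (h : BilinearSubGaussian μ G V) {r : ℝ} (hr : 0 ≤ r) :
    μ.real {ω | G ω ∉ netBounded ι κ r} ≤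
      Real.exp (2 * (Fintype.card ι + Fintype.card κ : ℕ) - r ^ 2 / (2 * V)) := by
  have hsub : {ω | G ω ∉ netBounded ι κ r} ⊆
      ⋃ q ∈ halfNet ι ×ˢ halfNet κ, {ω | r ≤ q.1 ⬝ᵥ G ω *ᵥ q.2} := by
    intro ω hω
    simp only [netBounded, Set.mem_ofPred_eq, not_forall, not_le] at hω
    obtain ⟨u, hu, w, hw, hlt⟩ := hω
    simp only [Set.mem_iUnion]
    exact ⟨(u, w), Finset.mk_mem_product hu hw, hlt.le⟩
  refine (measureReal_mono hsub (measure_ne_top _ _)).trans ((measureReal_biUnion_finset_le _ _).trans ?_)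
  have hq : ∀ q ∈ halfNet ι ×ˢ halfNet κ, μ.real {ω | r ≤ q.1 ⬝ᵥ G ω *ᵥ q.2} ≤
      Real.exp (-(r ^ 2 / (2 * V))) := by
    intro q hq
    rw [Finset.mem_product] at hq
    have := (h q.1 q.2 V ?_).measure_ge_le hr
    · rwa [neg_div] at this
    · have h1 := dotProduct_self_le_one_of_mem_halfNet hq.1
      have h2 := dotProduct_self_le_one_of_mem_halfNet hq.2
      have h3 := dotProduct_self_nonneg' q.2
      exact mul_le_of_le_one_right V.2 (mul_le_one₀ h1 h3 h2)
  refine (Finset.sum_le_sum hq).trans ?_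
  rw [Finset.sum_const, Finset.card_product, nsmul_eq_mul, sub_eq_add_neg, Real.exp_add]
  refine mul_le_mul_of_nonneg_right ?_ (Real.exp_pos _).le
  refine le_trans ?_ (five_pow_le_exp _)
  rw [pow_add]
  exact_mod_cast Nat.mul_le_mul (card_halfNet_le ι) (card_halfNet_le κ)

/-- The operator norm bound for a random matrix with sub-Gaussian bilinear forms. -/
theorem BilinearSubGaussian.exists_event [IsProbabilityMeasure μ] {G : Ω → Matrix ι κ ℝ}
    (hG : Measurable G) {V : ℝ≥0} (hV : 0 < V) (h : BilinearSubGaussian μ G V) {t : ℝ}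
    (ht : 0 ≤ t) : ∃ E : Set Ω, MeasurableSet E ∧ μ.real Eᶜ ≤ Real.exp (-t) ∧
      ∀ ω ∈ E, ∀ y, ((G ω)ᵀ *ᵥ y) ⬝ᵥ ((G ω)ᵀ *ᵥ y) ≤
        32 * V * (t + 2 * (Fintype.card ι + Fintype.card κ : ℕ)) * (y ⬝ᵥ y) := by
  set s : ℝ := t + 2 * (Fintype.card ι + Fintype.card κ : ℕ) with hs
  have hV' : (0 : ℝ) < V := hV
  have hsV : 0 ≤ 2 * V * s := by positivity
  -- The level `r² = 2 V s` turns the exponent of the union bound into exactly `-t`.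
  refine ⟨{ω | G ω ∈ netBounded ι κ √(2 * V * s)}, hG (measurableSet_netBounded _), ?_, ?_⟩
  · refine (h.measure_not_netBounded_le (Real.sqrt_nonneg _)).trans (Real.exp_le_exp.2 ?_)
    rw [Real.sq_sqrt hsV, mul_div_cancel_left₀ _ (by positivity), hs]
    linarith
  · intro ω hω y
    refine (mulVec_transpose_le_of_halfNet _ (Real.sqrt_nonneg _) hω y).trans (le_of_eq ?_)
    rw [Real.sq_sqrt hsV]
    ring

end SubGaussian

/-! ### Products of contractions and lower bounds for sums of positive semidefinite matrices. -/

section Contractions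

variable {I ι κ : Type*} [Fintype ι] [Fintype κ] [DecidableEq ι]

/-- The product of the matrices `1 - L⁻¹ A i (A i)ᵀ` along a list of indices. -/
noncomputable def contractionProd (L : ℝ) (A : I → Matrix ι κ ℝ) : List I → Matrix ι ι ℝ
  | [] => 1
  | i :: l => (1 - L⁻¹ • (A i * (A i)ᵀ)) * contractionProd L A l

theorem contractionProd_cons_mulVec (L : ℝ) (A : I → Matrix ι κ ℝ) (i : I) (l : List I)
    (x : ι → ℝ) : contractionProd L A (i :: l) *ᵥ x =
      contractionProd L A l *ᵥ x -
        L⁻¹ • (A i *ᵥ (A i)ᵀ *ᵥ contractionProd L A l *ᵥ x) := by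
  rw [contractionProd, ← Matrix.mulVec_mulVec, Matrix.sub_mulVec, Matrix.one_mulVec,
    Matrix.smul_mulVec, ← Matrix.mulVec_mulVec]

theorem contractionProd_congr (L : ℝ) {A A' : I → Matrix ι κ ℝ} {l : List I}
    (h : ∀ i ∈ l, A i = A' i) : contractionProd L A l = contractionProd L A' l := by
  induction l with
  | nil => rfl
  | cons i l ih =>
    rw [contractionProd, contractionProd, h i (by simp), ih fun j hj => h j (by simp [hj])]

-- On expanding the square, the second-order term `L⁻² |A Aᵀ y|²` is at most `L⁻¹ |Aᵀ y|²`, which is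
-- half of the first-order gain.
omit [DecidableEq ι] in
theorem dotProduct_self_contraction_le {L : ℝ} (hL : 0 < L) {A : Matrix ι κ ℝ}
    (hA : ∀ y, (Aᵀ *ᵥ y) ⬝ᵥ (Aᵀ *ᵥ y) ≤ L * (y ⬝ᵥ y)) (y : ι → ℝ) :
    (y - L⁻¹ • (A *ᵥ Aᵀ *ᵥ y)) ⬝ᵥ (y - L⁻¹ • (A *ᵥ Aᵀ *ᵥ y)) ≤
      y ⬝ᵥ y - L⁻¹ * ((Aᵀ *ᵥ y) ⬝ᵥ (Aᵀ *ᵥ y)) := by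
  have h1 := mulVec_transpose_dotProduct_self_le hA hL.le (Aᵀ *ᵥ y)
  rw [Matrix.transpose_transpose] at h1
  have h2 : y ⬝ᵥ (A *ᵥ Aᵀ *ᵥ y) = (Aᵀ *ᵥ y) ⬝ᵥ (Aᵀ *ᵥ y) := dotProduct_mulVec_transpose _ _ _
  rw [sub_dotProduct, dotProduct_sub, dotProduct_sub, smul_dotProduct, dotProduct_smul,
    smul_dotProduct, dotProduct_smul, dotProduct_comm (A *ᵥ _) y, h2]
  simp only [smul_eq_mul]
  have h3 : L⁻¹ * (L⁻¹ * ((A *ᵥ Aᵀ *ᵥ y) ⬝ᵥ (A *ᵥ Aᵀ *ᵥ y))) ≤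
      L⁻¹ * ((Aᵀ *ᵥ y) ⬝ᵥ (Aᵀ *ᵥ y)) := by
    refine mul_le_mul_of_nonneg_left ?_ (inv_pos.2 hL).le
    rw [inv_mul_le_iff₀ hL]
    exact h1
  linarith

theorem dotProduct_self_contractionProd_le {L : ℝ} (hL : 0 < L) {A : I → Matrix ι κ ℝ}
    (hA : ∀ i y, ((A i)ᵀ *ᵥ y) ⬝ᵥ ((A i)ᵀ *ᵥ y) ≤ L * (y ⬝ᵥ y)) (l : List I) (x : ι → ℝ) :
    (contractionProd L A l *ᵥ x) ⬝ᵥ (contractionProd L A l *ᵥ x) ≤ x ⬝ᵥ x := by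
  induction l with
  | nil => simp [contractionProd]
  | cons i l ih =>
    rw [contractionProd_cons_mulVec]
    refine (dotProduct_self_contraction_le hL (hA i) _).trans (le_trans ?_ ih)
    have := mul_nonneg (inv_pos.2 hL).le
      (dotProduct_self_nonneg' ((A i)ᵀ *ᵥ contractionProd L A l *ᵥ x))
    linarith

/-- With `y_i` the partial products applied to `x`, telescoping gives `x ⬝ (x - P x) = L⁻¹ ∑ (A_iᵀ
x) ⬝ (A_iᵀ y_i)`. Cauchy-Schwarz applies, and `L⁻¹ ∑ |A_iᵀ y_i|²` is at most the energy lost, `|x|²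
- |P x|²`. The induction performs this Cauchy-Schwarz one term at a time. -/
theorem sq_sub_dotProduct_contractionProd_le {L : ℝ} (hL : 0 < L) {A : I → Matrix ι κ ℝ}
    (hA : ∀ i y, ((A i)ᵀ *ᵥ y) ⬝ᵥ ((A i)ᵀ *ᵥ y) ≤ L * (y ⬝ᵥ y)) (l : List I) (x : ι → ℝ) :
    (x ⬝ᵥ x - x ⬝ᵥ contractionProd L A l *ᵥ x) ^ 2 ≤
      L⁻¹ * (l.map fun i => ((A i)ᵀ *ᵥ x) ⬝ᵥ ((A i)ᵀ *ᵥ x)).sum *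
        (x ⬝ᵥ x - (contractionProd L A l *ᵥ x) ⬝ᵥ (contractionProd L A l *ᵥ x)) := by
  induction l with
  | nil => simp [contractionProd]
  | cons i l ih =>
    have h1 := dotProduct_self_contraction_le hL (hA i) (contractionProd L A l *ᵥ x)
    have hE := dotProduct_self_contractionProd_le hL hA l x
    rw [List.map_cons, List.sum_cons, contractionProd_cons_mulVec]
    have hT : 0 ≤ (l.map fun i => ((A i)ᵀ *ᵥ x) ⬝ᵥ ((A i)ᵀ *ᵥ x)).sum :=
      List.sum_nonneg (by simpa using fun _ _ => dotProduct_self_nonneg' _)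
    set y := contractionProd L A l *ᵥ x
    set T := (l.map fun i => ((A i)ᵀ *ᵥ x) ⬝ᵥ ((A i)ᵀ *ᵥ x)).sum
    have hcs := dotProduct_sq_le ((A i)ᵀ *ᵥ x) ((A i)ᵀ *ᵥ y)
    have hB := dotProduct_self_nonneg' ((A i)ᵀ *ᵥ x)
    have hC := dotProduct_self_nonneg' ((A i)ᵀ *ᵥ y)
    rw [dotProduct_sub x, dotProduct_smul, smul_eq_mul, dotProduct_mulVec_transpose (A i) x]
    set B := ((A i)ᵀ *ᵥ x) ⬝ᵥ ((A i)ᵀ *ᵥ x)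
    set C := ((A i)ᵀ *ᵥ y) ⬝ᵥ ((A i)ᵀ *ᵥ y)
    set b := ((A i)ᵀ *ᵥ x) ⬝ᵥ ((A i)ᵀ *ᵥ y)
    set a := x ⬝ᵥ x - x ⬝ᵥ y with ha
    set E := x ⬝ᵥ x - y ⬝ᵥ y with hEdef
    have hE0 : 0 ≤ E := sub_nonneg.2 hE
    have hθ : 0 < L⁻¹ := inv_pos.2 hL
    set θ := L⁻¹
    -- From `a² ≤ θ T E` and `b² ≤ B C`, by the inequality of arithmetic and geometric means for `θ
    -- T C` and `B E`.
    have hcross : 2 * (a * b) ≤ θ * T * C + B * E := by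
      refine le_of_sq_le_sq_of_nonneg ?_ (by positivity)
      have : (a * b) ^ 2 ≤ (θ * T * E) * (B * C) := by
        rw [mul_pow]
        exact mul_le_mul ih hcs (sq_nonneg _) (by positivity)
      nlinarith [sq_nonneg (θ * T * C - B * E)]
    calc (x ⬝ᵥ x - (x ⬝ᵥ y - θ * b)) ^ 2 = a ^ 2 + θ * (2 * (a * b)) + θ ^ 2 * b ^ 2 := by
          rw [ha]; ring
      _ ≤ θ * T * E + θ * (θ * T * C + B * E) + θ ^ 2 * (B * C) := by gcongr
      _ = θ * (B + T) * (E + θ * C) := by ring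
      _ ≤ _ := by
          refine mul_le_mul_of_nonneg_left ?_ (by positivity)
          rw [hEdef]
          linarith

omit [DecidableEq ι] in
theorem mulVec_dotProduct_self_le_frobenius (P : Matrix κ ι ℝ) (x : ι → ℝ) :
    (P *ᵥ x) ⬝ᵥ (P *ᵥ x) ≤ (∑ a, ∑ b, P b a ^ 2) * (x ⬝ᵥ x) := by
  rw [Finset.sum_comm, Finset.sum_mul, dotProduct]
  refine Finset.sum_le_sum fun b _ => ?_
  have := dotProduct_sq_le (P b) x
  rw [← sq]
  refine this.trans (le_of_eq ?_)
  simp only [dotProduct, sq]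

/-- If the sum were smaller, the product would move `x` so little that `x ⬝ P x ≥ |x|²/2`; but the
Frobenius bound gives `|P x| < |x|/2`. -/
theorem le_sum_of_contractionProd {L : ℝ} (hL : 0 < L) {A : I → Matrix ι κ ℝ}
    (hA : ∀ i y, ((A i)ᵀ *ᵥ y) ⬝ᵥ ((A i)ᵀ *ᵥ y) ≤ L * (y ⬝ᵥ y)) {l : List I}
    (hl : ∑ a, ∑ b, contractionProd L A l b a ^ 2 < 1 / 4) (x : ι → ℝ) :
    L / 4 * (x ⬝ᵥ x) ≤ (l.map fun i => ((A i)ᵀ *ᵥ x) ⬝ᵥ ((A i)ᵀ *ᵥ x)).sum := by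
  have h1 := sq_sub_dotProduct_contractionProd_le hL hA l x
  have h2 := mulVec_dotProduct_self_le_frobenius (contractionProd L A l) x
  have h3 := dotProduct_sq_le x (contractionProd L A l *ᵥ x)
  have hT : 0 ≤ (l.map fun i => ((A i)ᵀ *ᵥ x) ⬝ᵥ ((A i)ᵀ *ᵥ x)).sum :=
    List.sum_nonneg (by simpa using fun _ _ => dotProduct_self_nonneg' _)
  have hy := dotProduct_self_nonneg' (contractionProd L A l *ᵥ x)
  set y := contractionProd L A l *ᵥ x
  set T := (l.map fun i => ((A i)ᵀ *ᵥ x) ⬝ᵥ ((A i)ᵀ *ᵥ x)).sum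
  have hx := dotProduct_self_nonneg' x
  by_contra! hcon
  have hx0 : 0 < x ⬝ᵥ x := by
    rcases hx.eq_or_lt with h0 | h0
    · rw [← h0, mul_zero] at hcon; linarith
    · exact h0
  have h4 : L⁻¹ * T ≤ (x ⬝ᵥ x) / 4 := by
    rw [inv_mul_le_iff₀ hL]; linarith
  have h5 : (x ⬝ᵥ x - x ⬝ᵥ y) ^ 2 ≤ ((x ⬝ᵥ x) / 2) ^ 2 := by
    refine h1.trans ?_
    calc _ ≤ (x ⬝ᵥ x) / 4 * (x ⬝ᵥ x) :=
          mul_le_mul h4 (by linarith) (by nlinarith [h2]) (by positivity)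
      _ = _ := by ring
  have h6 := le_of_sq_le_sq_of_nonneg h5 (by positivity)
  have h7 : ((x ⬝ᵥ x) / 2) ^ 2 ≤ (x ⬝ᵥ y) ^ 2 := pow_le_pow_left₀ (by positivity) (by linarith) 2
  have h8 : y ⬝ᵥ y < 1 / 4 * (x ⬝ᵥ x) := lt_of_le_of_lt h2 (mul_lt_mul_of_pos_right hl hx0)
  nlinarith

end Contractions

/-! ### Measurability of matrix operations, and independence of disjoint groups. -/

section MatrixMeasurability

variable {Ω ι κ τ : Type*} [MeasurableSpace Ω]

theorem Matrix.measurable_of_entries {f : Ω → Matrix ι κ ℝ}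
    (h : ∀ i j, Measurable fun ω => f ω i j) : Measurable f :=
  measurable_pi_iff.2 fun i => measurable_pi_iff.2 fun j => h i j

theorem Matrix.measurable_entry {f : Ω → Matrix ι κ ℝ} (hf : Measurable f) (i : ι) (j : κ) :
    Measurable fun ω => f ω i j :=
  (measurable_pi_apply j).comp ((measurable_pi_apply i).comp hf)

theorem Matrix.measurable_mul [Fintype κ] {f : Ω → Matrix ι κ ℝ} {g : Ω → Matrix κ τ ℝ}
    (hf : Measurable f) (hg : Measurable g) : Measurable fun ω => f ω * g ω := by
  refine Matrix.measurable_of_entries fun i j => ?_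
  simp only [Matrix.mul_apply]
  exact Finset.measurable_sum _ fun a _ =>
    (Matrix.measurable_entry hf i a).mul (Matrix.measurable_entry hg a j)

theorem Matrix.measurable_transpose {f : Ω → Matrix ι κ ℝ} (hf : Measurable f) :
    Measurable fun ω => (f ω)ᵀ :=
  Matrix.measurable_of_entries fun i j => Matrix.measurable_entry hf j i

theorem Matrix.measurable_mulVec_apply [Fintype κ] {f : Ω → Matrix ι κ ℝ} {g : Ω → κ → ℝ}
    (hf : Measurable f) (hg : Measurable g) (i : ι) : Measurable fun ω => (f ω *ᵥ g ω) i := by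
  simp only [Matrix.mulVec, dotProduct]
  exact Finset.measurable_sum _ fun a _ =>
    (Matrix.measurable_entry hf i a).mul ((measurable_pi_apply a).comp hg)

theorem measurable_dotProduct [Fintype ι] {f g : Ω → ι → ℝ} (hf : Measurable f)
    (hg : Measurable g) : Measurable fun ω => f ω ⬝ᵥ g ω := by
  simp only [dotProduct]
  exact Finset.measurable_sum _ fun a _ =>
    ((measurable_pi_apply a).comp hf).mul ((measurable_pi_apply a).comp hg)

theorem Matrix.measurable_mulVec [Fintype κ] {f : Ω → Matrix ι κ ℝ} {g : Ω → κ → ℝ}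
    (hf : Measurable f) (hg : Measurable g) : Measurable fun ω => f ω *ᵥ g ω :=
  measurable_pi_iff.2 fun i => Matrix.measurable_mulVec_apply hf hg i

end MatrixMeasurability

section Independence

variable {Ω : Type*} [MeasurableSpace Ω] {μ : Measure Ω}

/-- Functions of disjoint groups of independent random variables are independent. -/
theorem iIndepFun.indepFun_of_dependsOn {I E β γ : Type*} [MeasurableSpace E] [Zero E]
    [MeasurableSpace β] [MeasurableSpace γ] {A : I → Ω → E} (hind : iIndepFun A μ)
    (hA : ∀ i, Measurable (A i)) {S T : Finset I} (hST : Disjoint S T) {f : (I → E) → β}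
    {g : (I → E) → γ} (hf : Measurable f) (hg : Measurable g)
    (hfS : ∀ a b, (∀ i ∈ S, a i = b i) → f a = f b)
    (hgT : ∀ a b, (∀ i ∈ T, a i = b i) → g a = g b) :
    IndepFun (fun ω => f fun i => A i ω) (fun ω => g fun i => A i ω) μ := by
  classical
  -- Tuples indexed by `S` are extended by zero; the filler is irrelevant because the function
  -- ignores coordinates outside `S`.
  let ext : (S : Finset I) → (S → E) → I → E := fun S a i => if h : i ∈ S then a ⟨i, h⟩ else 0
  have hext : ∀ S, Measurable (ext S) := fun S => by
    refine measurable_pi_iff.2 fun i => ?_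
    by_cases h : i ∈ S
    · simp only [ext, h, dif_pos]
      exact measurable_pi_apply _
    · simp only [ext, h, dif_neg, not_false_eq_true]
      exact measurable_const
  have h := (hind.indepFun_finset S T hST hA).comp (hf.comp (hext S)) (hg.comp (hext T))
  convert h using 1
  · funext ω
    exact hfS _ _ fun i hi => by simp [ext, hi]
  · funext ω
    exact hgT _ _ fun i hi => by simp [ext, hi]

/-- Conditioning on `Y` in the form of Fubini: a bound on the mean over `A` for each fixed `y` may
be integrated at the random `Y`. -/
theorem IndepFun.integral_le_integral [IsProbabilityMeasure μ] {α β : Type*} [MeasurableSpace α]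
    [MeasurableSpace β] {A : Ω → α} {Y : Ω → β} (h : IndepFun A Y μ) (hA : Measurable A)
    (hY : Measurable Y) {f : α × β → ℝ} (hf : Measurable f) {g : β → ℝ} (hg : Measurable g)
    (hint : Integrable (fun ω => f (A ω, Y ω)) μ) (hgint : Integrable (fun ω => g (Y ω)) μ)
    (hfg : ∀ y, g y ≤ ∫ ω, f (A ω, y) ∂μ) :
    ∫ ω, g (Y ω) ∂μ ≤ ∫ ω, f (A ω, Y ω) ∂μ := by
  have hprod := (indepFun_iff_map_prod_eq_prod_map_map hA.aemeasurable hY.aemeasurable).1 h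
  have : IsProbabilityMeasure (μ.map A) := Measure.isProbabilityMeasure_map hA.aemeasurable
  have : IsProbabilityMeasure (μ.map Y) := Measure.isProbabilityMeasure_map hY.aemeasurable
  have hint' : Integrable f ((μ.map A).prod (μ.map Y)) := by
    rw [← hprod, integrable_map_measure hf.aestronglyMeasurable (hA.prodMk hY).aemeasurable]
    exact hint
  have h1 : ∫ ω, f (A ω, Y ω) ∂μ = ∫ y, ∫ a, f (a, y) ∂(μ.map A) ∂(μ.map Y) := by
    rw [← integral_prod_symm f hint', ← hprod,
      integral_map (hA.prodMk hY).aemeasurable hf.aestronglyMeasurable]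
  have h2 : ∫ ω, g (Y ω) ∂μ = ∫ y, g y ∂(μ.map Y) := by
    rw [integral_map hY.aemeasurable hg.aestronglyMeasurable]
  rw [h1, h2]
  refine integral_mono ?_ hint'.integral_prod_right fun y => ?_
  · rw [integrable_map_measure hg.aestronglyMeasurable hY.aemeasurable]
    exact hgint
  · change g y ≤ ∫ a, f (a, y) ∂(μ.map A)
    have hfy : Measurable fun a => f (a, y) := hf.comp measurable_prodMk_right
    rw [integral_map hA.aemeasurable hfy.aestronglyMeasurable]
    exact hfg y

end Independence

/-! ### Expected contraction, and counting of bad blocks. -/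

section ContractionExpectation

variable {Ω : Type*} [MeasurableSpace Ω] {μ : Measure Ω} [IsProbabilityMeasure μ]
  {I ι κ : Type*} [Fintype ι] [Fintype κ] [DecidableEq ι]

theorem measurable_contractionProd (L : ℝ) (l : List I) :
    Measurable fun A : I → Matrix ι κ ℝ => contractionProd L A l := by
  induction l with
  | nil => exact measurable_const
  | cons i l ih =>
    simp only [contractionProd]
    refine Matrix.measurable_mul (Matrix.measurable_of_entries fun a b => ?_) ih
    have h1 : Measurable fun A : I → Matrix ι κ ℝ => A i := measurable_pi_apply i
    simp only [Matrix.sub_apply, Matrix.smul_apply]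
    exact measurable_const.sub ((Matrix.measurable_entry
      (Matrix.measurable_mul h1 (Matrix.measurable_transpose h1)) a b).const_smul L⁻¹)

/-- As the list has no repetitions, the first factor is independent of the product of the others.
Conditionally on the latter it removes on average at least the fraction `m / L` of the squared norm.
-/
theorem integral_contractionProd_le {A : I → Ω → Matrix ι κ ℝ} (hA : ∀ i, Measurable (A i))
    (hind : iIndepFun A μ) {L m : ℝ} (hL : 0 < L) (hmL : m ≤ L)
    (hAL : ∀ i ω y, ((A i ω)ᵀ *ᵥ y) ⬝ᵥ ((A i ω)ᵀ *ᵥ y) ≤ L * (y ⬝ᵥ y))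
    (hm : ∀ i y, m * (y ⬝ᵥ y) ≤ ∫ ω, ((A i ω)ᵀ *ᵥ y) ⬝ᵥ ((A i ω)ᵀ *ᵥ y) ∂μ)
    {l : List I} (hl : l.Nodup) (x : ι → ℝ) :
    ∫ ω, (contractionProd L (fun i => A i ω) l *ᵥ x) ⬝ᵥ
      (contractionProd L (fun i => A i ω) l *ᵥ x) ∂μ ≤
        (1 - m / L) ^ l.length * (x ⬝ᵥ x) := by
  have hAm : Measurable fun ω i => A i ω := measurable_pi_iff.2 hA
  have hYm : ∀ l : List I, Measurable fun ω => contractionProd L (fun i => A i ω) l *ᵥ x :=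
    fun l => Matrix.measurable_mulVec ((measurable_contractionProd L l).comp hAm) measurable_const
  have hYint : ∀ l : List I, Integrable (fun ω => (contractionProd L (fun i => A i ω) l *ᵥ x) ⬝ᵥ
      (contractionProd L (fun i => A i ω) l *ᵥ x)) μ := fun l => by
    refine Integrable.of_bound (measurable_dotProduct (hYm l) (hYm l)).aestronglyMeasurable
      (x ⬝ᵥ x) (ae_of_all _ fun ω => ?_)
    rw [Real.norm_of_nonneg (dotProduct_self_nonneg' _)]
    exact dotProduct_self_contractionProd_le hL (fun i => hAL i ω) l x
  induction l with
  | nil => simp [contractionProd]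
  | cons i l ih =>
    rw [List.nodup_cons] at hl
    have hAY : IndepFun (A i) (fun ω => contractionProd L (fun i => A i ω) l *ᵥ x) μ := by
      classical
      refine iIndepFun.indepFun_of_dependsOn hind hA (S := {i}) (T := l.toFinset)
        (f := fun a => a i) (g := fun a => contractionProd L a l *ᵥ x) ?_ (measurable_pi_apply i)
        (Matrix.measurable_mulVec (measurable_contractionProd L l) measurable_const) ?_ ?_
      · simpa using hl.1
      · intro a b hab
        exact hab i (by simp)
      · intro a b hab
        rw [contractionProd_congr L fun j hj => hab j (by simpa using hj)]
    have hfm : Measurable fun q : Matrix ι κ ℝ × (ι → ℝ) => (q.1ᵀ *ᵥ q.2) ⬝ᵥ (q.1ᵀ *ᵥ q.2) := by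
      have := Matrix.measurable_mulVec
        (Matrix.measurable_transpose (measurable_fst (α := Matrix ι κ ℝ) (β := ι → ℝ)))
        (measurable_snd (α := Matrix ι κ ℝ) (β := ι → ℝ))
      exact measurable_dotProduct this this
    have hint : Integrable (fun ω => ((A i ω)ᵀ *ᵥ contractionProd L (fun i => A i ω) l *ᵥ x) ⬝ᵥ
        ((A i ω)ᵀ *ᵥ contractionProd L (fun i => A i ω) l *ᵥ x)) μ := by
      refine Integrable.of_bound (hfm.comp ((hA i).prodMk (hYm l))).aestronglyMeasurable
        (L * (x ⬝ᵥ x)) (ae_of_all _ fun ω => ?_)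
      rw [Real.norm_of_nonneg (dotProduct_self_nonneg' _)]
      exact (hAL i ω _).trans (mul_le_mul_of_nonneg_left
        (dotProduct_self_contractionProd_le hL (fun i => hAL i ω) l x) hL.le)
    have hle := IndepFun.integral_le_integral hAY (hA i) (hYm l) hfm
      (g := fun y => m * (y ⬝ᵥ y)) ((measurable_dotProduct measurable_id measurable_id).const_mul m)
      hint ((hYint l).const_mul m) (hm i)
    rw [integral_const_mul] at hle
    have hstep : ∫ ω, (contractionProd L (fun i => A i ω) (i :: l) *ᵥ x) ⬝ᵥ
        (contractionProd L (fun i => A i ω) (i :: l) *ᵥ x) ∂μ ≤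
        ∫ ω, ((contractionProd L (fun i => A i ω) l *ᵥ x) ⬝ᵥ
          (contractionProd L (fun i => A i ω) l *ᵥ x) -
          L⁻¹ * (((A i ω)ᵀ *ᵥ contractionProd L (fun i => A i ω) l *ᵥ x) ⬝ᵥ
          ((A i ω)ᵀ *ᵥ contractionProd L (fun i => A i ω) l *ᵥ x))) ∂μ := by
      refine integral_mono (hYint _) ((hYint l).sub (hint.const_mul _)) fun ω => ?_
      simp only [contractionProd_cons_mulVec]
      exact dotProduct_self_contraction_le hL (hAL i ω) _
    rw [integral_sub (hYint l) (hint.const_mul _), integral_const_mul] at hstep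
    have h0 : 0 ≤ 1 - m / L := by
      rw [sub_nonneg, div_le_one hL]; exact hmL
    have h3 := mul_le_mul_of_nonneg_left (ih hl.2) h0
    have h4 := mul_le_mul_of_nonneg_left hle (inv_pos.2 hL).le
    rw [List.length_cons, pow_succ]
    refine hstep.trans ?_
    have h5 : ∀ s : ℝ, L⁻¹ * (m * s) = m / L * s := fun s => by ring
    rw [h5] at h4
    linarith

/-- Summing over the standard basis gives uniformity in `x` at the price of the dimension; this is
the source of the logarithm in the signal bound. -/
theorem integral_frobenius_contractionProd_le {A : I → Ω → Matrix ι κ ℝ}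
    (hA : ∀ i, Measurable (A i))
    (hind : iIndepFun A μ) {L m : ℝ} (hL : 0 < L) (hmL : m ≤ L)
    (hAL : ∀ i ω y, ((A i ω)ᵀ *ᵥ y) ⬝ᵥ ((A i ω)ᵀ *ᵥ y) ≤ L * (y ⬝ᵥ y))
    (hm : ∀ i y, m * (y ⬝ᵥ y) ≤ ∫ ω, ((A i ω)ᵀ *ᵥ y) ⬝ᵥ ((A i ω)ᵀ *ᵥ y) ∂μ)
    {l : List I} (hl : l.Nodup) :
    Integrable (fun ω => ∑ a, ∑ b, contractionProd L (fun i => A i ω) l b a ^ 2) μ ∧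
    ∫ ω, ∑ a, ∑ b, contractionProd L (fun i => A i ω) l b a ^ 2 ∂μ ≤
        Fintype.card ι * (1 - m / L) ^ l.length := by
  have hAm : Measurable fun ω i => A i ω := measurable_pi_iff.2 hA
  have hcol : ∀ (a : ι) (P : Matrix ι ι ℝ), ∑ b, P b a ^ 2 =
      (P *ᵥ Pi.single a 1) ⬝ᵥ (P *ᵥ Pi.single a 1) := fun a P => by
    simp [dotProduct, sq]
  have hint : ∀ a, Integrable (fun ω => (contractionProd L (fun i => A i ω) l *ᵥ Pi.single a 1) ⬝ᵥ
      (contractionProd L (fun i => A i ω) l *ᵥ Pi.single a 1)) μ := fun a => by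
    have hYm : Measurable fun ω => contractionProd L (fun i => A i ω) l *ᵥ Pi.single a 1 :=
      Matrix.measurable_mulVec ((measurable_contractionProd L l).comp hAm) measurable_const
    refine Integrable.of_bound (measurable_dotProduct hYm hYm).aestronglyMeasurable
      (Pi.single a 1 ⬝ᵥ Pi.single a 1) (ae_of_all _ fun ω => ?_)
    rw [Real.norm_of_nonneg (dotProduct_self_nonneg' _)]
    exact dotProduct_self_contractionProd_le hL (fun i => hAL i ω) l _
  simp_rw [hcol]
  refine ⟨integrable_finsetSum _ fun a _ => hint a, ?_⟩
  rw [integral_finsetSum _ fun a _ => hint a]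
  calc _ ≤ ∑ a : ι, (1 - m / L) ^ l.length * ((Pi.single a 1 : ι → ℝ) ⬝ᵥ Pi.single a 1) :=
        Finset.sum_le_sum fun a _ => integral_contractionProd_le hA hind hL hmL hAL hm hl _
    _ = _ := by simp

/-- The number of lists of indices for which the Frobenius norm of the product is not small. -/
noncomputable def badCount (L : ℝ) (A : I → Matrix ι κ ℝ) : List (List I) → ℕ
  | [] => 0
  | l :: Ls => (if 1 / 4 ≤ ∑ a, ∑ b, contractionProd L A l b a ^ 2 then 1 else 0) + badCount L A Ls

theorem badCount_congr (L : ℝ) {A A' : I → Matrix ι κ ℝ} {Ls : List (List I)}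
    (h : ∀ i ∈ Ls.flatten, A i = A' i) : badCount L A Ls = badCount L A' Ls := by
  induction Ls with
  | nil => rfl
  | cons l Ls ih =>
    rw [badCount, badCount, ih fun i hi => h i (by simp only [List.flatten_cons, List.mem_append,
      hi, or_true]), contractionProd_congr L fun i hi => h i (by
      simp only [List.flatten_cons, List.mem_append, hi, true_or])]

theorem badCount_le_length (L : ℝ) (A : I → Matrix ι κ ℝ) (Ls : List (List I)) :
    badCount L A Ls ≤ Ls.length := by
  induction Ls with
  | nil => simp [badCount]
  | cons l Ls ih =>
    rw [badCount, List.length_cons]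
    split_ifs <;> omega

theorem measurableSet_frobenius_contractionProd (L : ℝ) (l : List I) :
    MeasurableSet {A : I → Matrix ι κ ℝ | 1 / 4 ≤ ∑ a, ∑ b, contractionProd L A l b a ^ 2} :=
  measurableSet_le measurable_const (Finset.measurable_sum _ fun a _ =>
    Finset.measurable_sum _ fun b _ =>
      (Matrix.measurable_entry (measurable_contractionProd L l) b a).pow_const 2)

theorem measurable_badCount (L : ℝ) (Ls : List (List I)) :
    Measurable fun A : I → Matrix ι κ ℝ => badCount L A Ls := by
  induction Ls with
  | nil => exact measurable_const
  | cons l Ls ih =>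
    simp only [badCount]
    exact (Measurable.ite (measurableSet_frobenius_contractionProd L l) measurable_const
      measurable_const).add ih

theorem le_sum_of_badCount {L : ℝ} (hL : 0 < L) {A : I → Matrix ι κ ℝ}
    (hA : ∀ i y, ((A i)ᵀ *ᵥ y) ⬝ᵥ ((A i)ᵀ *ᵥ y) ≤ L * (y ⬝ᵥ y)) (Ls : List (List I))
    (x : ι → ℝ) :
    ((Ls.length : ℝ) - badCount L A Ls) * (L / 4 * (x ⬝ᵥ x)) ≤
      (Ls.flatten.map fun i => ((A i)ᵀ *ᵥ x) ⬝ᵥ ((A i)ᵀ *ᵥ x)).sum := by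
  induction Ls with
  | nil => simp [badCount]
  | cons l Ls ih =>
    rw [badCount, List.length_cons, List.flatten_cons, List.map_append, List.sum_append]
    split_ifs with h
    · have : 0 ≤ (l.map fun i => ((A i)ᵀ *ᵥ x) ⬝ᵥ ((A i)ᵀ *ᵥ x)).sum :=
        List.sum_nonneg (by simpa using fun _ _ => dotProduct_self_nonneg' _)
      push_cast
      linarith
    · have := le_sum_of_contractionProd hL hA (not_le.1 h) x
      push_cast
      linarith

/-- Distinct blocks are independent, so the exponential moment factorizes. For one block, `exp (4 ·
1_bad) ≤ 1 + 4 e⁴ ‖P‖_F²`, whose mean is at most `2 ≤ e` by `hN`. -/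
theorem integral_exp_badCount_le {A : I → Ω → Matrix ι κ ℝ} (hA : ∀ i, Measurable (A i))
    (hind : iIndepFun A μ) {L m : ℝ} (hL : 0 < L) (hmL : m ≤ L)
    (hAL : ∀ i ω y, ((A i ω)ᵀ *ᵥ y) ⬝ᵥ ((A i ω)ᵀ *ᵥ y) ≤ L * (y ⬝ᵥ y))
    (hm : ∀ i y, m * (y ⬝ᵥ y) ≤ ∫ ω, ((A i ω)ᵀ *ᵥ y) ⬝ᵥ ((A i ω)ᵀ *ᵥ y) ∂μ) {N : ℕ}
    (hN : Fintype.card ι * (1 - m / L) ^ N * 4 * Real.exp 4 ≤ 1) {Ls : List (List I)}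
    (hLs : Ls.flatten.Nodup) (hlen : ∀ l ∈ Ls, l.length = N) :
    ∫ ω, Real.exp (4 * badCount L (fun i => A i ω) Ls) ∂μ ≤ Real.exp Ls.length := by
  have hAm : Measurable fun ω i => A i ω := measurable_pi_iff.2 hA
  induction Ls with
  | nil => simp [badCount]
  | cons l Ls ih =>
    rw [List.flatten_cons] at hLs
    obtain ⟨hl, hLs', hdisj⟩ := List.nodup_append'.1 hLs
    have ih' := ih hLs' fun l hl => hlen l (List.mem_cons_of_mem _ hl)
    let S : Set (I → Matrix ι κ ℝ) :=
      {A | 1 / 4 ≤ ∑ a, ∑ b, contractionProd L A l b a ^ 2}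
    have hS : MeasurableSet S := measurableSet_frobenius_contractionProd L l
    classical
    let f : (I → Matrix ι κ ℝ) → ℝ := fun A => Real.exp (4 * (if A ∈ S then 1 else 0))
    let g : (I → Matrix ι κ ℝ) → ℝ := fun A => Real.exp (4 * badCount L A Ls)
    have hf : Measurable f := Real.measurable_exp.comp
      ((Measurable.ite hS measurable_const measurable_const).const_mul 4)
    have hg : Measurable g := Real.measurable_exp.comp
      ((measurable_from_nat.comp (measurable_badCount L Ls)).const_mul 4)
    have hfg : IndepFun (fun ω => f fun i => A i ω) (fun ω => g fun i => A i ω) μ := by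
      refine iIndepFun.indepFun_of_dependsOn hind hA (S := l.toFinset) (T := Ls.flatten.toFinset)
        ?_ hf hg ?_ ?_
      · rw [Finset.disjoint_left]
        intro i hi hi'
        exact hdisj (List.mem_toFinset.1 hi) (List.mem_toFinset.1 hi')
      · intro a b hab
        simp only [f, S, Set.mem_ofPred_eq,
          contractionProd_congr L fun i hi => hab i (List.mem_toFinset.2 hi)]
      · intro a b hab
        simp only [g, badCount_congr L fun i hi => hab i (List.mem_toFinset.2 hi)]
    have hprod : ∀ ω, Real.exp (4 * badCount L (fun i => A i ω) (l :: Ls)) =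
        f (fun i => A i ω) * g (fun i => A i ω) := fun ω => by
      simp only [f, g, ← Real.exp_add, badCount, S, Set.mem_ofPred_eq]
      congr 1
      split_ifs <;> push_cast <;> ring
    simp_rw [hprod]
    rw [hfg.integral_fun_mul_eq_mul_integral (hf.comp hAm).aestronglyMeasurable
      (hg.comp hAm).aestronglyMeasurable]
    have hfint : ∫ ω, f (fun i => A i ω) ∂μ ≤ Real.exp 1 := by
      obtain ⟨hi1, hi2⟩ := integral_frobenius_contractionProd_le hA hind hL hmL hAL hm hl
      rw [hlen l (List.mem_cons_self ..)] at hi2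
      have hpt : ∀ ω, f (fun i => A i ω) ≤ 1 + 4 * Real.exp 4 *
          ∑ a, ∑ b, contractionProd L (fun i => A i ω) l b a ^ 2 := fun ω => by
        have h0 : 0 ≤ ∑ a, ∑ b, contractionProd L (fun i => A i ω) l b a ^ 2 :=
          Finset.sum_nonneg fun a _ => Finset.sum_nonneg fun b _ => sq_nonneg _
        have he := Real.exp_pos 4
        simp only [f]
        split_ifs with h
        · have h' : 1 / 4 ≤ ∑ a, ∑ b, contractionProd L (fun i => A i ω) l b a ^ 2 := h
          rw [mul_one]
          nlinarith
        · rw [mul_zero, Real.exp_zero]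
          have := mul_nonneg he.le h0
          linarith
      have hfi : Integrable (fun ω => f fun i => A i ω) μ := by
        refine Integrable.of_bound (hf.comp hAm).aestronglyMeasurable (Real.exp 4)
          (ae_of_all _ fun ω => ?_)
        rw [Real.norm_of_nonneg (Real.exp_pos _).le]
        refine Real.exp_le_exp.2 ?_
        split_ifs <;> norm_num
      refine (integral_mono hfi ((integrable_const 1).add (hi1.const_mul _)) hpt).trans ?_
      have hsplit := integral_add (integrable_const (μ := μ) (1 : ℝ)) (hi1.const_mul (4 * Real.exp 4))
      simp only [integral_const, probReal_univ, smul_eq_mul, mul_one, integral_const_mul] at hsplit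
      refine hsplit.le.trans ?_
      have h2 := Real.add_one_le_exp (1 : ℝ)
      have h3 := mul_le_mul_of_nonneg_left hi2 (by positivity : 0 ≤ 4 * Real.exp 4)
      linarith
    rw [List.length_cons]
    push_cast
    rw [add_comm, Real.exp_add]
    refine mul_le_mul hfint ih' (integral_nonneg fun ω => (Real.exp_pos _).le) (Real.exp_pos _).le

/-- Markov for `exp (4 · bad)` at level `exp (2B)`, against a mean of at most `exp B`, leaves more
than half of the `B` blocks good. Each good block contributes `L/4`. -/
theorem exists_event_le_sum_flatten {A : I → Ω → Matrix ι κ ℝ} (hA : ∀ i, Measurable (A i))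
    (hind : iIndepFun A μ) {L m : ℝ} (hL : 0 < L) (hmL : m ≤ L)
    (hAL : ∀ i ω y, ((A i ω)ᵀ *ᵥ y) ⬝ᵥ ((A i ω)ᵀ *ᵥ y) ≤ L * (y ⬝ᵥ y))
    (hm : ∀ i y, m * (y ⬝ᵥ y) ≤ ∫ ω, ((A i ω)ᵀ *ᵥ y) ⬝ᵥ ((A i ω)ᵀ *ᵥ y) ∂μ) {N : ℕ}
    (hN : Fintype.card ι * (1 - m / L) ^ N * 4 * Real.exp 4 ≤ 1) {Ls : List (List I)}
    (hLs : Ls.flatten.Nodup) (hlen : ∀ l ∈ Ls, l.length = N) :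
    ∃ E : Set Ω, MeasurableSet E ∧ μ.real Eᶜ ≤ Real.exp (-Ls.length) ∧
      ∀ ω ∈ E, ∀ x, Ls.length * (L / 8 * (x ⬝ᵥ x)) ≤
        (Ls.flatten.map fun i => ((A i ω)ᵀ *ᵥ x) ⬝ᵥ ((A i ω)ᵀ *ᵥ x)).sum := by
  have hAm : Measurable fun ω i => A i ω := measurable_pi_iff.2 hA
  have hbm : Measurable fun ω => (badCount L (fun i => A i ω) Ls : ℝ) :=
    measurable_from_nat.comp ((measurable_badCount L Ls).comp hAm)
  refine ⟨{ω | (badCount L (fun i => A i ω) Ls : ℝ) < Ls.length / 2},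
    measurableSet_lt hbm measurable_const, ?_, ?_⟩
  · have hi := integral_exp_badCount_le hA hind hL hmL hAL hm hN hLs hlen
    have hint : Integrable (fun ω => Real.exp (4 * badCount L (fun i => A i ω) Ls)) μ := by
      refine Integrable.of_bound (Real.measurable_exp.comp (hbm.const_mul 4)).aestronglyMeasurable
        (Real.exp (4 * Ls.length)) (ae_of_all _ fun ω => ?_)
      rw [Real.norm_of_nonneg (Real.exp_pos _).le]
      refine Real.exp_le_exp.2 ?_
      have := badCount_le_length L (fun i => A i ω) Ls
      have : (badCount L (fun i => A i ω) Ls : ℝ) ≤ Ls.length := by exact_mod_cast this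
      linarith
    have hmk := mul_meas_ge_le_integral_of_nonneg (ae_of_all _ fun ω => (Real.exp_pos _).le) hint
      (Real.exp (2 * Ls.length))
    have hset : {ω | (badCount L (fun i => A i ω) Ls : ℝ) < Ls.length / 2}ᶜ =
        {ω | Real.exp (2 * Ls.length) ≤ Real.exp (4 * badCount L (fun i => A i ω) Ls)} := by
      ext ω
      simp only [Set.mem_compl_iff, Set.mem_ofPred_eq, not_lt, Real.exp_le_exp]
      constructor <;> intro h <;> linarith
    rw [hset]
    have h1 := hmk.trans hi
    have h2 : Real.exp (-Ls.length) = Real.exp Ls.length / Real.exp (2 * Ls.length) := by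
      rw [← Real.exp_sub]; congr 1; ring
    rw [h2, le_div_iff₀ (Real.exp_pos _)]
    linarith
  · intro ω hω x
    refine le_trans ?_ (le_sum_of_badCount hL (fun i => hAL i ω) Ls x)
    have hω' : (badCount L (fun i => A i ω) Ls : ℝ) < Ls.length / 2 := hω
    have := dotProduct_self_nonneg' x
    have h3 : 0 ≤ L / 4 * (x ⬝ᵥ x) := by positivity
    nlinarith

/-- A list contains `B` disjoint consecutive blocks of length `N` if its length is at least
`B * N`. -/
theorem List.exists_blocks (N : ℕ) : ∀ (B : ℕ) (l : List I), B * N ≤ l.length →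
    ∃ Ls : List (List I), Ls.length = B ∧ (∀ l' ∈ Ls, l'.length = N) ∧ Ls.flatten.Sublist l
  | 0, l, _ => ⟨[], by simp⟩
  | B + 1, l, h => by
    rw [Nat.succ_mul] at h
    obtain ⟨Ls, h1, h2, h3⟩ := List.exists_blocks N B (l.drop N) (by rw [List.length_drop]; omega)
    refine ⟨l.take N :: Ls, by simp [h1], ?_, ?_⟩
    · intro l' hl'
      rw [List.mem_cons] at hl'
      rcases hl' with rfl | hl'
      · rw [List.length_take]; omega
      · exact h2 l' hl'
    · rw [List.flatten_cons]
      conv_rhs => rw [← List.take_append_drop N l]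
      exact (List.Sublist.refl _).append h3

/-- A lower bound for sums of independent positive semidefinite matrices, with a loss that is
logarithmic in the dimension. -/
theorem exists_event_le_sum [Fintype I] {A : I → Ω → Matrix ι κ ℝ} (hA : ∀ i, Measurable (A i))
    (hind : iIndepFun A μ) {L m : ℝ} (hL : 0 < L) (hmL : m ≤ L)
    (hAL : ∀ i ω y, ((A i ω)ᵀ *ᵥ y) ⬝ᵥ ((A i ω)ᵀ *ᵥ y) ≤ L * (y ⬝ᵥ y))
    (hm : ∀ i y, m * (y ⬝ᵥ y) ≤ ∫ ω, ((A i ω)ᵀ *ᵥ y) ⬝ᵥ ((A i ω)ᵀ *ᵥ y) ∂μ) {N B : ℕ}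
    (hN : Fintype.card ι * (1 - m / L) ^ N * 4 * Real.exp 4 ≤ 1)
    (hB : B * N ≤ Fintype.card I) :
    ∃ E : Set Ω, MeasurableSet E ∧ μ.real Eᶜ ≤ Real.exp (-B) ∧
      ∀ ω ∈ E, ∀ x, B * (L / 8 * (x ⬝ᵥ x)) ≤
        ∑ i, ((A i ω)ᵀ *ᵥ x) ⬝ᵥ ((A i ω)ᵀ *ᵥ x) := by
  classical
  obtain ⟨Ls, hLen, hN', hsub⟩ := List.exists_blocks N B (Finset.univ : Finset I).toList
    (by rwa [Finset.length_toList])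
  have hnd : Ls.flatten.Nodup := hsub.nodup (Finset.nodup_toList _)
  obtain ⟨E, hE, hEm, hEb⟩ := exists_event_le_sum_flatten hA hind hL hmL hAL hm hN hnd hN'
  rw [hLen] at hEm hEb
  refine ⟨E, hE, hEm, fun ω hω x => (hEb ω hω x).trans ?_⟩
  rw [← List.sum_toFinset _ hnd]
  exact Finset.sum_le_univ_sum_of_nonneg fun i => dotProduct_self_nonneg' _

end ContractionExpectation

/-! ### Lower bound for the factor signal by truncation. -/

section Signal

variable {Ω : Type*} [MeasurableSpace Ω] {μ : Measure Ω} [IsProbabilityMeasure μ]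
  {k₁ k₂ p : ℕ}

-- Cauchy-Schwarz over the `k₂` coordinates of `Gᵀ y` reduces to fourth moments of sub-Gaussian
-- variables; this controls the mean lost by truncation.
omit [IsProbabilityMeasure μ] in
theorem BilinearSubGaussian.integral_sq_le {G : Ω → Matrix (Fin k₁) (Fin k₂) ℝ} {V : ℝ≥0}
    (hG : Measurable G) (h : BilinearSubGaussian μ G V) {y : Fin k₁ → ℝ} (hy : y ⬝ᵥ y = 1) :
    Integrable (fun ω => (((G ω)ᵀ *ᵥ y) ⬝ᵥ ((G ω)ᵀ *ᵥ y)) ^ 2) μ ∧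
      ∫ ω, (((G ω)ᵀ *ᵥ y) ⬝ᵥ ((G ω)ᵀ *ᵥ y)) ^ 2 ∂μ ≤ 48 * k₂ ^ 2 * Real.exp (V / 2) := by
  have hx : ∀ j, HasSubgaussianMGF (fun ω => ((G ω)ᵀ *ᵥ y) j) V μ := fun j => by
    have := h y (Pi.single j 1) V (by simp [hy])
    refine this.congr (ae_of_all _ fun ω => ?_)
    change y ⬝ᵥ G ω *ᵥ Pi.single j 1 = _
    rw [dotProduct_mulVec_transpose]
    simp
  have h4 := fun j => HasSubgaussianMGF.integral_pow_four_le (hx j)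
  have hm : Measurable fun ω => (G ω)ᵀ *ᵥ y :=
    Matrix.measurable_mulVec (Matrix.measurable_transpose hG) measurable_const
  have hpt : ∀ ω, (((G ω)ᵀ *ᵥ y) ⬝ᵥ ((G ω)ᵀ *ᵥ y)) ^ 2 ≤ k₂ * ∑ j, ((G ω)ᵀ *ᵥ y) j ^ 4 := fun ω => by
    have := sq_sum_le_card_mul_sum_sq (s := Finset.univ) (f := fun j => ((G ω)ᵀ *ᵥ y) j ^ 2)
    simp only [Finset.card_univ, Fintype.card_fin, ← pow_mul, Nat.reduceMul] at this
    simp only [dotProduct, ← sq]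
    exact this
  have hint : Integrable (fun ω => (k₂ : ℝ) * ∑ j, ((G ω)ᵀ *ᵥ y) j ^ 4) μ :=
    (integrable_finsetSum _ fun j _ => (h4 j).1).const_mul _
  have hint2 : Integrable (fun ω => (((G ω)ᵀ *ᵥ y) ⬝ᵥ ((G ω)ᵀ *ᵥ y)) ^ 2) μ := by
    refine hint.mono' ((measurable_dotProduct hm hm).pow_const 2).aestronglyMeasurable
      (ae_of_all _ fun ω => ?_)
    rw [Real.norm_of_nonneg (sq_nonneg _)]
    exact hpt ω
  refine ⟨hint2, (integral_mono hint2 hint hpt).trans ?_⟩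
  rw [integral_const_mul, integral_finsetSum _ fun j _ => (h4 j).1]
  calc _ ≤ (k₂ : ℝ) * ∑ j : Fin k₂, 48 * Real.exp (V / 2) := by
        gcongr with j
        exact (h4 j).2
    _ = _ := by simp; ring

theorem Matrix.measurable_mulVec_transpose_sq {G : Ω → Matrix (Fin k₁) (Fin k₂) ℝ}
    (hG : Measurable G) (C : Matrix (Fin p) (Fin k₂) ℝ) (y : Fin k₁ → ℝ) :
    Measurable fun ω => (C *ᵥ (G ω)ᵀ *ᵥ y) ⬝ᵥ (C *ᵥ (G ω)ᵀ *ᵥ y) := by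
  have hm : Measurable fun ω => C *ᵥ (G ω)ᵀ *ᵥ y :=
    Matrix.measurable_mulVec measurable_const
      (Matrix.measurable_mulVec (Matrix.measurable_transpose hG) measurable_const)
  exact measurable_dotProduct hm hm

/-- The rows `p^{-1/2} G Cᵀ` of the signal, set to zero where `G` is large. -/
noncomputable def truncatedSignal (r : ℝ) (C : Matrix (Fin p) (Fin k₂) ℝ)
    (G : Matrix (Fin k₁) (Fin k₂) ℝ) : Matrix (Fin k₁) (Fin p) ℝ :=
  open Classical in
  if G ∈ netBounded (Fin k₁) (Fin k₂) r then (√(p : ℝ))⁻¹ • (G * Cᵀ) else 0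

theorem measurable_truncatedSignal (r : ℝ) (C : Matrix (Fin p) (Fin k₂) ℝ) :
    Measurable (truncatedSignal (k₁ := k₁) r C) := by
  classical
  unfold truncatedSignal
  refine Measurable.ite (measurableSet_netBounded (ι := Fin k₁) (κ := Fin k₂) r) ?_ measurable_const
  have hm : Measurable fun G : Matrix (Fin k₁) (Fin k₂) ℝ => G * Cᵀ :=
    Matrix.measurable_mul measurable_id measurable_const
  exact Matrix.measurable_of_entries fun a b => (Matrix.measurable_entry hm a b).const_mul _

theorem truncatedSignal_sq (r : ℝ) (C : Matrix (Fin p) (Fin k₂) ℝ)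
    (G : Matrix (Fin k₁) (Fin k₂) ℝ) (y : Fin k₁ → ℝ) :
    ((truncatedSignal r C G)ᵀ *ᵥ y) ⬝ᵥ ((truncatedSignal r C G)ᵀ *ᵥ y) =
      (netBounded (Fin k₁) (Fin k₂) r).indicator
        (fun G => (p : ℝ)⁻¹ * ((C *ᵥ Gᵀ *ᵥ y) ⬝ᵥ (C *ᵥ Gᵀ *ᵥ y))) G := by
  classical
  by_cases h : G ∈ netBounded (Fin k₁) (Fin k₂) r
  · rw [Set.indicator_of_mem h, truncatedSignal, if_pos h, Matrix.transpose_smul,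
      Matrix.smul_mulVec, smul_dotProduct, dotProduct_smul, Matrix.transpose_mul,
      Matrix.transpose_transpose, ← Matrix.mulVec_mulVec, smul_eq_mul, smul_eq_mul, ← mul_assoc,
      ← mul_inv, Real.mul_self_sqrt (Nat.cast_nonneg _)]
  · rw [Set.indicator_of_notMem h, truncatedSignal, if_neg h]
    simp

theorem truncatedSignal_sq_le_sq (r : ℝ) (C : Matrix (Fin p) (Fin k₂) ℝ)
    (G : Matrix (Fin k₁) (Fin k₂) ℝ) (y : Fin k₁ → ℝ) :
    ((truncatedSignal r C G)ᵀ *ᵥ y) ⬝ᵥ ((truncatedSignal r C G)ᵀ *ᵥ y) ≤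
      (p : ℝ)⁻¹ * ((C *ᵥ Gᵀ *ᵥ y) ⬝ᵥ (C *ᵥ Gᵀ *ᵥ y)) := by
  rw [truncatedSignal_sq]
  exact Set.indicator_le_self' (fun _ _ => mul_nonneg (by positivity) (dotProduct_self_nonneg' _)) _

theorem truncatedSignal_sq_le {r D : ℝ} (hr : 0 ≤ r) (hD : 0 ≤ D) {C : Matrix (Fin p) (Fin k₂) ℝ}
    (hC : ∀ w, (C *ᵥ w) ⬝ᵥ (C *ᵥ w) ≤ D * p * (w ⬝ᵥ w))
    (G : Matrix (Fin k₁) (Fin k₂) ℝ) (y : Fin k₁ → ℝ) :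
    ((truncatedSignal r C G)ᵀ *ᵥ y) ⬝ᵥ ((truncatedSignal r C G)ᵀ *ᵥ y) ≤
      D * (16 * r ^ 2) * (y ⬝ᵥ y) := by
  rw [truncatedSignal_sq]
  have hy := dotProduct_self_nonneg' y
  by_cases h : G ∈ netBounded (Fin k₁) (Fin k₂) r
  · rw [Set.indicator_of_mem h]
    have h1 := hC (Gᵀ *ᵥ y)
    have h2 := mulVec_transpose_le_of_halfNet G hr h y
    rcases Nat.eq_zero_or_pos p with rfl | hp
    · simp; positivity
    have hp' : (0 : ℝ) < p := by exact_mod_cast hp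
    rw [inv_mul_le_iff₀ hp']
    calc _ ≤ _ := h1
      _ ≤ D * p * (16 * r ^ 2 * (y ⬝ᵥ y)) := by gcongr
      _ = _ := by ring
  · rw [Set.indicator_of_notMem h]
    positivity

/-- The truncation level is `√(2 V s (k₁ + k₂))` with this `s`. -/
noncomputable def truncFactor (D : ℝ) (V : ℝ≥0) : ℝ := 4 + Real.log (192 * D ^ 2) + V / 2

theorem le_truncFactor {D : ℝ} (hD : 1 ≤ D) (V : ℝ≥0) : 4 ≤ truncFactor D V := by
  have h1 : 0 ≤ Real.log (192 * D ^ 2) := Real.log_nonneg (by nlinarith)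
  have h2 : (0 : ℝ) ≤ V / 2 := by positivity
  unfold truncFactor
  linarith

/-- Let `q` be the untruncated form, of mean 1 and second moment at most `M`. The lost part is at
most `E q² / (4M) + M P(Bad) ≤ 1/4 + 1/4`. -/
theorem half_le_integral_truncatedSignal_sq {F : Ω → Matrix (Fin k₁) (Fin k₂) ℝ} {V : ℝ≥0}
    (hF : Measurable F) (hV : 0 < V) (h : BilinearSubGaussian μ F V) (hk₂ : 0 < k₂)
    {D : ℝ} (hD : 1 ≤ D) (hp : 0 < p) {C : Matrix (Fin p) (Fin k₂) ℝ}
    (hC : ∀ w, (C *ᵥ w) ⬝ᵥ (C *ᵥ w) ≤ D * p * (w ⬝ᵥ w))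
    (hFC : ∀ y, ∫ ω, (C *ᵥ (F ω)ᵀ *ᵥ y) ⬝ᵥ (C *ᵥ (F ω)ᵀ *ᵥ y) ∂μ = p * (y ⬝ᵥ y)) {r : ℝ}
    (hr : r = √(2 * V * (truncFactor D V * (k₁ + k₂ : ℕ)))) {y : Fin k₁ → ℝ}
    (hy : y ⬝ᵥ y = 1) :
    1 / 2 ≤ ∫ ω, ((truncatedSignal r C (F ω))ᵀ *ᵥ y) ⬝ᵥ
      ((truncatedSignal r C (F ω))ᵀ *ᵥ y) ∂μ := by
  have hp' : (0 : ℝ) < p := by exact_mod_cast hp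
  have hV' : (0 : ℝ) < V := hV
  have hs := le_truncFactor hD V
  obtain ⟨hi2, hM⟩ := h.integral_sq_le hF hy
  set M : ℝ := 48 * k₂ ^ 2 * Real.exp (V / 2) * D ^ 2 with hMdef
  have hMpos : 0 < M := by positivity
  set q : Ω → ℝ := fun ω => (p : ℝ)⁻¹ * ((C *ᵥ (F ω)ᵀ *ᵥ y) ⬝ᵥ (C *ᵥ (F ω)ᵀ *ᵥ y)) with hq
  have hqm : Measurable q := (Matrix.measurable_mulVec_transpose_sq hF C y).const_mul _
  have hq0 : ∀ ω, 0 ≤ q ω := fun ω => mul_nonneg (by positivity) (dotProduct_self_nonneg' _)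
  have hqle : ∀ ω, q ω ^ 2 ≤ D ^ 2 * (((F ω)ᵀ *ᵥ y) ⬝ᵥ ((F ω)ᵀ *ᵥ y)) ^ 2 := fun ω => by
    rw [← mul_pow]
    refine pow_le_pow_left₀ (hq0 ω) ?_ 2
    rw [hq, inv_mul_le_iff₀ hp']
    exact (hC _).trans (le_of_eq (by ring))
  have hq2i : Integrable (fun ω => q ω ^ 2) μ := by
    refine (hi2.const_mul (D ^ 2)).mono' (hqm.pow_const 2).aestronglyMeasurable
      (ae_of_all _ fun ω => ?_)
    rw [Real.norm_of_nonneg (sq_nonneg _)]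
    exact hqle ω
  have hq2M : ∫ ω, q ω ^ 2 ∂μ ≤ M := by
    refine (integral_mono hq2i (hi2.const_mul (D ^ 2)) hqle).trans ?_
    rw [integral_const_mul, hMdef, mul_comm]
    gcongr
  have hqi : Integrable q μ := by
    refine ((integrable_const (1 : ℝ)).add hq2i).mono' hqm.aestronglyMeasurable
      (ae_of_all _ fun ω => ?_)
    rw [Real.norm_of_nonneg (hq0 ω)]
    simp only [Pi.add_apply]
    nlinarith [sq_nonneg (q ω - 1)]
  have hq1 : ∫ ω, q ω ∂μ = 1 := by
    rw [hq, integral_const_mul, hFC, hy]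
    field_simp
  set Bad : Set Ω := {ω | F ω ∉ netBounded (Fin k₁) (Fin k₂) r} with hBad
  have hBadm : MeasurableSet Bad := (hF (measurableSet_netBounded r)).compl
  have hBadp : μ.real Bad ≤ 1 / (4 * M) := by
    refine (h.measure_not_netBounded_le (r := r) (by rw [hr]; positivity)).trans ?_
    have hr2 : r ^ 2 / (2 * V) = truncFactor D V * (k₁ + k₂ : ℕ) := by
      rw [hr, Real.sq_sqrt (by positivity), mul_div_cancel_left₀ _ (by positivity)]
    rw [hr2, Fintype.card_fin, Fintype.card_fin]
    have hk : (1 : ℝ) ≤ (k₁ + k₂ : ℕ) := by exact_mod_cast (by omega : 1 ≤ k₁ + k₂)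
    have hkk : (k₂ : ℝ) ≤ (k₁ + k₂ : ℕ) := by exact_mod_cast (by omega : k₂ ≤ k₁ + k₂)
    set k : ℝ := ((k₁ + k₂ : ℕ) : ℝ)
    -- The summands of `truncFactor` are matched to this: of the 4, one 2 pays for the nets and the
    -- other for `k₂² ≤ exp (2k)`, while `log (192 D²) + V/2` pays for the rest of `4M`.
    have h4M : 1 / (4 * M) = Real.exp (-(Real.log (192 * D ^ 2) + V / 2)) / k₂ ^ 2 := by
      rw [neg_add, Real.exp_add, Real.exp_neg, Real.exp_neg, Real.exp_log (by positivity), hMdef]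
      field_simp
      norm_num
    rw [h4M, le_div_iff₀ (by positivity)]
    have h2 : (k₂ : ℝ) ^ 2 ≤ Real.exp (2 * k) := by
      have h3 : (k₂ : ℝ) ≤ Real.exp k := by linarith [Real.add_one_le_exp k]
      calc (k₂ : ℝ) ^ 2 ≤ Real.exp k ^ 2 := by gcongr
        _ = _ := by rw [← Real.exp_nat_mul]; norm_num
    calc _ ≤ Real.exp (2 * k - truncFactor D V * k) * Real.exp (2 * k) := by gcongr
      _ = Real.exp ((4 - truncFactor D V) * k) := by rw [← Real.exp_add]; congr 1; ring
      _ ≤ _ := by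
          refine Real.exp_le_exp.2 ?_
          have : truncFactor D V = 4 + Real.log (192 * D ^ 2) + V / 2 := rfl
          nlinarith
  have hpt : ∀ ω, q ω ≤ ((truncatedSignal r C (F ω))ᵀ *ᵥ y) ⬝ᵥ
      ((truncatedSignal r C (F ω))ᵀ *ᵥ y) + (1 / (4 * M) * q ω ^ 2 +
        Bad.indicator (fun _ => M) ω) := fun ω => by
    rw [truncatedSignal_sq]
    by_cases hω : F ω ∈ netBounded (Fin k₁) (Fin k₂) r
    · rw [Set.indicator_of_mem hω, Set.indicator_of_notMem (fun hb : ω ∈ Bad => hb hω)]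
      have : 0 ≤ 1 / (4 * M) * q ω ^ 2 := by positivity
      linarith
    · rw [Set.indicator_of_notMem hω, Set.indicator_of_mem (show ω ∈ Bad from hω), zero_add,
        ← sub_nonneg]
      -- On the bad event `q ≤ q²/(4M) + M`, by completing the square.
      have : 1 / (4 * M) * q ω ^ 2 + M - q ω = 1 / (4 * M) * (q ω - 2 * M) ^ 2 := by
        field_simp; ring
      rw [this]
      positivity
  have hti : Integrable (fun ω => ((truncatedSignal r C (F ω))ᵀ *ᵥ y) ⬝ᵥ
      ((truncatedSignal r C (F ω))ᵀ *ᵥ y)) μ := by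
    have hm : Measurable fun ω => (truncatedSignal r C (F ω))ᵀ *ᵥ y :=
      Matrix.measurable_mulVec (Matrix.measurable_transpose
        ((measurable_truncatedSignal r C).comp hF)) measurable_const
    refine hqi.mono' (measurable_dotProduct hm hm).aestronglyMeasurable (ae_of_all _ fun ω => ?_)
    rw [Real.norm_of_nonneg (dotProduct_self_nonneg' _)]
    exact truncatedSignal_sq_le_sq r C (F ω) y
  have hbi : Integrable (Bad.indicator fun _ => M) μ := (integrable_const M).indicator hBadm
  have hfin := integral_mono hqi (hti.add ((hq2i.const_mul (1 / (4 * M))).add hbi)) hpt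
  have hs1 := integral_add hti ((hq2i.const_mul (1 / (4 * M))).add hbi)
  have hs2 := integral_add (hq2i.const_mul (1 / (4 * M))) hbi
  simp only [Pi.add_apply] at hs1 hs2
  rw [hq1] at hfin
  rw [integral_const_mul, integral_indicator_const M hBadm, smul_eq_mul] at hs2
  have h5 : 1 / (4 * M) * ∫ ω, q ω ^ 2 ∂μ ≤ 1 / 4 := by
    calc _ ≤ 1 / (4 * M) * M := by gcongr
      _ = 1 / 4 := by field_simp
  have h6 : μ.real Bad * M ≤ 1 / 4 := by
    calc _ ≤ 1 / (4 * M) * M := by gcongr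
      _ = 1 / 4 := by field_simp
  have h7 := hfin.trans hs1.le
  rw [hs2] at h7
  linarith

/-- The operator norm of a truncated signal is at most `(k₁ + k₂) * signalConst D V`. -/
noncomputable def signalConst (D : ℝ) (V : ℝ≥0) : ℝ := 32 * D * V * truncFactor D V

theorem one_le_signalConst {D : ℝ} (hD : 1 ≤ D) {V : ℝ≥0} (hV : 1 ≤ V) : 1 ≤ signalConst D V := by
  have h1 := le_truncFactor hD V
  have h2 : (1 : ℝ) ≤ V := hV
  unfold signalConst
  have h3 : 1 ≤ D * V := one_le_mul_of_one_le_of_one_le hD h2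
  nlinarith

theorem exists_event_le_sum_signal {n : ℕ} {F : Fin n → Ω → Matrix (Fin k₁) (Fin k₂) ℝ}
    {V : ℝ≥0} (hF : ∀ i, Measurable (F i)) (hind : iIndepFun F μ) (hV : 1 ≤ V)
    (h : ∀ i, BilinearSubGaussian μ (F i) V) (hk₁ : 0 < k₁) (hk₂ : 0 < k₂)
    {D : ℝ} (hD : 1 ≤ D) (hp : 0 < p) {C : Matrix (Fin p) (Fin k₂) ℝ}
    (hC : ∀ w, (C *ᵥ w) ⬝ᵥ (C *ᵥ w) ≤ D * p * (w ⬝ᵥ w))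
    (hFC : ∀ i y, ∫ ω, (C *ᵥ (F i ω)ᵀ *ᵥ y) ⬝ᵥ (C *ᵥ (F i ω)ᵀ *ᵥ y) ∂μ = p * (y ⬝ᵥ y))
    {t : ℝ} (ht : 1 ≤ t)
    (hn : 84 * signalConst D V * (t * (max k₁ k₂ : ℕ) * (Real.log k₁ + t)) ≤ n) :
    ∃ E : Set Ω, MeasurableSet E ∧ μ.real Eᶜ ≤ Real.exp (-t) ∧ ∀ ω ∈ E, ∀ y,
      n * (1 / (48 * (Real.log k₁ + 7)) * p) * (y ⬝ᵥ y) ≤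
        ∑ i, (C *ᵥ (F i ω)ᵀ *ᵥ y) ⬝ᵥ (C *ᵥ (F i ω)ᵀ *ᵥ y) := by
  have hp' : (0 : ℝ) < p := by exact_mod_cast hp
  have hV' : (1 : ℝ) ≤ V := hV
  have hVpos : 0 < V := lt_of_lt_of_le one_pos hV
  have hs := le_truncFactor hD V
  have hSC := one_le_signalConst hD hV
  have hk₁' : (1 : ℝ) ≤ k₁ := by exact_mod_cast hk₁
  have hlog : 0 ≤ Real.log k₁ := Real.log_nonneg hk₁'
  set k : ℝ := ((k₁ + k₂ : ℕ) : ℝ) with hk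
  have hk1 : 1 ≤ k := by rw [hk]; exact_mod_cast (by omega : 1 ≤ k₁ + k₂)
  set r := √(2 * V * (truncFactor D V * k)) with hr
  set L := signalConst D V * k with hLdef
  have hL1 : 1 ≤ L := one_le_mul_of_one_le_of_one_le hSC hk1
  have hL : 0 < L := by linarith
  have hLr : D * (16 * r ^ 2) = L := by
    rw [hr, Real.sq_sqrt (by positivity), hLdef, signalConst]
    ring
  set A : Fin n → Ω → Matrix (Fin k₁) (Fin p) ℝ := fun i ω => truncatedSignal r C (F i ω)
  have hAm : ∀ i, Measurable (A i) := fun i => (measurable_truncatedSignal r C).comp (hF i)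
  have hAind : iIndepFun A μ := hind.comp _ fun i => measurable_truncatedSignal r C
  have hAL : ∀ i ω y, ((A i ω)ᵀ *ᵥ y) ⬝ᵥ ((A i ω)ᵀ *ᵥ y) ≤ L * (y ⬝ᵥ y) := fun i ω y => by
    rw [← hLr]
    exact truncatedSignal_sq_le (Real.sqrt_nonneg _) (by linarith) hC _ y
  have hmean : ∀ i y, 1 / 2 * (y ⬝ᵥ y) ≤ ∫ ω, ((A i ω)ᵀ *ᵥ y) ⬝ᵥ ((A i ω)ᵀ *ᵥ y) ∂μ := by
    intro i y
    rcases (dotProduct_self_nonneg' y).eq_or_lt with h0 | h0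
    · rw [← h0, mul_zero]
      exact integral_nonneg fun ω => dotProduct_self_nonneg' _
    · set a := √(y ⬝ᵥ y) with ha
      have ha2 : a * a = y ⬝ᵥ y := Real.mul_self_sqrt h0.le
      have hapos : 0 < a := Real.sqrt_pos.2 h0
      have hunit : (a⁻¹ • y) ⬝ᵥ (a⁻¹ • y) = 1 := by
        rw [smul_dotProduct, dotProduct_smul, ← ha2, smul_eq_mul, smul_eq_mul]
        field_simp
      have := half_le_integral_truncatedSignal_sq (hF i) hVpos (h i) hk₂ hD hp hC (hFC i) hr hunit
      have hscale : ∀ ω, ((truncatedSignal r C (F i ω))ᵀ *ᵥ (a⁻¹ • y)) ⬝ᵥ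
          ((truncatedSignal r C (F i ω))ᵀ *ᵥ (a⁻¹ • y)) =
          (y ⬝ᵥ y)⁻¹ * (((A i ω)ᵀ *ᵥ y) ⬝ᵥ ((A i ω)ᵀ *ᵥ y)) := fun ω => by
        rw [Matrix.mulVec_smul, smul_dotProduct, dotProduct_smul, smul_eq_mul, smul_eq_mul,
          ← mul_assoc, ← mul_inv, ha2]
      simp_rw [hscale] at this
      rw [integral_const_mul, inv_mul_eq_div, le_div_iff₀ h0] at this
      exact this
  -- With `m = 1/2` this block length gives `(1 - 1/(2L))^N ≤ e^{-7}/k₁`: the logarithm cancels the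
  -- dimension, and 7 suffices since `4 e⁴ e^{-7} ≤ 1`.
  set N := ⌈2 * L * (Real.log k₁ + 7)⌉₊ with hN
  have hNle : 2 * L * (Real.log k₁ + 7) ≤ N := Nat.le_ceil _
  have hNge : (N : ℝ) ≤ 3 * L * (Real.log k₁ + 7) := by
    have := (Nat.ceil_lt_add_one (by positivity : 0 ≤ 2 * L * (Real.log k₁ + 7))).le
    nlinarith
  have hNpos : (0 : ℝ) < N := lt_of_lt_of_le (by positivity) hNle
  have hcond : (Fintype.card (Fin k₁) : ℝ) * (1 - 1 / 2 / L) ^ N * 4 * Real.exp 4 ≤ 1 := by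
    rw [Fintype.card_fin]
    have h1 : (1 - 1 / 2 / L) ^ N ≤ Real.exp (-(Real.log k₁ + 7)) := by
      have h0 : 0 ≤ 1 - 1 / 2 / L := by
        rw [sub_nonneg, div_le_one hL]; linarith
      calc (1 - 1 / 2 / L) ^ N ≤ Real.exp (-(1 / 2 / L)) ^ N :=
            pow_le_pow_left₀ h0 (by linarith [Real.add_one_le_exp (-(1 / 2 / L))]) N
        _ = Real.exp (-(N / (2 * L))) := by
            rw [← Real.exp_nat_mul]; congr 1; field_simp
        _ ≤ _ := by
            refine Real.exp_le_exp.2 (neg_le_neg ?_)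
            rw [le_div_iff₀ (by positivity)]
            linarith
    have h2 : Real.exp (-(Real.log k₁ + 7)) = (k₁ : ℝ)⁻¹ * Real.exp (-7) := by
      rw [neg_add, Real.exp_add, Real.exp_neg, Real.exp_log (by positivity)]
    have h3 : Real.exp 4 * Real.exp (-7) * 4 ≤ 1 := by
      have h4 : Real.exp 4 * Real.exp (-7) = (Real.exp 3)⁻¹ := by
        rw [← Real.exp_add, ← Real.exp_neg]; norm_num
      rw [h4, inv_mul_le_iff₀ (Real.exp_pos _)]
      linarith [Real.add_one_le_exp (3 : ℝ)]
    calc _ ≤ (k₁ : ℝ) * ((k₁ : ℝ)⁻¹ * Real.exp (-7)) * 4 * Real.exp 4 := by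
          rw [← h2]; gcongr
      _ = Real.exp 4 * Real.exp (-7) * 4 := by field_simp
      _ ≤ 1 := h3
  have hn' : 2 * t * N ≤ n := by
    refine le_trans ?_ hn
    have h1 : k ≤ 2 * ((max k₁ k₂ : ℕ) : ℝ) := by
      rw [hk]; exact_mod_cast (by omega : k₁ + k₂ ≤ 2 * max k₁ k₂)
    have h2 : Real.log k₁ + 7 ≤ 7 * (Real.log k₁ + t) := by linarith
    calc 2 * t * N ≤ 2 * t * (3 * L * (Real.log k₁ + 7)) := by gcongr
      _ ≤ 2 * t * (3 * (signalConst D V * (2 * ((max k₁ k₂ : ℕ) : ℝ))) *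
          (7 * (Real.log k₁ + t))) := by rw [hLdef]; gcongr
      _ = _ := by ring
  -- Rounding down costs at most a factor 2, because `n ≥ 2 t N ≥ 2 N`.
  have hB1 : (n : ℝ) / (2 * N) ≤ ((n / N : ℕ) : ℝ) := by
    have h1 : (n : ℝ) < N * ((n / N : ℕ) + 1) := by
      exact_mod_cast Nat.lt_mul_div_succ n (by exact_mod_cast hNpos)
    rw [div_le_iff₀ (by positivity)]
    nlinarith
  have hBt : t ≤ ((n / N : ℕ) : ℝ) := by
    refine le_trans ?_ hB1
    rw [le_div_iff₀ (by positivity)]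
    linarith
  obtain ⟨E, hE, hEp, hEb⟩ := exists_event_le_sum hAm hAind hL (by linarith : 1 / 2 ≤ L) hAL hmean
    hcond (B := n / N) (by rw [Fintype.card_fin]; exact Nat.div_mul_le_self n N)
  refine ⟨E, hE, hEp.trans (Real.exp_le_exp.2 (neg_le_neg hBt)), fun ω hω y => ?_⟩
  have h1 := hEb ω hω y
  have hy := dotProduct_self_nonneg' y
  have h2 : ∑ i, ((A i ω)ᵀ *ᵥ y) ⬝ᵥ ((A i ω)ᵀ *ᵥ y) ≤
      (p : ℝ)⁻¹ * ∑ i, (C *ᵥ (F i ω)ᵀ *ᵥ y) ⬝ᵥ (C *ᵥ (F i ω)ᵀ *ᵥ y) := by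
    rw [Finset.mul_sum]
    exact Finset.sum_le_sum fun i _ => truncatedSignal_sq_le_sq r C (F i ω) y
  -- The factor `L`, of order `k₁ + k₂`, cancels: about `n/N` blocks each yield `L/8`, and `N ≤ 3 L
  -- (log k₁ + 7)`. Only the logarithm is lost.
  have h3 : (n : ℝ) * (1 / (48 * (Real.log k₁ + 7))) ≤ (n / N : ℕ) * (L / 8) := by
    have h4 : (n : ℝ) * (1 / (48 * (Real.log k₁ + 7))) ≤ (n : ℝ) / (2 * N) * (L / 8) := by
      rw [div_mul_div_comm, mul_one_div, div_le_div_iff₀ (by positivity) (by positivity)]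
      have : (0 : ℝ) ≤ n := Nat.cast_nonneg n
      nlinarith
    exact h4.trans (mul_le_mul_of_nonneg_right hB1 (by positivity))
  have h5 := (mul_le_mul_of_nonneg_right h3 hy).trans
    ((le_of_eq (by ring)).trans (h1.trans h2))
  rw [inv_mul_eq_div, le_div_iff₀ hp'] at h5
  linarith

end Signal

/-! ### From the entrywise normalization to quadratic forms. -/

section Normalization

variable {Ω : Type*} [MeasurableSpace Ω] {μ : Measure Ω} [IsProbabilityMeasure μ]
  {k₁ k₂ p : ℕ}

theorem integral_mulVec_transpose_sq_of_normalized {G : Ω → Matrix (Fin k₁) (Fin k₂) ℝ} {V : ℝ≥0}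
    (hG : Measurable G) (h : BilinearSubGaussian μ G V) (hp : 0 < p)
    {D : ℝ} (hD : 0 ≤ D) {C : Matrix (Fin p) (Fin k₂) ℝ}
    (hC : ∀ w, (C *ᵥ w) ⬝ᵥ (C *ᵥ w) ≤ D * p * (w ⬝ᵥ w))
    (hnorm : matrixExpectation μ (fun ω => (p : ℝ)⁻¹ • (G ω * (Cᵀ * C) * (G ω)ᵀ)) = 1)
    (y : Fin k₁ → ℝ) :
    ∫ ω, (C *ᵥ (G ω)ᵀ *ᵥ y) ⬝ᵥ (C *ᵥ (G ω)ᵀ *ᵥ y) ∂μ = p * (y ⬝ᵥ y) := by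
  have hp' : (0 : ℝ) < p := by exact_mod_cast hp
  have hsq : ∀ r, Integrable (fun ω => (C *ᵥ (G ω)ᵀ *ᵥ Pi.single r 1) ⬝ᵥ
      (C *ᵥ (G ω)ᵀ *ᵥ Pi.single r 1)) μ := fun r => by
    have h2 := (h.integral_sq_le hG (y := Pi.single r 1) (by simp)).1
    refine (((integrable_const (1 : ℝ)).add h2).const_mul (D * p)).mono'
      (Matrix.measurable_mulVec_transpose_sq hG C _).aestronglyMeasurable (ae_of_all _ fun ω => ?_)
    rw [Real.norm_of_nonneg (dotProduct_self_nonneg' _)]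
    refine (hC _).trans (mul_le_mul_of_nonneg_left ?_ (by positivity))
    simp only [Pi.add_apply]
    nlinarith [sq_nonneg (((G ω)ᵀ *ᵥ Pi.single r 1) ⬝ᵥ ((G ω)ᵀ *ᵥ Pi.single r 1) - 1)]
  have hentry : ∀ ω r s, (G ω * (Cᵀ * C) * (G ω)ᵀ) r s =
      (C *ᵥ (G ω)ᵀ *ᵥ Pi.single r 1) ⬝ᵥ (C *ᵥ (G ω)ᵀ *ᵥ Pi.single s 1) := fun ω r s => by
    have h1 : G ω * (Cᵀ * C) * (G ω)ᵀ = (C * (G ω)ᵀ)ᵀ * (C * (G ω)ᵀ) := by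
      rw [Matrix.transpose_mul, Matrix.transpose_transpose]
      simp only [Matrix.mul_assoc]
    rw [h1, Matrix.mulVec_mulVec, Matrix.mulVec_mulVec]
    simp [Matrix.mul_apply, dotProduct, mul_comm]
  have hcol : ∀ r, Measurable fun ω => C *ᵥ (G ω)ᵀ *ᵥ (Pi.single r 1 : Fin k₁ → ℝ) := fun r =>
    Matrix.measurable_mulVec measurable_const
      (Matrix.measurable_mulVec (Matrix.measurable_transpose hG) measurable_const)
  -- The Bochner integral of a non-integrable entry would be 0, so the entrywise normalization can
  -- be summed up only once integrability is known.
  have hint : ∀ r s, Integrable (fun ω => (G ω * (Cᵀ * C) * (G ω)ᵀ) r s) μ := fun r s => by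
    simp_rw [hentry]
    refine ((hsq r).add (hsq s)).mono'
      (measurable_dotProduct (hcol r) (hcol s)).aestronglyMeasurable (ae_of_all _ fun ω => ?_)
    have h1 := dotProduct_sq_le (C *ᵥ (G ω)ᵀ *ᵥ Pi.single r 1) (C *ᵥ (G ω)ᵀ *ᵥ Pi.single s 1)
    have h2 := dotProduct_self_nonneg' (C *ᵥ (G ω)ᵀ *ᵥ Pi.single r 1)
    have h3 := dotProduct_self_nonneg' (C *ᵥ (G ω)ᵀ *ᵥ Pi.single s 1)
    rw [Real.norm_eq_abs]
    refine abs_le_of_sq_le_sq (h1.trans ?_) (add_nonneg h2 h3)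
    rw [Pi.add_apply, add_sq]
    nlinarith [mul_nonneg h2 h3]
  have hval : ∀ r s, ∫ ω, (G ω * (Cᵀ * C) * (G ω)ᵀ) r s ∂μ =
      p * (1 : Matrix (Fin k₁) (Fin k₁) ℝ) r s := fun r s => by
    have h1 := congrFun (congrFun hnorm r) s
    simp only [matrixExpectation, Matrix.of_apply, Matrix.smul_apply, smul_eq_mul] at h1
    rw [integral_const_mul] at h1
    rw [← h1, mul_inv_cancel_left₀ hp'.ne']
  have hquad : ∀ ω, (C *ᵥ (G ω)ᵀ *ᵥ y) ⬝ᵥ (C *ᵥ (G ω)ᵀ *ᵥ y) =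
      ∑ r, ∑ s, y r * y s * (G ω * (Cᵀ * C) * (G ω)ᵀ) r s := fun ω => by
    have h1 : (C *ᵥ (G ω)ᵀ *ᵥ y) ⬝ᵥ (C *ᵥ (G ω)ᵀ *ᵥ y) =
        y ⬝ᵥ (G ω * (Cᵀ * C) * (G ω)ᵀ) *ᵥ y := by
      simp only [← Matrix.mulVec_mulVec]
      rw [dotProduct_mulVec_transpose (G ω), dotProduct_mulVec_transpose Cᵀ,
        Matrix.transpose_transpose]
    rw [h1, dotProduct]
    refine Finset.sum_congr rfl fun r _ => ?_
    rw [Matrix.mulVec, dotProduct, Finset.mul_sum]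
    exact Finset.sum_congr rfl fun s _ => by ring
  simp_rw [hquad]
  rw [integral_finsetSum _ fun r _ => integrable_finsetSum _ fun s _ => (hint r s).const_mul _]
  have h2 : ∀ r, ∫ ω, ∑ s, y r * y s * (G ω * (Cᵀ * C) * (G ω)ᵀ) r s ∂μ = p * (y r * y r) := by
    intro r
    rw [integral_finsetSum _ fun s _ => (hint r s).const_mul _]
    simp_rw [integral_const_mul, hval]
    rw [Finset.sum_eq_single r]
    · rw [Matrix.one_apply_eq]; ring
    · intro s _ hsr
      rw [Matrix.one_apply_ne hsr.symm]; ring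
    · simp
  simp_rw [h2, dotProduct, Finset.mul_sum]

end Normalization

/-! ### The threshold on the pre-training error and the row bound. -/

theorem bounds_of_pretrainError_le {t ε : ℝ} {k₁ k₂ n k p : ℕ} (ht : 0 ≤ t)
    (hn : 0 < n) (h : pretrainError t k₁ k₂ n k p ≤ ε) :
    t * (max k₁ k₂ : ℕ) * (Real.log k + t) ≤ ε ^ 2 * n ∧ 1 / √(p : ℝ) ≤ ε := by
  have hn' : (0 : ℝ) < n := by exact_mod_cast hn
  have hlog : 0 ≤ Real.log k := Real.log_natCast_nonneg k
  have h1 : 0 ≤ √(t * (max k₁ k₂ : ℕ)) * √((Real.log k + t) / n) := by positivity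
  have h2 : 0 ≤ 1 / √(p : ℝ) := by positivity
  unfold pretrainError at h
  refine ⟨?_, by linarith⟩
  have h3 : √(t * (max k₁ k₂ : ℕ)) * √((Real.log k + t) / n) ≤ ε := by linarith
  have h4 := pow_le_pow_left₀ h1 h3 2
  rw [mul_pow, Real.sq_sqrt (by positivity), Real.sq_sqrt (by positivity), mul_div_assoc',
    div_le_iff₀ hn'] at h4
  exact h4

/-- Since `log k ≤ log p = 2 log √p ≤ 2 √p`, the logarithmic loss of the signal is absorbed by
replacing `1/p` with `1/√p`. -/
theorem log_add_seven_div_le {k p : ℕ} (hk : 0 < k) (hkp : k ≤ p) :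
    (Real.log k + 7) / p ≤ 9 * (1 / √(p : ℝ)) := by
  have hk' : (0 : ℝ) < k := by exact_mod_cast hk
  have hp : (1 : ℝ) ≤ p := by exact_mod_cast (by omega : 1 ≤ p)
  set s := √(p : ℝ) with hs
  have hs1 : 1 ≤ s := Real.one_le_sqrt.2 hp
  have hss : s * s = p := Real.mul_self_sqrt (by linarith)
  have h1 : Real.log k ≤ 2 * s := by
    have h2 : Real.log k ≤ Real.log (s * s) := by
      rw [hss]; exact Real.log_le_log hk' (by exact_mod_cast hkp)
    rw [Real.log_mul (by positivity) (by positivity)] at h2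
    linarith [Real.log_le_sub_one_of_pos (by positivity : 0 < s)]
  rw [mul_one_div, div_le_div_iff₀ (by linarith) (by linarith), ← hss]
  nlinarith

section RowBound

/-- The lower bound on the smallest singular value of the row transformation matrix. -/
theorem exists_row_threshold (α : ℝ) {cR D : ℝ} {V : ℝ≥0} (hα : -1 ≤ α) (hcR : 0 < cR)
    (hD : 1 ≤ D) (hV : 1 ≤ V) : ∃ ε : ℝ, 0 < ε ∧
    ∀ (Ω : Type*) [MeasurableSpace Ω] (μ : Measure Ω) [IsProbabilityMeasure μ]
      (p₁ p₂ k₁ k₂ n : ℕ), 0 < k₁ → 0 < k₂ → 0 < n → 0 < p₁ → 0 < p₂ →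
    ∀ (R : Matrix (Fin p₁) (Fin k₁) ℝ) (C : Matrix (Fin p₂) (Fin k₂) ℝ)
      (F : Fin n → Ω → Matrix (Fin k₁) (Fin k₂) ℝ) (U : Fin n → Ω → Matrix (Fin p₁) (Fin p₂) ℝ),
      (∀ i, Measurable (F i)) → (∀ i, Measurable (U i)) → iIndepFun F μ → iIndepFun U μ →
      (∀ i, BilinearSubGaussian μ (F i) V) → (∀ i, BilinearSubGaussian μ (U i) V) →
      (∀ u, cR * p₁ * (u ⬝ᵥ u) ≤ (R *ᵥ u) ⬝ᵥ (R *ᵥ u)) →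
      (∀ w, (C *ᵥ w) ⬝ᵥ (C *ᵥ w) ≤ D * p₂ * (w ⬝ᵥ w)) →
      (∀ i y, ∫ ω, (C *ᵥ (F i ω)ᵀ *ᵥ y) ⬝ᵥ (C *ᵥ (F i ω)ᵀ *ᵥ y) ∂μ = p₂ * (y ⬝ᵥ y)) →
    ∀ t : ℝ, 1 ≤ t → ∃ E : Set Ω, MeasurableSet E ∧ μ.real Eᶜ ≤ 3 * Real.exp (-t) ∧
      ∀ ω ∈ E, ∀ W : Matrix (Fin p₁) (Fin k₁) ℝ, IsAlphaPCARow α (fun i => mfmObs R C F U i ω) W →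
        pretrainError t k₁ k₂ n k₁ p₁ ≤ ε → √(cR / 2) ≤ nuMin (transformationMatrix W R) := by
  have hV' : (1 : ℝ) ≤ V := hV
  have hVpos : 0 < V := lt_of_lt_of_le one_pos hV
  have hSC := one_le_signalConst hD hV
  -- The perturbation condition `4 (2 + |α|) η ≤ cR κ` with `κ = 1/(96 (log k₁ + 7))` reads `η (log
  -- k₁ + 7) ≤ γ`.
  set γ := cR / (384 * (2 + |α|)) with hγ
  have hαpos : 0 < 2 + |α| := by positivity
  have hγpos : 0 < γ := by positivity
  -- The four constraints serve the sample size for the signal, the smallness of the factor mean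
  -- (`107520 = 32 · 5 · 96 · 7`), `ε² ≤ ε`, and the noise (`1248 = 32 (3 · 7 + 2 · 9)`).
  set ε := min (min (1 / (84 * signalConst D V)) (1 / (107520 * (D * V))))
    (min 1 (γ / (1248 * V))) with hε
  have hε0 : 0 < ε := by positivity
  have hε1 : ε ≤ 1 := (min_le_right _ _).trans (min_le_left _ _)
  have hεsq : ε ^ 2 ≤ ε := by nlinarith
  have hεS : 84 * signalConst D V * ε ≤ 1 := by
    have h1 : ε ≤ 1 / (84 * signalConst D V) := (min_le_left _ _).trans (min_le_left _ _)
    rw [le_div_iff₀ (by positivity)] at h1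
    linarith
  have hεD : 107520 * (D * V) * ε ≤ 1 := by
    have h1 : ε ≤ 1 / (107520 * (D * V)) := (min_le_left _ _).trans (min_le_right _ _)
    rw [le_div_iff₀ (by positivity)] at h1
    linarith
  have hεγ : 1248 * V * ε ≤ γ := by
    have h1 : ε ≤ γ / (1248 * V) := (min_le_right _ _).trans (min_le_right _ _)
    rw [le_div_iff₀ (by positivity)] at h1
    linarith
  refine ⟨ε, hε0, ?_⟩
  intro Ω _ μ _ p₁ p₂ k₁ k₂ n hk₁ hk₂ hn hp₁ hp₂ R C F U hF hU hFi hUi hFs hUs hR hC hFC t ht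
  -- If `k₁ > p₁` there is no `α`-PCA estimate, and if the error exceeds `ε` nothing is claimed; in
  -- both cases the whole space serves as event.
  by_cases hcase : k₁ ≤ p₁ ∧ pretrainError t k₁ k₂ n k₁ p₁ ≤ ε
  swap
  · refine ⟨Set.univ, MeasurableSet.univ, by simp; positivity, fun ω _ W hW hle => ?_⟩
    obtain ⟨Q, ⟨hk, _⟩, _⟩ := hW
    exact absurd ⟨hk, hle⟩ hcase
  obtain ⟨hkp, hpre⟩ := hcase
  obtain ⟨hsize, hroot⟩ := bounds_of_pretrainError_le (by linarith) hn hpre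
  have hn' : (0 : ℝ) < n := by exact_mod_cast hn
  have hp₁' : (1 : ℝ) ≤ p₁ := by exact_mod_cast hp₁
  have hp₂' : (1 : ℝ) ≤ p₂ := by exact_mod_cast hp₂
  have hk₁' : (1 : ℝ) ≤ k₁ := by exact_mod_cast hk₁
  have hlog : 0 ≤ Real.log k₁ := Real.log_nonneg hk₁'
  set kmax : ℝ := ((max k₁ k₂ : ℕ) : ℝ) with hkmax
  have hkmax1 : 1 ≤ kmax := by rw [hkmax]; exact_mod_cast (by omega : 1 ≤ max k₁ k₂)
  have hsize0 : 0 ≤ t * kmax * (Real.log k₁ + t) := by positivity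
  have hlog7 : Real.log k₁ + 7 ≤ 7 * (Real.log k₁ + t) := by linarith
  have hsmall : ∀ c : ℝ, 0 ≤ c → c * ε ≤ 1 → c * (t * kmax * (Real.log k₁ + t)) ≤ n := by
    intro c hc hcε
    calc c * (t * kmax * (Real.log k₁ + t)) ≤ c * (ε ^ 2 * n) := by gcongr
      _ ≤ c * (ε * n) := by gcongr
      _ = c * ε * n := by ring
      _ ≤ 1 * n := by gcongr
      _ = n := one_mul _
  obtain ⟨E₁, hE₁, hP₁, hB₁⟩ := exists_event_le_sum_signal hF hFi hV hFs hk₁ hk₂ hD hp₂ hC hFC ht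
    (hsmall _ (by positivity) hεS)
  have hFsum : Measurable fun ω => ∑ i, F i ω := Matrix.measurable_of_entries fun r s => by
    simp only [Matrix.sum_apply]
    exact Finset.measurable_sum _ fun i _ => Matrix.measurable_entry (hF i) r s
  obtain ⟨E₂, hE₂, hP₂, hB₂⟩ := BilinearSubGaussian.exists_event
    (V := n * V) hFsum
    (mul_pos (by exact_mod_cast hn) hVpos)
    (BilinearSubGaussian.sum hFi hFs) (by linarith : 0 ≤ t)
  have hUm : Measurable fun ω => concatMatrix fun i => U i ω :=
    Matrix.measurable_of_entries fun r q => Matrix.measurable_entry (hU q.1) r q.2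
  obtain ⟨E₃, hE₃, hP₃, hB₃⟩ := BilinearSubGaussian.exists_event hUm hVpos
    (BilinearSubGaussian.concat hUi hUs) (by linarith : 0 ≤ t)
  refine ⟨E₁ ∩ E₂ ∩ E₃, (hE₁.inter hE₂).inter hE₃, ?_, ?_⟩
  · rw [Set.compl_inter, Set.compl_inter]
    have h1 := measureReal_union_le (μ := μ) (E₁ᶜ ∪ E₂ᶜ) E₃ᶜ
    have h2 := measureReal_union_le (μ := μ) E₁ᶜ E₂ᶜ
    linarith
  rintro ω ⟨⟨hω₁, hω₂⟩, hω₃⟩ W hW -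
  -- Half of the uncentred signal level: the other half pays for subtracting the sample mean.
  set κ : ℝ := 1 / (96 * (Real.log k₁ + 7)) with hκ
  have hκpos : 0 < κ := by positivity
  set η : ℝ := 32 * V * (t + 2 * (p₁ + n * p₂)) / (n * (p₁ * p₂)) with hη
  have hηpos : 0 ≤ η := by positivity
  have hnoise : ∀ z, ∑ i, ((U i ω)ᵀ *ᵥ z) ⬝ᵥ ((U i ω)ᵀ *ᵥ z) ≤
      n * (η * (p₁ * p₂)) * (z ⬝ᵥ z) := fun z => by
    have h1 := hB₃ ω hω₃ z
    rw [concatMatrix_transpose_mulVec_sq] at h1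
    refine h1.trans (le_of_eq ?_)
    rw [hη]
    simp only [Fintype.card_fin, Fintype.card_prod]
    push_cast
    field_simp
  have hmean : ∀ y, n * ((C *ᵥ (sampleMean fun i => F i ω)ᵀ *ᵥ y) ⬝ᵥ
      (C *ᵥ (sampleMean fun i => F i ω)ᵀ *ᵥ y)) ≤ n * (κ * p₂) * (y ⬝ᵥ y) := fun y => by
    have h1 := hB₂ ω hω₂ y
    have h2 := hC ((sampleMean fun i => F i ω)ᵀ *ᵥ y)
    have hy := dotProduct_self_nonneg' y
    have h3 : (sampleMean fun i => F i ω)ᵀ *ᵥ y = (n : ℝ)⁻¹ • ((∑ i, F i ω)ᵀ *ᵥ y) := by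
      rw [sampleMean, Matrix.transpose_smul, Matrix.smul_mulVec]
    have h4 : ((sampleMean fun i => F i ω)ᵀ *ᵥ y) ⬝ᵥ ((sampleMean fun i => F i ω)ᵀ *ᵥ y) ≤
        κ / D * (y ⬝ᵥ y) := by
      rw [h3, smul_dotProduct, dotProduct_smul, smul_eq_mul, smul_eq_mul, inv_mul_le_iff₀ hn',
        inv_mul_le_iff₀ hn']
      refine h1.trans ?_
      simp only [Fintype.card_fin]
      have h5 : t + 2 * ((k₁ + k₂ : ℕ) : ℝ) ≤ 5 * (t * kmax) := by
        have h6 : ((k₁ + k₂ : ℕ) : ℝ) ≤ 2 * kmax := by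
          rw [hkmax]; exact_mod_cast (by omega : k₁ + k₂ ≤ 2 * max k₁ k₂)
        nlinarith
      have h7 : 32 * V * (t + 2 * ((k₁ + k₂ : ℕ) : ℝ)) ≤ n * (κ / D) := by
        rw [hκ, div_div, mul_one_div, le_div_iff₀ (by positivity)]
        calc _ ≤ 32 * V * (5 * (t * kmax)) * (96 * (7 * (Real.log k₁ + t)) * D) := by gcongr
          _ = 107520 * (D * V) * (t * kmax * (Real.log k₁ + t)) := by ring
          _ ≤ n := hsmall _ (by positivity) hεD
      push_cast at h7 ⊢
      calc 32 * (n * V) * (t + 2 * ((k₁ : ℝ) + k₂)) * (y ⬝ᵥ y) =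
          n * (32 * V * (t + 2 * ((k₁ : ℝ) + k₂))) * (y ⬝ᵥ y) := by ring
        _ ≤ n * (n * (κ / D)) * (y ⬝ᵥ y) := by gcongr
        _ = _ := by ring
    calc _ ≤ n * (D * p₂ * (κ / D * (y ⬝ᵥ y))) := by
          refine mul_le_mul_of_nonneg_left (h2.trans ?_) hn'.le
          exact mul_le_mul_of_nonneg_left h4 (by positivity)
      _ = _ := by field_simp
  have hsignal : ∀ y, n * (κ * p₂) * (y ⬝ᵥ y) ≤
      ∑ i, (C *ᵥ (F i ω - sampleMean fun i => F i ω)ᵀ *ᵥ y) ⬝ᵥ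
        (C *ᵥ (F i ω - sampleMean fun i => F i ω)ᵀ *ᵥ y) := fun y => by
    have h1 := sum_sub_sampleMean hn (fun i => F i ω * Cᵀ) y
    have h2 : sampleMean (fun i => F i ω * Cᵀ) = sampleMean (fun i => F i ω) * Cᵀ := by
      have := sampleMean_mul_mul (1 : Matrix (Fin k₁) (Fin k₁) ℝ) Cᵀ fun i => F i ω
      simpa only [Matrix.one_mul] using this
    rw [h2] at h1
    simp only [← Matrix.sub_mul, Matrix.transpose_mul, Matrix.transpose_transpose,
      ← Matrix.mulVec_mulVec] at h1
    rw [h1]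
    have h3 := hB₁ ω hω₁ y
    have h4 := hmean y
    have h5 : n * (1 / (48 * (Real.log k₁ + 7)) * p₂) * (y ⬝ᵥ y) =
        n * (κ * p₂) * (y ⬝ᵥ y) + n * (κ * p₂) * (y ⬝ᵥ y) := by
      rw [hκ]; field_simp; ring
    linarith
  have hηle : η * (Real.log k₁ + 7) ≤ γ := by
    refine le_trans ?_ hεγ
    have h1 := log_add_seven_div_le hk₁ hkp
    have h2 : (Real.log k₁ + 7) * t / n ≤ 7 * ε := by
      rw [div_le_iff₀ hn']
      have h3 : t * (Real.log k₁ + t) ≤ ε ^ 2 * n := by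
        refine le_trans ?_ hsize
        have : t * 1 * (Real.log k₁ + t) ≤ t * kmax * (Real.log k₁ + t) := by gcongr
        linarith
      have h4 : ε ^ 2 * n ≤ ε * n := by gcongr
      have h5 : (Real.log k₁ + 7) * t ≤ 7 * (Real.log k₁ + t) * t := by gcongr
      linarith
    have h6 : η ≤ 32 * V * (3 * (t / n) + 2 * (1 / p₁)) := by
      -- The noise level splits into three terms; since `t ≥ 1`, those carrying `1/n` are all
      -- dominated by multiples of `t/n`.
      have h7 : t / (n * (p₁ * p₂)) ≤ t / n :=
        div_le_div_of_nonneg_left (by linarith) hn'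
          (le_mul_of_one_le_right hn'.le (one_le_mul_of_one_le_of_one_le hp₁' hp₂'))
      have h8 : 2 * (1 / (n * p₂) : ℝ) ≤ 2 * (t / n) := by
        refine mul_le_mul_of_nonneg_left ?_ (by norm_num)
        exact div_le_div₀ (by linarith) ht hn' (le_mul_of_one_le_right hn'.le hp₂')
      have h9 : η = 32 * V * (t / (n * (p₁ * p₂)) + 2 * (1 / (n * p₂)) + 2 * (1 / p₁)) := by
        rw [hη]; field_simp; ring
      rw [h9]
      gcongr
      linarith
    calc η * (Real.log k₁ + 7) ≤ 32 * V * (3 * (t / n) + 2 * (1 / p₁)) * (Real.log k₁ + 7) := by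
          gcongr
      _ = 32 * V * (3 * ((Real.log k₁ + 7) * t / n) + 2 * ((Real.log k₁ + 7) / p₁)) := by ring
      _ ≤ 32 * V * (3 * (7 * ε) + 2 * (9 * ε)) := by
          gcongr
          exact h1.trans (by gcongr)
      _ = 1248 * V * ε := by ring
  have hηκ : 4 * (2 + |α|) * η ≤ cR * κ := by
    rw [hκ, mul_one_div, le_div_iff₀ (by positivity)]
    rw [hγ, le_div_iff₀ (by positivity)] at hηle
    linarith
  refine le_nuMin hk₁ _ fun u => ?_
  rw [Real.sq_sqrt (by positivity)]
  exact hW.le_transformationMatrix hα hn hp₁ hp₂ hηpos hκpos hR hnoise hsignal hηκ u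

end RowBound

/-! ### Subsamples and transposition of the model, and assembly of the theorem. -/

section Model

variable {Ω : Type*} [MeasurableSpace Ω] {μ : Measure Ω} {p₁ p₂ k₁ k₂ : ℕ}

theorem WeaklyCorrelatedSubGaussian.precomp {I J : Type*} {a b : ℕ}
    {A : I → Ω → Matrix (Fin a) (Fin b) ℝ} {c₀ : ℝ} {K : ℝ≥0}
    (h : WeaklyCorrelatedSubGaussian μ A c₀ K) (e : J → I) :
    WeaklyCorrelatedSubGaussian μ (fun j => A (e j)) c₀ K := by
  obtain ⟨S₁, S₂, Z, h1, h2, h3, h4, h5⟩ := h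
  exact ⟨S₁, S₂, fun j => Z (e j), h1, h2, fun j => h3 (e j), fun j => h4 (e j),
    fun j => h5 (e j)⟩

theorem IsSubGaussianMFM.precomp {I J : Type*} {R : Matrix (Fin p₁) (Fin k₁) ℝ}
    {C : Matrix (Fin p₂) (Fin k₂) ℝ} {F : I → Ω → Matrix (Fin k₁) (Fin k₂) ℝ}
    {U : I → Ω → Matrix (Fin p₁) (Fin p₂) ℝ} {c₀ : ℝ} {K : ℝ≥0} {cR CR cC CC cU : ℝ}
    (h : IsSubGaussianMFM μ R C F U c₀ K cR CR cC CC cU) {e : J → I} (he : e.Injective) :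
    IsSubGaussianMFM μ R C (fun j => F (e j)) (fun j => U (e j)) c₀ K cR CR cC CC cU where
  measurable_factor j := h.measurable_factor (e j)
  measurable_idio j := h.measurable_idio (e j)
  indep := h.indep.precomp he
  identDistrib i j := h.identDistrib (e i) (e j)
  gram_row := h.gram_row
  gram_col := h.gram_col
  normalize_row j := h.normalize_row (e j)
  normalize_col j := h.normalize_col (e j)
  factor_subGaussian := h.factor_subGaussian.precomp e
  idio_subGaussian := h.idio_subGaussian.precomp e
  idio_rows j := h.idio_rows (e j)
  idio_cols j := h.idio_cols (e j)

omit [MeasurableSpace Ω] in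
theorem mfmObs_transpose {I : Type*} (R : Matrix (Fin p₁) (Fin k₁) ℝ)
    (C : Matrix (Fin p₂) (Fin k₂) ℝ) (F : I → Ω → Matrix (Fin k₁) (Fin k₂) ℝ)
    (U : I → Ω → Matrix (Fin p₁) (Fin p₂) ℝ) (i : I) (ω : Ω) :
    (mfmObs R C F U i ω)ᵀ = mfmObs C R (fun i ω => (F i ω)ᵀ) (fun i ω => (U i ω)ᵀ) i ω := by
  simp only [mfmObs, Matrix.transpose_add, Matrix.transpose_mul, Matrix.transpose_transpose,
    Matrix.mul_assoc]

theorem measurable_mfm_map (R : Matrix (Fin p₁) (Fin k₁) ℝ) (C : Matrix (Fin p₂) (Fin k₂) ℝ) :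
    Measurable fun q : Matrix (Fin k₁) (Fin k₂) ℝ × Matrix (Fin p₁) (Fin p₂) ℝ =>
      R * q.1 * Cᵀ + q.2 := by
  have h1 : Measurable fun q : Matrix (Fin k₁) (Fin k₂) ℝ × Matrix (Fin p₁) (Fin p₂) ℝ =>
      R * q.1 * Cᵀ :=
    Matrix.measurable_mul (Matrix.measurable_mul measurable_const measurable_fst) measurable_const
  exact Matrix.measurable_of_entries fun r s =>
    (Matrix.measurable_entry h1 r s).add (Matrix.measurable_entry measurable_snd r s)

end Model

theorem pretrainError_nonneg (t : ℝ) (k₁ k₂ n k p : ℕ) : 0 ≤ pretrainError t k₁ k₂ n k p := by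
  unfold pretrainError
  positivity

/-- Two-sided bounds on the singular values of the transformation matrices. -/
theorem exists_singularValue_bounds (α c₀ : ℝ) (K : ℝ≥0) (cR CR cC CC cU : ℝ)
    (hα : -1 ≤ α) (hcR : 0 < cR) (hcC : 0 < cC) :
    ∃ c₁ c₂ c₃ : ℝ, 0 < c₁ ∧ 0 < c₂ ∧ 0 < c₃ ∧
      ∀ (Ω : Type*) [MeasurableSpace Ω] (μ : Measure Ω) [IsProbabilityMeasure μ]
        (p₁ p₂ k₁ k₂ n : ℕ), 0 < k₁ → 0 < k₂ → 0 < n →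
      ∀ (R : Matrix (Fin p₁) (Fin k₁) ℝ) (C : Matrix (Fin p₂) (Fin k₂) ℝ)
        (F : Fin n → Ω → Matrix (Fin k₁) (Fin k₂) ℝ)
        (U : Fin n → Ω → Matrix (Fin p₁) (Fin p₂) ℝ),
        IsSubGaussianMFM μ R C F U c₀ K cR CR cC CC cU →
      ∀ t : ℝ, 0 < t →
        ∃ E : Set Ω, MeasurableSet E ∧ 1 - 11 * Real.exp (-t) ≤ μ.real E ∧
          ∀ ω ∈ E, ∀ (W₁ : Matrix (Fin p₁) (Fin k₁) ℝ) (W₂ : Matrix (Fin p₂) (Fin k₂) ℝ),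
            IsAlphaPCARow α (fun i => mfmObs R C F U i ω) W₁ →
            IsAlphaPCACol α (fun i => mfmObs R C F U i ω) W₂ →
            (c₁ - c₂ * pretrainError t k₁ k₂ n k₁ p₁ ≤ nuMin (transformationMatrix W₁ R) ∧
              nuMin (transformationMatrix W₁ R) ≤ nuMax (transformationMatrix W₁ R) ∧
              nuMax (transformationMatrix W₁ R) ≤ c₃) ∧
            (c₁ - c₂ * pretrainError t k₁ k₂ n k₂ p₂ ≤ nuMin (transformationMatrix W₂ C) ∧
              nuMin (transformationMatrix W₂ C) ≤ nuMax (transformationMatrix W₂ C) ∧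
              nuMax (transformationMatrix W₂ C) ≤ c₃) := by
  set D := max 1 (max CR CC) with hD
  have hD1 : 1 ≤ D := le_max_left _ _
  have hCRD : CR ≤ D := (le_max_left _ _).trans (le_max_right _ _)
  have hCCD : CC ≤ D := (le_max_right _ _).trans (le_max_right _ _)
  set V : ℝ≥0 := K * c₀.toNNReal ^ 4 + 1 with hV
  have hV1 : 1 ≤ V := le_add_of_nonneg_left zero_le
  obtain ⟨ε₁, hε₁, H₁⟩ := exists_row_threshold α hα hcR hD1 hV1
  obtain ⟨ε₂, hε₂, H₂⟩ := exists_row_threshold α hα hcC hD1 hV1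
  set c := min √(cR / 2) √(cC / 2) with hc
  have hcpos : 0 < c := lt_min (Real.sqrt_pos.2 (by positivity)) (Real.sqrt_pos.2 (by positivity))
  set ε := min ε₁ ε₂ with hε
  have hεpos : 0 < ε := lt_min hε₁ hε₂
  -- The slope `c / ε` turns a threshold statement into an affine bound: for `δ > ε` the left side
  -- is negative.
  have hlow : ∀ δ s : ℝ, 0 ≤ δ → 0 ≤ s → (δ ≤ ε → c ≤ s) → c - c / ε * δ ≤ s := by
    intro δ s hδ hs0 hs
    rcases le_or_gt δ ε with h | h
    · have : 0 ≤ c / ε * δ := by positivity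
      linarith [hs h]
    · have : c ≤ c / ε * δ := by
        rw [div_mul_eq_mul_div, le_div_iff₀ hεpos]
        gcongr
      linarith
  refine ⟨c, c / ε, √D, hcpos, by positivity, Real.sqrt_pos.2 (by linarith), ?_⟩
  intro Ω _ μ _ p₁ p₂ k₁ k₂ n hk₁ hk₂ hn R C F U hmodel t ht
  -- For `t < 1` one has `11 exp (-t) > 11/3`, so the empty event will do.
  rcases lt_or_ge t 1 with ht1 | ht1
  · refine ⟨∅, MeasurableSet.empty, ?_, fun ω hω => absurd hω (Set.notMem_empty ω)⟩
    rw [measureReal_empty]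
    have h1 : Real.exp (-1) ≤ Real.exp (-t) := Real.exp_le_exp.2 (by linarith)
    have h2 : 1 / 3 ≤ Real.exp (-1) := by
      rw [Real.exp_neg, ← one_div]
      exact one_div_le_one_div_of_le (Real.exp_pos _) (by linarith [Real.exp_one_lt_d9])
    linarith
  have hp₁ := pos_of_pos_le_eigenvalues_gram hk₁ R hcR fun a => (hmodel.gram_row a).1
  have hp₂ := pos_of_pos_le_eigenvalues_gram hk₂ C hcC fun a => (hmodel.gram_col a).1
  have hRD : ∀ u, (R *ᵥ u) ⬝ᵥ (R *ᵥ u) ≤ D * p₁ * (u ⬝ᵥ u) :=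
    dotProduct_le_of_eigenvalues_gram_le hp₁ R fun a => (hmodel.gram_row a).2.trans hCRD
  have hCD : ∀ u, (C *ᵥ u) ⬝ᵥ (C *ᵥ u) ≤ D * p₂ * (u ⬝ᵥ u) :=
    dotProduct_le_of_eigenvalues_gram_le hp₂ C fun a => (hmodel.gram_col a).2.trans hCCD
  have hFi : iIndepFun F μ := hmodel.indep.comp (fun _ => Prod.fst) fun _ => measurable_fst
  have hUi : iIndepFun U μ := hmodel.indep.comp (fun _ => Prod.snd) fun _ => measurable_snd
  have hFs : ∀ i, BilinearSubGaussian μ (F i) V := fun i =>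
    (hmodel.factor_subGaussian.bilinearSubGaussian i).mono (le_add_of_nonneg_right zero_le)
  have hUs : ∀ i, BilinearSubGaussian μ (U i) V := fun i =>
    (hmodel.idio_subGaussian.bilinearSubGaussian i).mono (le_add_of_nonneg_right zero_le)
  have hFtm : ∀ i, Measurable fun ω => (F i ω)ᵀ := fun i =>
    Matrix.measurable_transpose (hmodel.measurable_factor i)
  have htr : ∀ a b : ℕ, Measurable fun A : Matrix (Fin a) (Fin b) ℝ => Aᵀ := fun a b =>
    Matrix.measurable_transpose measurable_id
  obtain ⟨E₁, hE₁, hP₁, hB₁⟩ := H₁ Ω μ p₁ p₂ k₁ k₂ n hk₁ hk₂ hn hp₁ hp₂ R C F U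
    hmodel.measurable_factor hmodel.measurable_idio hFi hUi hFs hUs
    (le_dotProduct_of_le_eigenvalues_gram hp₁ R fun a => (hmodel.gram_row a).1) hCD
    (fun i => integral_mulVec_transpose_sq_of_normalized (hmodel.measurable_factor i) (hFs i) hp₂
      (by linarith) hCD (hmodel.normalize_col i)) t ht1
  obtain ⟨E₂, hE₂, hP₂, hB₂⟩ := H₂ Ω μ p₂ p₁ k₂ k₁ n hk₂ hk₁ hn hp₂ hp₁ C R
    (fun i ω => (F i ω)ᵀ) (fun i ω => (U i ω)ᵀ) hFtm
    (fun i => Matrix.measurable_transpose (hmodel.measurable_idio i))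
    (hFi.comp (fun _ => Matrix.transpose) fun _ => htr _ _)
    (hUi.comp (fun _ => Matrix.transpose) fun _ => htr _ _)
    (fun i => (hFs i).transpose) (fun i => (hUs i).transpose)
    (le_dotProduct_of_le_eigenvalues_gram hp₂ C fun a => (hmodel.gram_col a).1) hRD
    (fun i => integral_mulVec_transpose_sq_of_normalized (hFtm i) (hFs i).transpose hp₁
      (by linarith) hRD (hmodel.normalize_row i)) t ht1
  -- Rows and columns fail with probability at most `3 exp (-t)` each, within the allowance of `11
  -- exp (-t)`.
  refine ⟨E₁ ∩ E₂, hE₁.inter hE₂, ?_, ?_⟩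
  · have h1 := measureReal_union_le (μ := μ) E₁ᶜ E₂ᶜ
    rw [← Set.compl_inter, probReal_compl_eq_one_sub (hE₁.inter hE₂)] at h1
    have := Real.exp_pos (-t)
    linarith
  rintro ω ⟨hω₁, hω₂⟩ W₁ W₂ hW₁ hW₂
  have hW₂' : IsAlphaPCARow α
      (fun i => mfmObs C R (fun i ω => (F i ω)ᵀ) (fun i ω => (U i ω)ᵀ) i ω) W₂ := by
    simp_rw [← mfmObs_transpose]
    exact hW₂
  have hDsq : √D ^ 2 = D := Real.sq_sqrt (by linarith)
  have hsymm : pretrainError t k₁ k₂ n k₂ p₂ = pretrainError t k₂ k₁ n k₂ p₂ := by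
    rw [pretrainError, pretrainError, max_comm]
  refine ⟨⟨hlow _ _ (pretrainError_nonneg ..) (nuMin_nonneg _) fun h => ?_, nuMin_le_nuMax _, ?_⟩,
    hlow _ _ (pretrainError_nonneg ..) (nuMin_nonneg _) fun h => ?_, nuMin_le_nuMax _, ?_⟩
  · exact (min_le_left _ _).trans (hB₁ ω hω₁ W₁ hW₁ (h.trans (min_le_left _ _)))
  · refine nuMax_le hk₁ _ (Real.sqrt_nonneg _) ?_
    rw [hDsq]
    exact hW₁.transformationMatrix_le hp₁ R hRD
  · rw [hsymm] at h
    exact (min_le_right _ _).trans (hB₂ ω hω₂ W₂ hW₂' (h.trans (min_le_right _ _)))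
  · refine nuMax_le hk₂ _ (Real.sqrt_nonneg _) ?_
    rw [hDsq]
    exact hW₂'.transformationMatrix_le hp₂ C hCD

theorem mainTheorem4 (α c₀ : ℝ) (K : ℝ≥0) (cR CR cC CC cU : ℝ)
    (hα : -1 ≤ α) (hcR : 0 < cR) (hcC : 0 < cC) :
    -- the two-sided bound on the singular values of the transformation matrices
    (∃ c₁ c₂ c₃ : ℝ, 0 < c₁ ∧ 0 < c₂ ∧ 0 < c₃ ∧
      ∀ (Ω : Type*) [MeasurableSpace Ω] (μ : Measure Ω) [IsProbabilityMeasure μ]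
        (p₁ p₂ k₁ k₂ n : ℕ), 0 < k₁ → 0 < k₂ → 0 < n →
      ∀ (R : Matrix (Fin p₁) (Fin k₁) ℝ) (C : Matrix (Fin p₂) (Fin k₂) ℝ)
        (F : Fin n → Ω → Matrix (Fin k₁) (Fin k₂) ℝ)
        (U : Fin n → Ω → Matrix (Fin p₁) (Fin p₂) ℝ),
        IsSubGaussianMFM μ R C F U c₀ K cR CR cC CC cU →
      ∀ t : ℝ, 0 < t →
        ∃ E : Set Ω, MeasurableSet E ∧ 1 - 11 * Real.exp (-t) ≤ μ.real E ∧
          ∀ ω ∈ E, ∀ (W₁ : Matrix (Fin p₁) (Fin k₁) ℝ) (W₂ : Matrix (Fin p₂) (Fin k₂) ℝ),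
            IsAlphaPCARow α (fun i => mfmObs R C F U i ω) W₁ →
            IsAlphaPCACol α (fun i => mfmObs R C F U i ω) W₂ →
            (c₁ - c₂ * pretrainError t k₁ k₂ n k₁ p₁ ≤ nuMin (transformationMatrix W₁ R) ∧
              nuMin (transformationMatrix W₁ R) ≤ nuMax (transformationMatrix W₁ R) ∧
              nuMax (transformationMatrix W₁ R) ≤ c₃) ∧
            (c₁ - c₂ * pretrainError t k₁ k₂ n k₂ p₂ ≤ nuMin (transformationMatrix W₂ C) ∧
              nuMin (transformationMatrix W₂ C) ≤ nuMax (transformationMatrix W₂ C) ∧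
              nuMax (transformationMatrix W₂ C) ≤ c₃)) ∧
    -- data splitting: `ν_min(H_j) ≫ p_j^{-1/2}`, and independence of the main sample
    (∀ M : ℝ, 0 < M → ∃ ε : ℝ, 0 < ε ∧
      ∀ (Ω : Type*) [MeasurableSpace Ω] (μ : Measure Ω) [IsProbabilityMeasure μ]
        (p₁ p₂ k₁ k₂ n N : ℕ), 0 < k₁ → 0 < k₂ → 0 < n →
      ∀ (R : Matrix (Fin p₁) (Fin k₁) ℝ) (C : Matrix (Fin p₂) (Fin k₂) ℝ)
        (F : Fin n ⊕ Fin N → Ω → Matrix (Fin k₁) (Fin k₂) ℝ)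
        (U : Fin n ⊕ Fin N → Ω → Matrix (Fin p₁) (Fin p₂) ℝ),
        IsSubGaussianMFM μ R C F U c₀ K cR CR cC CC cU →
      ∀ (w₁ : (Fin n → Matrix (Fin p₁) (Fin p₂) ℝ) → Matrix (Fin p₁) (Fin k₁) ℝ)
        (w₂ : (Fin n → Matrix (Fin p₁) (Fin p₂) ℝ) → Matrix (Fin p₂) (Fin k₂) ℝ),
        Measurable w₁ → Measurable w₂ →
        (∀ x, IsAlphaPCARow α x (w₁ x)) → (∀ x, IsAlphaPCACol α x (w₂ x)) →
      ∀ (W₁ : Ω → Matrix (Fin p₁) (Fin k₁) ℝ) (W₂ : Ω → Matrix (Fin p₂) (Fin k₂) ℝ),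
        (∀ ω, W₁ ω = w₁ fun i => mfmObs R C F U (Sum.inl i) ω) →
        (∀ ω, W₂ ω = w₂ fun i => mfmObs R C F U (Sum.inl i) ω) →
        IndepFun (fun ω => (W₁ ω, W₂ ω)) (fun ω (i : Fin N) => mfmObs R C F U (Sum.inr i) ω) μ ∧
        ∀ t : ℝ, 0 < t → pretrainError t k₁ k₂ n k₁ p₁ ≤ ε → pretrainError t k₁ k₂ n k₂ p₂ ≤ ε →
          1 - 11 * Real.exp (-t) ≤ μ.real {ω |
            M / √(p₁ : ℝ) ≤ nuMin (transformationMatrix (W₁ ω) R) ∧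
            M / √(p₂ : ℝ) ≤ nuMin (transformationMatrix (W₂ ω) C)}) := by
  refine ⟨exists_singularValue_bounds α c₀ K cR CR cC CC cU hα hcR hcC, fun M hM => ?_⟩
  obtain ⟨c₁, c₂, c₃, hc₁, hc₂, -, H⟩ :=
    exists_singularValue_bounds α c₀ K cR CR cC CC cU hα hcR hcC
  have hcM : 0 < c₂ + M := by linarith
  -- Since `1/√p` is a summand of `δ`, `(c₂ + M) δ ≤ c₁` gives `M/√p ≤ M δ ≤ c₁ - c₂ δ`.
  refine ⟨c₁ / (c₂ + M), by positivity, ?_⟩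
  intro Ω _ μ _ p₁ p₂ k₁ k₂ n N hk₁ hk₂ hn R C F U hmodel w₁ w₂ hw₁ hw₂ hpca₁ hpca₂ W₁ W₂ hW₁ hW₂
  constructor
  · have hind : iIndepFun (fun i => mfmObs R C F U i) μ :=
      hmodel.indep.comp (fun _ q => R * q.1 * Cᵀ + q.2) fun _ => measurable_mfm_map R C
    have hmeas : ∀ i, Measurable (mfmObs R C F U i) := fun i => by
      have hp := (hmodel.measurable_factor i).prodMk (hmodel.measurable_idio i)
      have h := Measurable.comp (measurable_mfm_map R C) hp
      exact h
    have hleft : Measurable fun (a : Fin n ⊕ Fin N → Matrix (Fin p₁) (Fin p₂) ℝ) (i : Fin n) =>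
        a (Sum.inl i) := measurable_pi_iff.2 fun i => measurable_pi_apply _
    have hright : Measurable fun (a : Fin n ⊕ Fin N → Matrix (Fin p₁) (Fin p₂) ℝ) (i : Fin N) =>
        a (Sum.inr i) := measurable_pi_iff.2 fun i => measurable_pi_apply _
    have hdisj : Disjoint (Finset.univ.map (Function.Embedding.inl : Fin n ↪ Fin n ⊕ Fin N))
        (Finset.univ.map (Function.Embedding.inr : Fin N ↪ Fin n ⊕ Fin N)) := by
      rw [Finset.disjoint_left]
      simp
    have hw : Measurable fun a : Fin n ⊕ Fin N → Matrix (Fin p₁) (Fin p₂) ℝ =>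
        (w₁ fun i => a (Sum.inl i), w₂ fun i => a (Sum.inl i)) :=
      Measurable.prodMk (hw₁.comp hleft) (hw₂.comp hleft)
    -- The projection matrices depend only on the `Sum.inl` coordinates and the main sample only on
    -- the `Sum.inr` ones.
    have h := iIndepFun.indepFun_of_dependsOn hind hmeas hdisj
      (f := fun a => (w₁ fun i => a (Sum.inl i), w₂ fun i => a (Sum.inl i)))
      (g := fun a i => a (Sum.inr i))
      hw hright
      (fun a b hab => by
        have : (fun i => a (Sum.inl i)) = fun i => b (Sum.inl i) :=
          funext fun i => hab _ (Finset.mem_map_of_mem _ (Finset.mem_univ i))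
        simp only [this])
      (fun a b hab => funext fun i =>
        hab _ (Finset.mem_map_of_mem Function.Embedding.inr (Finset.mem_univ i)))
    have hW : (fun ω => (W₁ ω, W₂ ω)) = fun ω => (w₁ fun i => mfmObs R C F U (Sum.inl i) ω,
        w₂ fun i => mfmObs R C F U (Sum.inl i) ω) := funext fun ω => by rw [hW₁, hW₂]
    rw [hW]
    exact h
  · intro t ht hδ₁ hδ₂
    obtain ⟨E, -, hEp, hE⟩ := H Ω μ p₁ p₂ k₁ k₂ n hk₁ hk₂ hn R C (fun i => F (Sum.inl i))
      (fun i => U (Sum.inl i)) (hmodel.precomp Sum.inl_injective) t ht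
    refine hEp.trans (measureReal_mono (fun ω hω => ?_))
    have h := hE ω hω (W₁ ω) (W₂ ω) (by rw [hW₁]; exact hpca₁ _) (by rw [hW₂]; exact hpca₂ _)
    have key : ∀ k p : ℕ, pretrainError t k₁ k₂ n k p ≤ c₁ / (c₂ + M) →
        M / √(p : ℝ) ≤ c₁ - c₂ * pretrainError t k₁ k₂ n k p := fun k p hδ => by
      have h1 := (bounds_of_pretrainError_le ht.le hn hδ).2
      rw [le_div_iff₀ hcM] at h1 hδ
      have h2 : M / √(p : ℝ) = M * (1 / √(p : ℝ)) := by ring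
      have h3 : 1 / √(p : ℝ) ≤ pretrainError t k₁ k₂ n k p :=
        (bounds_of_pretrainError_le ht.le hn le_rfl).2
      rw [h2]
      have h4 := mul_le_mul_of_nonneg_left h3 hM.le
      linarith
    exact ⟨(key k₁ p₁ hδ₁).trans h.1.1, (key k₂ p₂ hδ₂).trans h.2.1⟩
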